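/- Let $p$ be an odd prime and $\mathbb F_p=\mathbb Z/p\mathbb Z$. **$\dagger$-compact closed categories.** A $\dagger$-compact closed category is a symmetric monoidal category with an involutive, identity-on-objects, contravariant functor $(-)^\dagger$ which preserves $\otimes$ and for which the associators, unitors and symmetries are unitary (their dagger is their inverse), such that every object $X$ has a chosen dual $X^*$ with a cup $\eta_X:I\to X\otimes X^*$ and a cap $\epsilon_X:X^*\otimes X\to I$ that satisfy the snake equations and $\epsilon_X^\dagger=\mathrm{swap}_{X,X^*}\circ\eta_X$. A $\dagger$-compact functor is a strong symmetric monoidal functor that commutes with daggers, has unitary structure isomorphisms, and preserves duals up to unitary isomorphisms compatible with the cups. For a $\dagger$-compact closed category $\mathsf C$, $\mathrm{Proj}(\mathsf C)$ is the $\dagger$-compact closed category with the same objects and with morphisms taken modulo $f\sim s\cdot f$, for $s:I\to I$ an invertible scalar. **Stabiliser maps.** Let $\mathcal H_p=\mathbb C^p$ with orthonormal basis $\{|x\rangle : x\in\mathbb F_p\}$, and let $\xi(x)=e^{2\pi i x/p}$, $X|x\rangle=|x+1\rangle$, $Z|x\rangle=\xi(x)|x\rangle$. The $n$-qupit Pauli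 group consists of the operators $\xi(y)\bigotimes_{j=1}^n X^{x_j}Z^{z_j}$ on $\mathcal H_p^{\otimes n}$ with $y,x_j,z_j\in\mathbb F_p$. The Clifford group consists of the unitaries $U$ on $\mathcal H_p^{\otimes n}$ such that $UPU^\dagger$ is a Pauli operator for every Pauli operator $P$. A stabiliser group is a maximal element among the abelian subgroups of the Pauli group that contain $\xi(a)1$ only for $a=0$; a stabiliser state is a unit vector fixed by all elements of some stabiliser group. $\mathsf{Stab}_p$ is the $\dagger$-compact closed category with objects $\mathcal H_p^{\otimes n}$, $n\ge 0$, whose morphisms are the linear maps generated by the stabiliser states (as maps $\mathbb C\to\mathcal H_p^{\otimes n}$), the Clifford operators and the scalars $\sqrt p$, $1/\sqrt p$ under composition, tensor product and Hermitian adjoint; each object is its own dual, with cup $\sum_x |x\rangle\otimes|x\rangle$. **Mixed stabiliser maps.** $\mathrm{CPM}(\mathsf{Stab}_p)$ is the $\dagger$-compact closed category with the objects of $\mathsf{Stab}_p$. Its morphisms $X\to Y$ are the classes $[f,S]$ of pairs of an object $S$ and a map $f:X\otimes S\to Y$ of $\mathsf{Stab}_p$, where $(f,S)\sim(g,T)$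 if and only if the doubled maps $X\otimes X^*\to Y\otimes Y^*$ agree; the doubled map of $(f,S)$ is $f\otimes f_*$ precomposed with the cup of $S$ on the inputs $S$ and $S^*$, where $f_*=(f^\dagger)^*$. The remaining structure is inherited from $\mathsf{Stab}_p$: identities, coherence maps, cups and caps are the classes $[g,I]$ of those of $\mathsf{Stab}_p$, environments are tensored under composition and tensor product, and the dagger of $[f,S]$ is represented by $f^\dagger:Y\to X\otimes S$ with the output $S$ bent to an input $S^*$. **Affine coisotropic relations.** $\mathsf{ACR}$ is the $\dagger$-compact closed category whose objects are the finite-dimensional symplectic vector spaces $(V,\omega_V)$ over $\mathbb F_p$ (that is, $\omega_V$ is an alternating nondegenerate bilinear form). A morphism $(V,\omega_V)\to(W,\omega_W)$ is an affine coisotropic subspace $R$ of $(V\oplus W,\,-\omega_V\oplus\omega_W)$: an affine subspace that is either empty or whose linear component contains its own symplectic complement. Composition is composition of relations, the identities are the diagonals, the tensor product is the direct sum, with unit the zero space and the evident coherence maps, the dagger is the relational converse, the dual of $(V,\omega_V)$ is $(V,-\omega_V)$, and the cup is $\{(\bullet,(v,v)) : v\in V\}$. **Theorem.** There is an essentially surjective,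 full, $\dagger$-compact functor $$\mathrm{Rel}:\mathrm{CPM}(\mathsf{Stab}_p)\longrightarrow\mathsf{ACR}$$ which factors, as a $\dagger$-compact functor, through the quotient functor $\mathrm{CPM}(\mathsf{Stab}_p)\to\mathrm{Proj}(\mathrm{CPM}(\mathsf{Stab}_p))$, and the induced $\dagger$-compact functor $$\mathrm{Proj}(\mathrm{CPM}(\mathsf{Stab}_p))\longrightarrow\mathsf{ACR}$$ is an equivalence of categories. -/

import Mathlib

open CategoryTheory MonoidalCategory

universe v u v' u' v'' u''

/-- A dagger on a category: an involutive, identity-on-objects contravariant functor. -/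
class DaggerCategory (C : Type u) [Category.{v} C] where
  dag : ∀ {X Y : C}, (X ⟶ Y) → (Y ⟶ X)
  dag_id : ∀ X : C, dag (𝟙 X) = 𝟙 X
  dag_comp : ∀ {X Y Z : C} (f : X ⟶ Y) (g : Y ⟶ Z), dag (f ≫ g) = dag g ≫ dag f
  dag_dag : ∀ {X Y : C} (f : X ⟶ Y), dag (dag f) = f


/-- A morphism whose dagger is its two-sided inverse. -/
def IsUnitary {C : Type u} [Category.{v} C] [DaggerCategory C] {X Y : C} (f : X ⟶ Y) : Prop :=
  f ≫ DaggerCategory.dag f = 𝟙 X ∧ DaggerCategory.dag f ≫ f = 𝟙 Y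

/-- A `†`-symmetric monoidal category (not necessarily strict): the dagger is a monoidal functor,
and the coherence isomorphisms are unitary. -/
class DaggerSymmetricCategory (C : Type u) [Category.{v} C] [MonoidalCategory C]
    [SymmetricCategory C] extends DaggerCategory C where
  dag_tensorHom : ∀ {X Y X' Y' : C} (f : X ⟶ Y) (g : X' ⟶ Y'),
    dag (f ⊗ₘ g) = dag f ⊗ₘ dag g
  dag_associator_hom : ∀ X Y Z : C, dag (α_ X Y Z).hom = (α_ X Y Z).inv
  dag_leftUnitor_hom : ∀ X : C, dag (λ_ X).hom = (λ_ X).inv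
  dag_rightUnitor_hom : ∀ X : C, dag (ρ_ X).hom = (ρ_ X).inv
  dag_braiding_hom : ∀ X Y : C, dag (β_ X Y).hom = (β_ X Y).inv

/-- A `†`-compact closed category: every object `X` has a chosen dual `Xᘁ`, with a cup
`η_ X Xᘁ : 𝟙 ⟶ X ⊗ Xᘁ` and a cap `ε_ X Xᘁ : Xᘁ ⊗ X ⟶ 𝟙` satisfying the snake equations (this is
`RightRigidCategory`), and the cap is the dagger of the cup followed by the symmetry. -/
class DaggerCompactCategory (C : Type u) [Category.{v} C] [MonoidalCategory C]
    [SymmetricCategory C] [RightRigidCategory C] extends DaggerSymmetricCategory C where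
  dag_cap : ∀ X : C, dag (ε_ X Xᘁ) = η_ X Xᘁ ≫ (β_ X Xᘁ).hom

/-- A `†`-compact functor: a strong symmetric monoidal functor preserving the dagger, with unitary
structure isomorphisms, and preserving duals up to unitary isomorphisms that match the cups (the
caps are then matched as well, because they are determined by the cups and the dagger). -/
structure DaggerCompactFunctor (C : Type u) [Category.{v} C] [MonoidalCategory C]
    [SymmetricCategory C] [RightRigidCategory C] [DaggerCompactCategory C]
    (D : Type u') [Category.{v'} D] [MonoidalCategory D]
    [SymmetricCategory D] [RightRigidCategory D] [DaggerCompactCategory D] where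
  functor : C ⥤ D
  braided : functor.Braided
  map_dag : ∀ {X Y : C} (f : X ⟶ Y),
    functor.map (DaggerCategory.dag f) = DaggerCategory.dag (functor.map f)
  unitary_unit : IsUnitary (Functor.LaxMonoidal.ε functor)
  unitary_tensor : ∀ X Y : C, IsUnitary (Functor.LaxMonoidal.μ functor X Y)
  map_cup : ∀ X : C, ∃ θ : functor.obj Xᘁ ⟶ (functor.obj X)ᘁ, IsUnitary θ ∧
    Functor.LaxMonoidal.ε functor ≫ functor.map (η_ X Xᘁ) ≫
      Functor.OplaxMonoidal.δ functor X Xᘁ ≫ functor.obj X ◁ θ =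
        η_ (functor.obj X) (functor.obj X)ᘁ

namespace DaggerCompactFunctor

open Functor.LaxMonoidal Functor.OplaxMonoidal

/-- Composition of `†`-compact functors. -/
def comp {C : Type u} [Category.{v} C] [MonoidalCategory C]
    [SymmetricCategory C] [RightRigidCategory C] [DaggerCompactCategory C]
    {D : Type u'} [Category.{v'} D] [MonoidalCategory D]
    [SymmetricCategory D] [RightRigidCategory D] [DaggerCompactCategory D]
    {E : Type u''} [Category.{v''} E] [MonoidalCategory E]
    [SymmetricCategory E] [RightRigidCategory E] [DaggerCompactCategory E]
    (F : DaggerCompactFunctor C D) (G : DaggerCompactFunctor D E) : DaggerCompactFunctor C E where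
  functor := F.functor ⋙ G.functor
  braided :=
    letI := F.braided
    letI := G.braided
    inferInstance
  map_dag f := by simp [F.map_dag, G.map_dag]
  unitary_unit := by
    let := F.braided
    let := G.braided
    have h1 := F.unitary_unit
    have h2 := G.unitary_unit
    constructor
    · rw [comp_ε, DaggerCategory.dag_comp, ← G.map_dag, Category.assoc, ← G.functor.map_comp_assoc,
        h1.1, G.functor.map_id, Category.id_comp, h2.1]
    · rw [comp_ε, DaggerCategory.dag_comp, ← G.map_dag, Category.assoc, reassoc_of% h2.2,
        ← G.functor.map_comp, h1.2, G.functor.map_id]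
      rfl
  unitary_tensor X Y := by
    let := F.braided
    let := G.braided
    have h1 := F.unitary_tensor X Y
    have h2 := G.unitary_tensor (F.functor.obj X) (F.functor.obj Y)
    constructor
    · rw [comp_μ, DaggerCategory.dag_comp, ← G.map_dag, Category.assoc, ← G.functor.map_comp_assoc,
        h1.1, G.functor.map_id, Category.id_comp, h2.1]
      rfl
    · rw [comp_μ, DaggerCategory.dag_comp, ← G.map_dag, Category.assoc, reassoc_of% h2.2,
        ← G.functor.map_comp, h1.2, G.functor.map_id]
      rfl
  map_cup X := by
    let := F.braided
    let := G.braided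
    obtain ⟨θ, hθ, h1⟩ := F.map_cup X
    obtain ⟨κ, hκ, h2⟩ := G.map_cup (F.functor.obj X)
    refine ⟨G.functor.map θ ≫ κ, ⟨?_, ?_⟩, ?_⟩
    · rw [DaggerCategory.dag_comp, ← G.map_dag, Category.assoc, reassoc_of% hκ.1,
        ← G.functor.map_comp, hθ.1, G.functor.map_id]
      rfl
    · rw [DaggerCategory.dag_comp, ← G.map_dag, Category.assoc, ← G.functor.map_comp_assoc, hθ.2,
        G.functor.map_id, Category.id_comp, hκ.2]
      rfl
    · rw [← h1] at h2
      simp only [Functor.map_comp, Category.assoc] at h2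
      refine Eq.trans ?_ h2
      simp only [comp_ε, comp_δ, Functor.comp_map, Functor.comp_obj, Category.assoc,
        MonoidalCategory.whiskerLeft_comp]
      rw [δ_natural_right_assoc]

end DaggerCompactFunctor

/-! ### Projectivisation -/

section Scale

variable {C : Type u} [Category.{v} C] [MonoidalCategory C]

/-- The scalar multiple `s • f`, that is, `s ⊗ f` up to unitors. -/
def scale (s : 𝟙_ C ⟶ 𝟙_ C) {X Y : C} (f : X ⟶ Y) : X ⟶ Y :=
  (λ_ X).inv ≫ (s ⊗ₘ f) ≫ (λ_ Y).hom

theorem scale_comp (s : 𝟙_ C ⟶ 𝟙_ C) {X Y Z : C} (f : X ⟶ Y) (g : Y ⟶ Z) :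
    scale s f ≫ g = scale s (f ≫ g) := by
  simp [scale, MonoidalCategory.tensorHom_def]

theorem comp_scale (s : 𝟙_ C ⟶ 𝟙_ C) {X Y Z : C} (f : X ⟶ Y) (g : Y ⟶ Z) :
    f ≫ scale s g = scale s (f ≫ g) := by
  simp [scale, MonoidalCategory.tensorHom_def']

theorem one_scale {X Y : C} (f : X ⟶ Y) : scale (𝟙 (𝟙_ C)) f = f := by
  simp [scale]

theorem scale_scale (s t : 𝟙_ C ⟶ 𝟙_ C) {X Y : C} (f : X ⟶ Y) :
    scale s (scale t f) = scale (s ≫ t) f := by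
  simp [scale, MonoidalCategory.tensorHom_def]

theorem scale_tensor (s : 𝟙_ C ⟶ 𝟙_ C) {X Y X' Y' : C} (f : X ⟶ Y) (g : X' ⟶ Y') :
    scale s f ⊗ₘ g = scale s (f ⊗ₘ g) := by
  simp [scale, MonoidalCategory.tensorHom_def]

theorem tensor_scale [BraidedCategory C] (s : 𝟙_ C ⟶ 𝟙_ C) {X Y X' Y' : C} (f : X ⟶ Y)
    (g : X' ⟶ Y') : f ⊗ₘ scale s g = scale s (f ⊗ₘ g) := by
  have h : ∀ {A B A' B' : C} (a : A ⟶ B) (b : A' ⟶ B'),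
      a ⊗ₘ b = (β_ A A').hom ≫ (b ⊗ₘ a) ≫ (β_ B B').inv := by
    intros; simp
  rw [h f (scale s g), scale_tensor, scale_comp, comp_scale, ← h]

end Scale

/-- Two parallel morphisms are projectively equivalent when they differ by an invertible scalar. -/
def projSetoid {C : Type u} [Category.{v} C] [MonoidalCategory C] (X Y : C) : Setoid (X ⟶ Y) where
  r f g := ∃ s : 𝟙_ C ≅ 𝟙_ C, g = scale s.hom f
  iseqv :=
    { refl := fun f => ⟨Iso.refl _, (one_scale f).symm⟩
      symm := by
        rintro f g ⟨s, rfl⟩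
        exact ⟨s.symm, by simp [scale_scale, one_scale]⟩
      trans := by
        rintro f g h ⟨s, rfl⟩ ⟨t, rfl⟩
        exact ⟨t ≪≫ s, by simp [scale_scale]⟩ }

/-- `Proj C`: the objects of `C`, with morphisms modulo invertible scalars. -/
structure Proj (C : Type u) where
  of ::
  obj : C

namespace Proj

variable {C : Type u} [Category.{v} C] [MonoidalCategory C]

instance : Category.{v} (Proj C) where
  Hom X Y := Quotient (projSetoid X.obj Y.obj)
  id X := Quotient.mk _ (𝟙 X.obj)
  comp := Quotient.map₂ (fun f g => f ≫ g) (by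
    rintro f _ ⟨s, rfl⟩ g _ ⟨t, rfl⟩
    exact ⟨t ≪≫ s, by simp [scale_comp, comp_scale, scale_scale]⟩)
  id_comp := by rintro _ _ ⟨f⟩; exact congrArg (Quotient.mk _) (Category.id_comp f)
  comp_id := by rintro _ _ ⟨f⟩; exact congrArg (Quotient.mk _) (Category.comp_id f)
  assoc := by
    rintro _ _ _ _ ⟨f⟩ ⟨g⟩ ⟨h⟩; exact congrArg (Quotient.mk _) (Category.assoc f g h)

variable (C) in
/-- The quotient functor `C ⥤ Proj C`. -/
def quot : C ⥤ Proj C where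
  obj X := ⟨X⟩
  map f := Quotient.mk _ f
  map_id _ := rfl
  map_comp _ _ := rfl

variable [SymmetricCategory C]

instance : MonoidalCategoryStruct (Proj C) where
  tensorObj X Y := ⟨X.obj ⊗ Y.obj⟩
  tensorUnit := ⟨𝟙_ C⟩
  tensorHom := Quotient.map₂ (fun f g => f ⊗ₘ g) (by
    rintro f _ ⟨s, rfl⟩ g _ ⟨t, rfl⟩
    exact ⟨t ≪≫ s, by simp [scale_tensor, tensor_scale, scale_scale]⟩)
  whiskerLeft X _ _ := Quotient.map (fun f => X.obj ◁ f) (by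
    rintro f _ ⟨s, rfl⟩
    exact ⟨s, by simp [← id_tensorHom, tensor_scale]⟩)
  whiskerRight f Y := Quotient.map (fun f => f ▷ Y.obj) (by
    rintro f _ ⟨s, rfl⟩
    exact ⟨s, by simp [← tensorHom_id, scale_tensor]⟩) f
  associator X Y Z := (quot C).mapIso (α_ X.obj Y.obj Z.obj)
  leftUnitor X := (quot C).mapIso (λ_ X.obj)
  rightUnitor X := (quot C).mapIso (ρ_ X.obj)

instance : MonoidalCategory (Proj C) where
  tensorHom_def := by rintro _ _ _ _ ⟨f⟩ ⟨g⟩; exact congrArg (Quotient.mk _) (tensorHom_def f g)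
  id_tensorHom_id X Y := congrArg (Quotient.mk _) (id_tensorHom_id X.obj Y.obj)
  tensorHom_comp_tensorHom := by
    rintro _ _ _ _ _ _ ⟨f⟩ ⟨g⟩ ⟨h⟩ ⟨k⟩
    exact congrArg (Quotient.mk _) (tensorHom_comp_tensorHom f g h k)
  whiskerLeft_id X Y := congrArg (Quotient.mk _) (whiskerLeft_id X.obj Y.obj)
  id_whiskerRight X Y := congrArg (Quotient.mk _) (id_whiskerRight X.obj Y.obj)
  associator_naturality := by
    rintro _ _ _ _ _ _ ⟨f⟩ ⟨g⟩ ⟨h⟩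
    exact congrArg (Quotient.mk _) (associator_naturality f g h)
  leftUnitor_naturality := by
    rintro _ _ ⟨f⟩; exact congrArg (Quotient.mk _) (leftUnitor_naturality f)
  rightUnitor_naturality := by
    rintro _ _ ⟨f⟩; exact congrArg (Quotient.mk _) (rightUnitor_naturality f)
  pentagon W X Y Z := congrArg (Quotient.mk _) (pentagon W.obj X.obj Y.obj Z.obj)
  triangle X Y := congrArg (Quotient.mk _) (triangle X.obj Y.obj)

instance : SymmetricCategory (Proj C) where
  braiding X Y := (quot C).mapIso (β_ X.obj Y.obj)
  braiding_naturality_right := by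
    rintro X _ _ ⟨f⟩
    exact congrArg (Quotient.mk _) (BraidedCategory.braiding_naturality_right X.obj f)
  braiding_naturality_left := by
    rintro _ _ ⟨f⟩ Z
    exact congrArg (Quotient.mk _) (BraidedCategory.braiding_naturality_left f Z.obj)
  hexagon_forward X Y Z :=
    congrArg (Quotient.mk _) (BraidedCategory.hexagon_forward X.obj Y.obj Z.obj)
  hexagon_reverse X Y Z :=
    congrArg (Quotient.mk _) (BraidedCategory.hexagon_reverse X.obj Y.obj Z.obj)
  symmetry X Y := congrArg (Quotient.mk _) (SymmetricCategory.symmetry X.obj Y.obj)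

instance [RightRigidCategory C] : RightRigidCategory (Proj C) where
  rightDual X :=
    { rightDual := ⟨X.objᘁ⟩
      exact :=
        { coevaluation' := (quot C).map (η_ X.obj X.objᘁ)
          evaluation' := (quot C).map (ε_ X.obj X.objᘁ)
          coevaluation_evaluation' :=
            congrArg (Quotient.mk _) (ExactPairing.coevaluation_evaluation X.obj X.objᘁ)
          evaluation_coevaluation' :=
            congrArg (Quotient.mk _) (ExactPairing.evaluation_coevaluation X.obj X.objᘁ) } }

variable [RightRigidCategory C] [DaggerCompactCategory C]

theorem dag_scale (s : 𝟙_ C ⟶ 𝟙_ C) {X Y : C} (f : X ⟶ Y) :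
    DaggerCategory.dag (scale s f) = scale (DaggerCategory.dag s) (DaggerCategory.dag f) := by
  have h : DaggerCategory.dag (λ_ X).inv = (λ_ X).hom := by
    rw [← DaggerSymmetricCategory.dag_leftUnitor_hom, DaggerCategory.dag_dag]
  simp [scale, DaggerCategory.dag_comp, DaggerSymmetricCategory.dag_tensorHom,
    DaggerSymmetricCategory.dag_leftUnitor_hom, h]

instance : DaggerCompactCategory (Proj C) where
  dag := Quotient.map (fun f => DaggerCategory.dag f) (by
    rintro f _ ⟨s, rfl⟩
    refine ⟨⟨DaggerCategory.dag s.hom, DaggerCategory.dag s.inv, ?_, ?_⟩, dag_scale _ _⟩ <;>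
    simp [← DaggerCategory.dag_comp, DaggerCategory.dag_id])
  dag_id X := congrArg (Quotient.mk _) (DaggerCategory.dag_id X.obj)
  dag_comp := by
    rintro _ _ _ ⟨f⟩ ⟨g⟩; exact congrArg (Quotient.mk _) (DaggerCategory.dag_comp f g)
  dag_dag := by rintro _ _ ⟨f⟩; exact congrArg (Quotient.mk _) (DaggerCategory.dag_dag f)
  dag_tensorHom := by
    rintro _ _ _ _ ⟨f⟩ ⟨g⟩
    exact congrArg (Quotient.mk _) (DaggerSymmetricCategory.dag_tensorHom f g)
  dag_associator_hom X Y Z :=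
    congrArg (Quotient.mk _) (DaggerSymmetricCategory.dag_associator_hom X.obj Y.obj Z.obj)
  dag_leftUnitor_hom X :=
    congrArg (Quotient.mk _) (DaggerSymmetricCategory.dag_leftUnitor_hom X.obj)
  dag_rightUnitor_hom X :=
    congrArg (Quotient.mk _) (DaggerSymmetricCategory.dag_rightUnitor_hom X.obj)
  dag_braiding_hom X Y :=
    congrArg (Quotient.mk _) (DaggerSymmetricCategory.dag_braiding_hom X.obj Y.obj)
  dag_cap X := congrArg (Quotient.mk _) (DaggerCompactCategory.dag_cap X.obj)


end Proj

/-- The quotient functor `C ⥤ Proj C` as a (strict) `†`-compact functor. -/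
def Proj.proj (C : Type u) [Category.{v} C] [MonoidalCategory C] [SymmetricCategory C]
    [RightRigidCategory C] [DaggerCompactCategory C] : DaggerCompactFunctor C (Proj C) where
  functor := Proj.quot C
  braided :=
    { toMonoidal := Functor.CoreMonoidal.toMonoidal
        { εIso := Iso.refl _
          μIso := fun _ _ => Iso.refl _
          μIso_hom_natural_left := fun f X => (Category.comp_id _).trans (Category.id_comp _).symm
          μIso_hom_natural_right := fun X f => (Category.comp_id _).trans (Category.id_comp _).symm
          associativity := fun X Y Z => congrArg (Quotient.mk _)
            (show 𝟙 (X ⊗ Y) ▷ Z ≫ 𝟙 _ ≫ (α_ X Y Z).hom = (α_ X Y Z).hom ≫ X ◁ 𝟙 (Y ⊗ Z) ≫ 𝟙 _ by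
              simp)
          left_unitality := fun X => congrArg (Quotient.mk _)
            (show (λ_ X).hom = 𝟙 (𝟙_ C) ▷ X ≫ 𝟙 _ ≫ (λ_ X).hom by simp)
          right_unitality := fun X => congrArg (Quotient.mk _)
            (show (ρ_ X).hom = X ◁ 𝟙 (𝟙_ C) ≫ 𝟙 _ ≫ (ρ_ X).hom by simp) }
      braided := fun X Y => (Category.id_comp _).trans (Category.comp_id _).symm }
  map_dag _ := rfl
  unitary_unit := ⟨(Category.id_comp _).trans (DaggerCategory.dag_id _),
    (Category.comp_id _).trans (DaggerCategory.dag_id _)⟩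
  unitary_tensor _ _ := ⟨(Category.id_comp _).trans (DaggerCategory.dag_id _),
    (Category.comp_id _).trans (DaggerCategory.dag_id _)⟩
  map_cup X := ⟨𝟙 _, ⟨(Category.id_comp _).trans (DaggerCategory.dag_id _),
    (Category.comp_id _).trans (DaggerCategory.dag_id _)⟩, congrArg (Quotient.mk _)
      (show 𝟙 _ ≫ η_ X Xᘁ ≫ 𝟙 _ ≫ X ◁ 𝟙 Xᘁ = η_ X Xᘁ by simp)⟩

/-! ### Multi-wire matrices -/

/-- Linear maps `(ℂ^K)^{⊗ m} → (ℂ^K)^{⊗ n}`, as matrices in the canonical basis: a basis vector of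
`(ℂ^K)^{⊗ n}` is a word `Fin n → K`. -/
abbrev Mx (K : Type) (m n : ℕ) : Type := Matrix (Fin n → K) (Fin m → K) ℂ

namespace Mx

variable {K : Type}

/-- The first `m` letters of a word of length `m + n`. -/
def lft {m n : ℕ} (x : Fin (m + n) → K) : Fin m → K := fun i => x (Fin.castAdd n i)

/-- The last `n` letters of a word of length `m + n`. -/
def rgt {m n : ℕ} (x : Fin (m + n) → K) : Fin n → K := fun i => x (Fin.natAdd m i)

@[simp] theorem lft_append {m n : ℕ} (x : Fin m → K) (y : Fin n → K) :
    lft (Fin.append x y) = x := by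
  funext i; simp [lft]

@[simp] theorem rgt_append {m n : ℕ} (x : Fin m → K) (y : Fin n → K) :
    rgt (Fin.append x y) = y := by
  funext i; simp [rgt]

@[simp] theorem append_lft_rgt {m n : ℕ} (x : Fin (m + n) → K) :
    Fin.append (lft x) (rgt x) = x := Fin.append_castAdd_natAdd

theorem word_ext {m n : ℕ} {x y : Fin (m + n) → K} (h₁ : lft x = lft y) (h₂ : rgt x = rgt y) :
    x = y := by
  rw [← append_lft_rgt x, h₁, h₂, append_lft_rgt]

/-- The tensor product of two linear maps. -/
def tens {a b c d : ℕ} (f : Mx K a b) (g : Mx K c d) : Mx K (a + c) (b + d) :=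
  Matrix.of fun y x => f (lft y) (lft x) * g (rgt y) (rgt x)

variable [DecidableEq K]

/-- The map that permutes (relabels) tensor factors. -/
def relabel {a b : ℕ} (σ : Fin b ≃ Fin a) : Mx K a b :=
  Matrix.of fun y x => if y = x ∘ σ then 1 else 0

/-- The (unnormalised) cup `∑ x, |x⟩ ⊗ |x⟩`. -/
def cup (n : ℕ) : Mx K 0 (n + n) :=
  Matrix.of fun y _ => if lft y = rgt y then 1 else 0

section

variable {a b c d : ℕ}

theorem tens_apply (f : Mx K a b) (g : Mx K c d) (y x) :
    tens f g y x = f (lft y) (lft x) * g (rgt y) (rgt x) := rfl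

theorem conjTranspose_tens (f : Mx K a b) (g : Mx K c d) :
    (tens f g).conjTranspose = tens f.conjTranspose g.conjTranspose := by
  ext y x; simp [tens_apply]

theorem tens_one : tens (1 : Mx K a a) (1 : Mx K c c) = 1 := by
  ext y x
  rw [tens_apply, Matrix.one_apply, Matrix.one_apply, Matrix.one_apply]
  by_cases h : y = x
  · simp [h]
  · rw [if_neg h]
    by_cases h₁ : lft y = lft x
    · have : rgt y ≠ rgt x := fun h₂ => h (word_ext h₁ h₂)
      simp [this]
    · simp [h₁]

theorem relabel_apply (σ : Fin b ≃ Fin a) (y x) :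
    (relabel σ : Mx K a b) y x = if y = x ∘ σ then 1 else 0 := rfl

theorem relabel_refl : (relabel (Equiv.refl _) : Mx K a a) = 1 := by
  ext y x; simp [relabel_apply, Matrix.one_apply]

theorem comp_equiv_eq (σ : Fin b ≃ Fin a) (y : Fin b → K) (x : Fin a → K) :
    y = x ∘ σ ↔ x = y ∘ σ.symm := by
  constructor
  · rintro rfl; funext i; simp
  · rintro rfl; funext i; simp

theorem conjTranspose_relabel (σ : Fin b ≃ Fin a) :
    (relabel σ : Mx K a b).conjTranspose = relabel σ.symm := by
  ext y x
  simp only [Matrix.conjTranspose_apply, relabel_apply, comp_equiv_eq σ]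
  split_ifs <;> simp

theorem sum_word [Fintype K] {M : Type*} [AddCommMonoid M] (F : (Fin (a + b) → K) → M) :
    ∑ x, F x = ∑ y : Fin a → K, ∑ z : Fin b → K, F (Fin.append y z) := by
  rw [← Fintype.sum_prod_type', ← (Fin.appendEquiv a b).sum_comp]
  rfl

variable [Fintype K]

theorem mul_relabel (f : Mx K b c) (σ : Fin b ≃ Fin a) (y : Fin c → K) (x : Fin a → K) :
    (f * (relabel σ : Mx K a b)) y x = f y (x ∘ σ) := by
  simp [Matrix.mul_apply, relabel_apply]

theorem relabel_mul (f : Mx K c a) (σ : Fin b ≃ Fin a) (y : Fin b → K) (x : Fin c → K) :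
    ((relabel σ : Mx K a b) * f) y x = f (y ∘ σ.symm) x := by
  simp [Matrix.mul_apply, relabel_apply, comp_equiv_eq σ]

theorem relabel_mul_relabel (σ : Fin b ≃ Fin a) (τ : Fin c ≃ Fin b) :
    (relabel τ : Mx K b c) * (relabel σ : Mx K a b) = relabel (τ.trans σ) := by
  ext y x
  rw [mul_relabel]
  rfl

theorem relabel_mul_symm (σ : Fin b ≃ Fin a) :
    (relabel σ : Mx K a b) * (relabel σ.symm : Mx K b a) = 1 := by
  rw [relabel_mul_relabel, Equiv.self_trans_symm, relabel_refl]

theorem relabel_symm_mul (σ : Fin b ≃ Fin a) :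
    (relabel σ.symm : Mx K b a) * (relabel σ : Mx K a b) = 1 := by
  rw [relabel_mul_relabel, Equiv.symm_trans_self, relabel_refl]

theorem tens_mul_tens {e e' : ℕ} (f : Mx K a b) (g : Mx K c d) (f' : Mx K b e) (g' : Mx K d e') :
    tens f' g' * tens f g = tens (f' * f) (g' * g) := by
  ext y x
  simp only [Matrix.mul_apply, tens_apply, sum_word, lft_append, rgt_append, Finset.sum_mul_sum]
  refine Finset.sum_congr rfl fun i _ => Finset.sum_congr rfl fun j _ => by ring

theorem relabel_natural {f : Mx K c a} {g : Mx K d b} {σ : Fin b ≃ Fin a} {τ : Fin d ≃ Fin c}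
    (h : ∀ y x, f y x = g (y ∘ σ) (x ∘ τ)) :
    (relabel σ : Mx K a b) * f = g * (relabel τ : Mx K c d) := by
  ext y x
  rw [relabel_mul, mul_relabel, h]
  congr 1
  funext i
  simp

end

section

variable {a b c d : ℕ}

theorem relabel_congr {σ τ : Fin b ≃ Fin a} (h : ∀ x : Fin a → K, x ∘ σ = x ∘ τ) :
    (relabel σ : Mx K a b) = relabel τ := by
  ext y x; rw [relabel_apply, relabel_apply, h]

/-- The relabelling underlying the associator. -/
def assocE (a b c : ℕ) : Fin (a + (b + c)) ≃ Fin (a + b + c) := finCongr (Nat.add_assoc a b c).symm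

/-- The relabelling underlying the left unitor. -/
def leftE (a : ℕ) : Fin a ≃ Fin (0 + a) := finCongr (Nat.zero_add a).symm

/-- The relabelling underlying the right unitor. -/
def rightE (a : ℕ) : Fin a ≃ Fin (a + 0) := finCongr (Nat.add_zero a).symm

/-- The relabelling underlying the symmetry. -/
def braidE (a b : ℕ) : Fin (b + a) ≃ Fin (a + b) := finAddFlip

/-- Juxtaposition of relabellings. -/
def tensE (σ : Fin b ≃ Fin a) (τ : Fin d ≃ Fin c) : Fin (b + d) ≃ Fin (a + c) :=
  finSumFinEquiv.symm.trans ((Equiv.sumCongr σ τ).trans finSumFinEquiv)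

variable {L : Type}

theorem lft_assocE (x : Fin (a + b + c) → L) : lft (x ∘ assocE a b c) = lft (lft x) := rfl

theorem lft_rgt_assocE (x : Fin (a + b + c) → L) :
    lft (rgt (x ∘ assocE a b c)) = rgt (lft x) := rfl

theorem rgt_rgt_assocE (x : Fin (a + b + c) → L) : rgt (rgt (x ∘ assocE a b c)) = rgt x := by
  funext i
  refine congrArg x (Fin.ext ?_)
  simp [assocE, Nat.add_assoc]

theorem lft_lft_assocE_symm (x : Fin (a + (b + c)) → L) :
    lft (lft (x ∘ (assocE a b c).symm)) = lft x := rfl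

theorem rgt_lft_assocE_symm (x : Fin (a + (b + c)) → L) :
    rgt (lft (x ∘ (assocE a b c).symm)) = lft (rgt x) := rfl

theorem rgt_assocE_symm (x : Fin (a + (b + c)) → L) :
    rgt (x ∘ (assocE a b c).symm) = rgt (rgt x) := by
  funext i
  refine congrArg x (Fin.ext ?_)
  simp [assocE, Nat.add_assoc]

theorem rgt_eq_leftE (x : Fin (0 + a) → L) : rgt x = x ∘ leftE a := by
  funext i
  refine congrArg x (Fin.ext ?_)
  simp [leftE]

theorem lft_eq_rightE (x : Fin (a + 0) → L) : lft x = x ∘ rightE a := rfl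

theorem lft_braidE (x : Fin (a + b) → L) : lft (x ∘ braidE a b) = rgt x := by
  funext i
  refine congrArg x ?_
  simp [braidE]

theorem rgt_braidE (x : Fin (a + b) → L) : rgt (x ∘ braidE a b) = lft x := by
  funext i
  refine congrArg x ?_
  simp [braidE]

theorem lft_tensE (σ : Fin b ≃ Fin a) (τ : Fin d ≃ Fin c) (x : Fin (a + c) → L) :
    lft (x ∘ tensE σ τ) = lft x ∘ σ := by
  funext i
  refine congrArg x ?_
  simp [tensE]

theorem rgt_tensE (σ : Fin b ≃ Fin a) (τ : Fin d ≃ Fin c) (x : Fin (a + c) → L) :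
    rgt (x ∘ tensE σ τ) = rgt x ∘ τ := by
  funext i
  refine congrArg x ?_
  simp [tensE]

theorem tens_relabel (σ : Fin b ≃ Fin a) (τ : Fin d ≃ Fin c) :
    tens (relabel σ : Mx K a b) (relabel τ : Mx K c d) = relabel (tensE σ τ) := by
  ext y x
  have : y = x ∘ tensE σ τ ↔ lft y = lft x ∘ σ ∧ rgt y = rgt x ∘ τ := by
    rw [← lft_tensE σ τ, ← rgt_tensE σ τ]
    exact ⟨fun h => by simp [h], fun h => word_ext h.1 h.2⟩
  simp only [tens_apply, relabel_apply, this, ite_and]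
  split_ifs <;> simp

theorem tensE_finCongr (h : b = a) (k : d = c) :
    tensE (finCongr h) (finCongr k) = finCongr (by rw [h, k]) := by
  subst h; subst k
  ext i
  simp [tensE]

variable [Fintype K]

theorem associator_natural {a' b' c' : ℕ} (f : Mx K a a') (g : Mx K b b') (h : Mx K c c') :
    (relabel (assocE a' b' c') : Mx K _ _) * tens (tens f g) h =
      tens f (tens g h) * (relabel (assocE a b c) : Mx K _ _) :=
  relabel_natural fun y x => by
    simp only [tens_apply, lft_assocE, lft_rgt_assocE, rgt_rgt_assocE, mul_assoc]

theorem leftUnitor_natural (f : Mx K a b) :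
    (relabel (leftE b) : Mx K _ _) * tens (1 : Mx K 0 0) f =
      f * (relabel (leftE a) : Mx K _ _) :=
  relabel_natural fun y x => by
    rw [tens_apply, rgt_eq_leftE, rgt_eq_leftE, Subsingleton.elim (lft y) (lft x)]
    simp

theorem rightUnitor_natural (f : Mx K a b) :
    (relabel (rightE b) : Mx K _ _) * tens f (1 : Mx K 0 0) =
      f * (relabel (rightE a) : Mx K _ _) :=
  relabel_natural fun y x => by
    rw [tens_apply, lft_eq_rightE, lft_eq_rightE, Subsingleton.elim (rgt y) (rgt x)]
    simp

theorem braiding_natural (f : Mx K a b) (g : Mx K c d) :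
    (relabel (braidE b d) : Mx K _ _) * tens f g =
      tens g f * (relabel (braidE a c) : Mx K _ _) :=
  relabel_natural fun y x => by
    simp only [tens_apply, lft_braidE, rgt_braidE, mul_comm]

theorem relabel_pentagon (a b c d : ℕ) :
    tens (1 : Mx K a a) (relabel (assocE b c d) : Mx K _ _) *
      (relabel (assocE a (b + c) d) : Mx K _ _) *
        tens (relabel (assocE a b c) : Mx K _ _) (1 : Mx K d d) =
      (relabel (assocE a b (c + d)) : Mx K _ _) * (relabel (assocE (a + b) c d) : Mx K _ _) := by
  simp only [← relabel_refl, tens_relabel, relabel_mul_relabel]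
  refine relabel_congr fun x => funext fun i => congrArg x (Fin.ext ?_)
  simp only [assocE, ← finCongr_refl, tensE_finCongr]
  rfl

theorem relabel_triangle (a b : ℕ) :
    tens (1 : Mx K a a) (relabel (leftE b) : Mx K _ _) *
      (relabel (assocE a 0 b) : Mx K _ _) =
        tens (relabel (rightE a) : Mx K _ _) (1 : Mx K b b) := by
  simp only [← relabel_refl, tens_relabel, relabel_mul_relabel]
  refine relabel_congr fun x => funext fun i => congrArg x (Fin.ext ?_)
  simp only [assocE, leftE, rightE, ← finCongr_refl, tensE_finCongr]
  rfl

theorem relabel_symmetry (a b : ℕ) :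
    (relabel (braidE b a) : Mx K _ _) * (relabel (braidE a b) : Mx K _ _) = 1 := by
  rw [relabel_mul_relabel, ← relabel_refl]
  refine relabel_congr fun x => word_ext ?_ ?_
  · exact (lft_braidE (x ∘ braidE a b)).trans (rgt_braidE x)
  · exact (rgt_braidE (x ∘ braidE a b)).trans (lft_braidE x)

theorem relabel_hexagon (a b c : ℕ) :
    (relabel (assocE b c a) : Mx K _ _) *
      (relabel (braidE a (b + c)) : Mx K _ _) * (relabel (assocE a b c) : Mx K _ _) =
    tens (1 : Mx K b b) (relabel (braidE a c) : Mx K _ _) *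
      (relabel (assocE b a c) : Mx K _ _) *
        tens (relabel (braidE a b) : Mx K _ _) (1 : Mx K c c) := by
  simp only [← relabel_refl, tens_relabel, relabel_mul_relabel]
  refine relabel_congr fun x => ?_
  simp only [Equiv.coe_trans, ← Function.comp_assoc]
  refine word_ext ?_ (word_ext ?_ ?_) <;>
  simp only [lft_assocE, lft_rgt_assocE, rgt_rgt_assocE, lft_braidE, rgt_braidE, lft_tensE,
    rgt_tensE, Equiv.coe_refl, Function.comp_id]

theorem relabel_hexagon' (a b c : ℕ) :
    (relabel (assocE c a b).symm : Mx K _ _) *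
      (relabel (braidE (a + b) c) : Mx K _ _) * (relabel (assocE a b c).symm : Mx K _ _) =
    tens (relabel (braidE a c) : Mx K _ _) (1 : Mx K b b) *
      (relabel (assocE a c b).symm : Mx K _ _) *
        tens (1 : Mx K a a) (relabel (braidE b c) : Mx K _ _) := by
  simp only [← relabel_refl, tens_relabel, relabel_mul_relabel]
  refine relabel_congr fun x => ?_
  simp only [Equiv.coe_trans, ← Function.comp_assoc]
  refine word_ext (word_ext ?_ ?_) ?_ <;>
  simp only [lft_lft_assocE_symm, rgt_lft_assocE_symm, rgt_assocE_symm, lft_braidE, rgt_braidE,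
    lft_tensE, rgt_tensE, Equiv.coe_refl, Function.comp_id]

theorem cup_apply (n : ℕ) (y : Fin (n + n) → K) (x : Fin 0 → K) :
    cup n y x = if lft y = rgt y then 1 else 0 := rfl

theorem cup_snake (n : ℕ) :
    tens (cup n : Mx K 0 (n + n)).conjTranspose (1 : Mx K n n) *
      (relabel (assocE n n n).symm : Mx K _ _) * tens (1 : Mx K n n) (cup n : Mx K 0 (n + n)) =
    (relabel (leftE n).symm : Mx K _ _) * (relabel (rightE n) : Mx K _ _) := by
  ext y x
  rw [relabel_mul, relabel_apply, Matrix.mul_assoc, Matrix.mul_apply]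
  simp only [relabel_mul, tens_apply, sum_word, lft_append, rgt_append, Equiv.symm_symm,
    lft_assocE, lft_rgt_assocE, rgt_rgt_assocE, Matrix.conjTranspose_apply, cup_apply,
    Matrix.one_apply, ← rgt_eq_leftE, ← lft_eq_rightE]
  simp [eq_comm]

theorem cup_snake' (n : ℕ) :
    tens (1 : Mx K n n) (cup n : Mx K 0 (n + n)).conjTranspose *
      (relabel (assocE n n n) : Mx K _ _) * tens (cup n : Mx K 0 (n + n)) (1 : Mx K n n) =
    (relabel (rightE n).symm : Mx K _ _) * (relabel (leftE n) : Mx K _ _) := by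
  ext y x
  rw [relabel_mul, relabel_apply, Matrix.mul_assoc, Matrix.mul_apply]
  simp only [relabel_mul, tens_apply, sum_word, lft_append, rgt_append, Equiv.symm_symm,
    lft_lft_assocE_symm, rgt_lft_assocE_symm, rgt_assocE_symm, Matrix.conjTranspose_apply,
    cup_apply, Matrix.one_apply, ← rgt_eq_leftE, ← lft_eq_rightE]
  simp

theorem braid_cup (n : ℕ) :
    (relabel (braidE n n) : Mx K (n + n) (n + n)) * (cup n : Mx K 0 (n + n)) = cup n := by
  ext y x
  rw [relabel_mul, cup_apply, cup_apply]
  obtain ⟨z, rfl⟩ : ∃ z : Fin (n + n) → K, y = z ∘ braidE n n :=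
    ⟨y ∘ (braidE n n).symm, by funext i; simp⟩
  rw [lft_braidE, rgt_braidE, Function.comp_assoc, Equiv.self_comp_symm, Function.comp_id]
  simp only [eq_comm]

end

end Mx

/-! ### Qupit stabiliser maps -/

section Stabiliser

open Mx

variable {p : ℕ} [Fact p.Prime]

/-- The `n`-qupit Pauli operator `ξ(y) ⨂ₖ X^(x k) Z^(z k)`, where `X|j⟩ = |j+1⟩`,
`Z|j⟩ = ξ(j)|j⟩` and `ξ(j) = exp(2πij/p)`. It maps `|k⟩` to `ξ(y + z ⬝ k) |k + x⟩`. -/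
noncomputable def pauli {n : ℕ} (y : ZMod p) (x z : Fin n → ZMod p) : Mx (ZMod p) n n :=
  Matrix.of fun j k => if j = k + x then ZMod.stdAddChar (y + z ⬝ᵥ k) else 0

/-- Membership of the `n`-qupit Pauli group. -/
def IsPauli {n : ℕ} (P : Mx (ZMod p) n n) : Prop :=
  ∃ (y : ZMod p) (x z : Fin n → ZMod p), P = pauli y x z

/-- Membership of the Clifford group, the unitary normaliser of the Pauli group. -/
def IsClifford {n : ℕ} (U : Mx (ZMod p) n n) : Prop :=
  U ∈ Matrix.unitaryGroup (Fin n → ZMod p) ℂ ∧ ∀ P, IsPauli P → IsPauli (U * P * U.conjTranspose)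

/-- Abelian groups of Pauli operators that contain no nontrivial phase `ξ(y) 1`. -/
structure IsPhaseFree {n : ℕ} (S : Subgroup (Matrix.unitaryGroup (Fin n → ZMod p) ℂ)) : Prop where
  isPauli : ∀ s ∈ S, IsPauli s.1
  comm : ∀ s ∈ S, ∀ t ∈ S, s * t = t * s
  phase : ∀ s ∈ S, ∀ y : ZMod p, s.1 = pauli y 0 0 → y = 0

/-- Stabiliser groups: the maximal abelian groups of Paulis without nontrivial phases. -/
def IsStabiliserGroup {n : ℕ} (S : Subgroup (Matrix.unitaryGroup (Fin n → ZMod p) ℂ)) : Prop :=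
  Maximal IsPhaseFree S

/-- Stabiliser states: the normalised vectors fixed by some stabiliser group. -/
def IsStabiliserState {n : ℕ} (ψ : (Fin n → ZMod p) → ℂ) : Prop :=
  ∑ x, ‖ψ x‖ ^ 2 = 1 ∧ ∃ S : Subgroup (Matrix.unitaryGroup (Fin n → ZMod p) ℂ),
    IsStabiliserGroup S ∧ ∀ s ∈ S, Matrix.mulVec s.1 ψ = ψ

/-- A vector as a linear map out of the monoidal unit. -/
def ket {n : ℕ} (ψ : (Fin n → ZMod p) → ℂ) : Mx (ZMod p) 0 n := Matrix.of fun y _ => ψ y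

/-- A complex number as a linear endomorphism of the monoidal unit. -/
def scal (p : ℕ) (c : ℂ) : Mx (ZMod p) 0 0 := Matrix.of fun _ _ => c

/-- The qupit stabiliser maps: the linear maps generated by the stabiliser states, the Clifford
operators and the scalars `√p` and `1 / √p` under composition, tensor product and adjoint. -/
inductive IsStab : ∀ {m n : ℕ}, Mx (ZMod p) m n → Prop
  | state {n : ℕ} (ψ : (Fin n → ZMod p) → ℂ) : IsStabiliserState ψ → IsStab (ket ψ)
  | clifford {n : ℕ} (U : Mx (ZMod p) n n) : IsClifford U → IsStab U
  | sqrt : IsStab (scal p (Real.sqrt p))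
  | invSqrt : IsStab (scal p (1 / Real.sqrt p))
  | comp {l m n : ℕ} (f : Mx (ZMod p) l m) (g : Mx (ZMod p) m n) :
      IsStab f → IsStab g → IsStab (g * f)
  | tens {m n m' n' : ℕ} (f : Mx (ZMod p) m n) (g : Mx (ZMod p) m' n') :
      IsStab f → IsStab g → IsStab (tens f g)
  | dag {m n : ℕ} (f : Mx (ZMod p) m n) : IsStab f → IsStab f.conjTranspose

theorem isClifford_relabel {n : ℕ} (σ : Fin n ≃ Fin n) :
    IsClifford (relabel σ : Mx (ZMod p) n n) := by
  refine ⟨?_, ?_⟩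
  · rw [Matrix.mem_unitaryGroup_iff, Matrix.star_eq_conjTranspose, conjTranspose_relabel]
    exact relabel_mul_symm σ
  · rintro _ ⟨y, x, z, rfl⟩
    refine ⟨y, x ∘ σ, z ∘ σ, ?_⟩
    rw [conjTranspose_relabel]
    ext j k
    rw [mul_relabel, relabel_mul]
    have h₁ : (j ∘ σ.symm = k ∘ σ.symm + x) ↔ j = k + x ∘ σ := by
      rw [← Equiv.eq_comp_symm]
      constructor
      · rintro h
        rw [h]; funext i; simp
      · rintro h
        rw [h]; funext i; simp
    have h₂ : z ⬝ᵥ (k ∘ σ.symm) = (z ∘ σ) ⬝ᵥ k := by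
      simp only [dotProduct]
      rw [← σ.sum_comp]
      simp
    simp only [pauli, Matrix.of_apply, h₁, h₂]

theorem isStab_relabel {m n : ℕ} (σ : Fin n ≃ Fin m) : IsStab (relabel σ : Mx (ZMod p) m n) := by
  obtain rfl : n = m := by simpa using Fintype.card_congr σ
  exact .clifford _ (isClifford_relabel σ)

theorem isStab_one {n : ℕ} : IsStab (1 : Mx (ZMod p) n n) := by
  rw [← relabel_refl]
  exact isStab_relabel _

theorem pauli_mul {n : ℕ} (y y' : ZMod p) (x z x' z' : Fin n → ZMod p) :
    pauli y x z * pauli y' x' z' = pauli (y + y' + z ⬝ᵥ x') (x + x') (z + z') := by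
  ext j k
  simp only [Matrix.mul_apply, pauli, Matrix.of_apply, mul_ite, mul_zero, ite_mul, zero_mul]
  rw [Finset.sum_ite_eq' , if_pos (Finset.mem_univ _)]
  have : k + x' + x = k + (x + x') := by abel
  rw [this, ← AddChar.map_add_eq_mul, add_dotProduct, dotProduct_add]
  congr 2
  ring

theorem pauli_zero {n : ℕ} : pauli (0 : ZMod p) (0 : Fin n → ZMod p) 0 = 1 := by
  ext j k
  simp [pauli, Matrix.one_apply]

theorem pauli_conjTranspose {n : ℕ} (y : ZMod p) (x z : Fin n → ZMod p) :
    (pauli y x z).conjTranspose = pauli (-y + z ⬝ᵥ x) (-x) (-z) := by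
  ext j k
  simp only [Matrix.conjTranspose_apply, pauli, Matrix.of_apply]
  have : k = j + x ↔ j = k + -x := by
    constructor <;> rintro rfl <;> simp
  simp only [this]
  split_ifs with h
  · subst h
    rw [← starRingEnd_apply, ← AddChar.map_neg_eq_conj]
    congr 1
    simp only [dotProduct_add, dotProduct_neg, neg_dotProduct]
    ring
  · simp

theorem pauli_phase_injective {n : ℕ} {y y' : ZMod p} {x z : Fin n → ZMod p}
    (h : pauli y x z = pauli y' x z) : y = y' := by
  have := congrFun (congrFun h x) 0
  simp only [pauli, Matrix.of_apply, zero_add, if_true, dotProduct_zero, add_zero] at this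
  exact ZMod.injective_stdAddChar this

theorem pauli_mem {n : ℕ} (y : ZMod p) (x z : Fin n → ZMod p) :
    pauli y x z ∈ Matrix.unitaryGroup (Fin n → ZMod p) ℂ := by
  rw [Matrix.mem_unitaryGroup_iff, Matrix.star_eq_conjTranspose, pauli_conjTranspose, pauli_mul,
    ← pauli_zero]
  congr 1 <;> simp

theorem dotProduct_word {m n : ℕ} (x y : Fin (m + n) → ZMod p) :
    x ⬝ᵥ y = lft x ⬝ᵥ lft y + rgt x ⬝ᵥ rgt y := by
  simp only [dotProduct, Fin.sum_univ_add]
  rfl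

theorem lft_add {m n : ℕ} (x y : Fin (m + n) → ZMod p) : lft (x + y) = lft x + lft y := rfl

theorem rgt_add {m n : ℕ} (x y : Fin (m + n) → ZMod p) : rgt (x + y) = rgt x + rgt y := rfl

theorem lft_neg {m n : ℕ} (x : Fin (m + n) → ZMod p) : lft (-x) = -lft x := rfl

theorem rgt_neg {m n : ℕ} (x : Fin (m + n) → ZMod p) : rgt (-x) = -rgt x := rfl

/-- The stabiliser group of the maximally entangled state. -/
def bellGroup (p n : ℕ) [Fact p.Prime] :
    Subgroup (Matrix.unitaryGroup (Fin (n + n) → ZMod p) ℂ) where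
  carrier := {s | ∃ x z : Fin n → ZMod p, s.1 = pauli 0 (Fin.append x x) (Fin.append z (-z))}
  one_mem' := ⟨0, 0, by
    rw [show Fin.append (0 : Fin n → ZMod p) 0 = 0 from word_ext (by simp; rfl) (by simp; rfl),
      show Fin.append (0 : Fin n → ZMod p) (-0) = 0 from word_ext (by simp; rfl) (by simp; rfl),
      pauli_zero]
    rfl⟩
  mul_mem' := by
    rintro s t ⟨x, z, hs⟩ ⟨x', z', ht⟩
    refine ⟨x + x', z + z', ?_⟩
    rw [Submonoid.coe_mul, hs, ht, pauli_mul]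
    congr 1
    · simp [dotProduct_word]
    · exact word_ext (by simp [lft_add]) (by simp [rgt_add])
    · exact word_ext (by simp [lft_add]) (by simp [rgt_add, add_comm])
  inv_mem' := by
    rintro s ⟨x, z, hs⟩
    refine ⟨-x, -z, ?_⟩
    change star s.1 = _
    rw [hs, Matrix.star_eq_conjTranspose, pauli_conjTranspose]
    congr 1
    · simp [dotProduct_word]
    · exact word_ext (by simp [lft_neg]) (by simp [rgt_neg])
    · exact word_ext (by simp [lft_neg]) (by simp [rgt_neg])

theorem isStabiliserGroup_bellGroup (n : ℕ) : IsStabiliserGroup (bellGroup p n) := by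
  refine ⟨⟨?_, ?_, ?_⟩, ?_⟩
  · rintro s ⟨x, z, hs⟩
    exact ⟨_, _, _, hs⟩
  · rintro s ⟨x, z, hs⟩ t ⟨x', z', ht⟩
    apply Subtype.ext
    rw [Submonoid.coe_mul, Submonoid.coe_mul, hs, ht, pauli_mul, pauli_mul, add_comm (Fin.append x x),
      add_comm (Fin.append z (-z))]
    congr 1
    simp [dotProduct_word]
  · rintro s ⟨x, z, hs⟩ y hy
    rw [hs] at hy
    have h := congrFun (congrFun hy (Fin.append x x)) 0
    simp only [pauli, Matrix.of_apply, zero_add, if_true, dotProduct_zero, add_zero,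
      AddChar.map_zero_eq_one] at h
    split_ifs at h with h0
    · refine ZMod.injective_stdAddChar ?_
      rw [← h, AddChar.map_zero_eq_one]
    · exact absurd h one_ne_zero
  · intro T hT hle t ht
    obtain ⟨y, a, c, hac⟩ := hT.isPauli t ht
    have key : ∀ x z : Fin n → ZMod p, c ⬝ᵥ Fin.append x x = Fin.append z (-z) ⬝ᵥ a := by
      intro x z
      have hs : (⟨pauli 0 (Fin.append x x) (Fin.append z (-z)), pauli_mem _ _ _⟩ :
          Matrix.unitaryGroup (Fin (n + n) → ZMod p) ℂ) ∈ bellGroup p n := ⟨x, z, rfl⟩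
      have h := congrArg Subtype.val (hT.comm t ht _ (hle hs))
      rw [Submonoid.coe_mul, Submonoid.coe_mul, hac, pauli_mul, pauli_mul,
        add_comm (Fin.append x x), add_comm (Fin.append z (-z))] at h
      simpa using pauli_phase_injective h
    have ha : lft a = rgt a := by
      refine dotProduct_eq _ _ fun w => ?_
      have := key 0 w
      simp only [dotProduct_word, lft_append, rgt_append, dotProduct_zero, add_zero,
        neg_dotProduct] at this
      rw [dotProduct_comm, dotProduct_comm (rgt a)]
      linear_combination -this
    have hc : rgt c = -lft c := by
      refine dotProduct_eq _ _ fun w => ?_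
      have := key w 0
      simp only [dotProduct_word, lft_append, rgt_append, zero_dotProduct, add_zero,
        neg_zero] at this
      rw [neg_dotProduct]
      linear_combination this
    have ha' : a = Fin.append (lft a) (lft a) := word_ext (by simp) (by simp [ha])
    have hc' : c = Fin.append (lft c) (-lft c) := word_ext (by simp) (by simp [hc])
    have hca : c ⬝ᵥ -a = 0 := by
      rw [dotProduct_word, lft_neg, rgt_neg, hc, ha]
      simp
    have hs : (⟨pauli 0 (-a) (-c), pauli_mem _ _ _⟩ :
        Matrix.unitaryGroup (Fin (n + n) → ZMod p) ℂ) ∈ bellGroup p n :=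
      ⟨-lft a, -lft c, congrArg₂ (pauli 0)
        (word_ext (by simp [lft_neg]) (by simp [rgt_neg, ha]))
        (word_ext (by simp [lft_neg]) (by simp [rgt_neg, hc]))⟩
    have hy : y = 0 := by
      refine hT.phase _ (T.mul_mem ht (hle hs)) y ?_
      rw [Submonoid.coe_mul, hac, pauli_mul, hca]
      congr 1 <;> simp
    refine ⟨lft a, lft c, ?_⟩
    rw [hac, ← ha', ← hc', hy]

theorem isStab_scal_pow (n : ℕ) : IsStab (scal p ((Real.sqrt p : ℂ) ^ n)) := by
  induction n with
  | zero =>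
    have : scal p ((Real.sqrt p : ℂ) ^ 0) = 1 := by
      ext i j
      simp [scal, Matrix.one_apply, Subsingleton.elim i j]
    rw [this]
    exact isStab_one
  | succ n ih =>
    have : scal p ((Real.sqrt p : ℂ) ^ (n + 1)) =
        scal p ((Real.sqrt p : ℂ) ^ n) * scal p (Real.sqrt p) := by
      ext i j
      simp [scal, Matrix.mul_apply, pow_succ]
    rw [this]
    exact .comp _ _ .sqrt ih

theorem isStab_cup (n : ℕ) : IsStab (cup n : Mx (ZMod p) 0 (n + n)) := by
  have hp : (0 : ℝ) < p := by exact_mod_cast (Fact.out : p.Prime).pos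
  have hs : ((Real.sqrt p : ℂ)) ≠ 0 := by
    exact_mod_cast (Real.sqrt_pos.mpr hp).ne'
  set ψ : (Fin (n + n) → ZMod p) → ℂ :=
    fun y => if lft y = rgt y then ((Real.sqrt p : ℂ) ^ n)⁻¹ else 0 with hψ
  have h : IsStabiliserState ψ := by
    refine ⟨?_, bellGroup p n, isStabiliserGroup_bellGroup n, ?_⟩
    · have h1 : ((Real.sqrt p : ℝ) ^ n) ^ 2 = (p : ℝ) ^ n := by
        rw [← pow_mul, mul_comm, pow_mul, Real.sq_sqrt hp.le]
      rw [sum_word]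
      have h2 : ∀ u v : Fin n → ZMod p, ‖ψ (Fin.append u v)‖ ^ 2 =
          if u = v then ((p : ℝ) ^ n)⁻¹ else 0 := by
        intro u v
        simp only [hψ, lft_append, rgt_append]
        split_ifs
        · rw [norm_inv, norm_pow, Complex.norm_real, Real.norm_of_nonneg (Real.sqrt_nonneg _),
            inv_pow, h1]
        · simp
      simp only [h2, Finset.sum_ite_eq, Finset.mem_univ, if_true, Finset.sum_const,
        Finset.card_univ, Fintype.card_fun, ZMod.card, Fintype.card_fin, nsmul_eq_mul]
      push_cast
      exact mul_inv_cancel₀ (pow_pos hp n).ne'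
    · rintro s ⟨x, z, hs⟩
      rw [hs]
      funext j
      have h3 : ∀ k : Fin (n + n) → ZMod p,
          j = k + Fin.append x x ↔ k = j - Fin.append x x := by
        intro k
        constructor <;> rintro rfl <;> simp
      simp only [Matrix.mulVec, dotProduct, pauli, Matrix.of_apply, h3, ite_mul, zero_mul,
        Finset.sum_ite_eq', Finset.mem_univ, if_true]
      change ZMod.stdAddChar (0 + Fin.append z (-z) ⬝ᵥ (j - Fin.append x x)) * _ = _
      have hl : lft (j - Fin.append x x) = lft j - x := by
        rw [sub_eq_add_neg, lft_add, lft_neg, lft_append, sub_eq_add_neg]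
      have hr : rgt (j - Fin.append x x) = rgt j - x := by
        rw [sub_eq_add_neg, rgt_add, rgt_neg, rgt_append, sub_eq_add_neg]
      simp only [hψ, hl, hr, sub_left_inj, dotProduct_word, lft_append, rgt_append]
      split_ifs with h4
      · rw [h4]
        simp
      · simp
  have h' : (cup n : Mx (ZMod p) 0 (n + n)) = ket ψ * scal p ((Real.sqrt p : ℂ) ^ n) := by
    ext y x
    rw [cup_apply]
    simp [Matrix.mul_apply, ket, scal, hψ, hs]
  rw [h']
  exact .comp _ _ (isStab_scal_pow n) (.state ψ h)

end Stabiliser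

/-- The `†`-compact closed category `Stab_p` of pure qupit stabiliser maps, a subcategory of the
category of finite-dimensional Hilbert spaces. The object with `n` wires is `(ℂ^p)^{⊗ n}`. -/
structure Stab (p : ℕ) where
  wires : ℕ

namespace Stab

open Mx

variable {p : ℕ} [Fact p.Prime]

instance : Category (Stab p) where
  Hom X Y := {f : Mx (ZMod p) X.wires Y.wires // IsStab f}
  id X := ⟨1, isStab_one⟩
  comp f g := ⟨g.1 * f.1, .comp _ _ f.2 g.2⟩
  id_comp f := Subtype.ext (Matrix.mul_one f.1)
  comp_id f := Subtype.ext (Matrix.one_mul f.1)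
  assoc f g h := Subtype.ext (Matrix.mul_assoc h.1 g.1 f.1).symm

/-- Relabelling along a bijection, as an isomorphism. -/
def relabelIso {X Y : Stab p} (σ : Fin Y.wires ≃ Fin X.wires) : X ≅ Y where
  hom := ⟨relabel σ, isStab_relabel σ⟩
  inv := ⟨relabel σ.symm, isStab_relabel σ.symm⟩
  hom_inv_id := Subtype.ext (relabel_symm_mul σ)
  inv_hom_id := Subtype.ext (relabel_mul_symm σ)

instance : MonoidalCategoryStruct (Stab p) where
  tensorObj X Y := ⟨X.wires + Y.wires⟩
  tensorUnit := ⟨0⟩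
  tensorHom f g := ⟨tens f.1 g.1, .tens _ _ f.2 g.2⟩
  whiskerLeft X _ _ f := ⟨tens (1 : Mx (ZMod p) X.wires X.wires) f.1, .tens _ _ isStab_one f.2⟩
  whiskerRight f Y := ⟨tens f.1 (1 : Mx (ZMod p) Y.wires Y.wires), .tens _ _ f.2 isStab_one⟩
  associator X Y Z := relabelIso (assocE X.wires Y.wires Z.wires)
  leftUnitor X := relabelIso (leftE X.wires)
  rightUnitor X := relabelIso (rightE X.wires)

instance : MonoidalCategory (Stab p) := MonoidalCategory.ofTensorHom
  (id_tensorHom_id := fun _ _ => Subtype.ext tens_one)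
  (id_tensorHom := fun _ _ _ _ => rfl)
  (tensorHom_id := fun _ _ => rfl)
  (tensorHom_comp_tensorHom := fun f₁ f₂ g₁ g₂ => Subtype.ext (tens_mul_tens f₁.1 f₂.1 g₁.1 g₂.1))
  (associator_naturality := fun f₁ f₂ f₃ => Subtype.ext (associator_natural f₁.1 f₂.1 f₃.1))
  (leftUnitor_naturality := fun f => Subtype.ext (leftUnitor_natural f.1))
  (rightUnitor_naturality := fun f => Subtype.ext (rightUnitor_natural f.1))
  (pentagon := fun W X Y Z => Subtype.ext (relabel_pentagon W.wires X.wires Y.wires Z.wires))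
  (triangle := fun X Y => Subtype.ext (relabel_triangle X.wires Y.wires))

instance : SymmetricCategory (Stab p) where
  braiding X Y := relabelIso (braidE X.wires Y.wires)
  braiding_naturality_right X _ _ f :=
    Subtype.ext (braiding_natural (1 : Mx (ZMod p) X.wires X.wires) f.1)
  braiding_naturality_left f Z :=
    Subtype.ext (braiding_natural f.1 (1 : Mx (ZMod p) Z.wires Z.wires))
  hexagon_forward X Y Z := Subtype.ext (relabel_hexagon X.wires Y.wires Z.wires)
  hexagon_reverse X Y Z := Subtype.ext (relabel_hexagon' X.wires Y.wires Z.wires)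
  symmetry X Y := Subtype.ext (relabel_symmetry X.wires Y.wires)

/-- Spaces are identified with their duals through the canonical basis. -/
instance : RightRigidCategory (Stab p) where
  rightDual X :=
    { rightDual := X
      exact :=
        { coevaluation' := ⟨cup X.wires, isStab_cup X.wires⟩
          evaluation' := ⟨(cup X.wires : Mx (ZMod p) 0 (X.wires + X.wires)).conjTranspose,
            .dag _ (isStab_cup X.wires)⟩
          coevaluation_evaluation' := Subtype.ext (cup_snake X.wires)
          evaluation_coevaluation' := Subtype.ext (cup_snake' X.wires) } }

instance : DaggerCompactCategory (Stab p) where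
  dag f := ⟨f.1.conjTranspose, .dag _ f.2⟩
  dag_id _ := Subtype.ext Matrix.conjTranspose_one
  dag_comp f g := Subtype.ext (Matrix.conjTranspose_mul g.1 f.1)
  dag_dag f := Subtype.ext (Matrix.conjTranspose_conjTranspose f.1)
  dag_tensorHom f g := Subtype.ext (conjTranspose_tens f.1 g.1)
  dag_associator_hom _ _ _ := Subtype.ext (conjTranspose_relabel _)
  dag_leftUnitor_hom _ := Subtype.ext (conjTranspose_relabel _)
  dag_rightUnitor_hom _ := Subtype.ext (conjTranspose_relabel _)
  dag_braiding_hom _ _ := Subtype.ext (conjTranspose_relabel _)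
  dag_cap X := Subtype.ext
    ((Matrix.conjTranspose_conjTranspose _).trans (braid_cup X.wires).symm)

end Stab

/-! ### The CPM construction -/

namespace Mx

variable {K : Type} {a b c d s t : ℕ}

/-- The first components of a word of pairs. -/
def fstW (x : Fin a → K × K) : Fin a → K := fun i => (x i).1

/-- The second components of a word of pairs. -/
def sndW (x : Fin a → K × K) : Fin a → K := fun i => (x i).2

/-- A word of pairs from a pair of words. -/
def pairW (x y : Fin a → K) : Fin a → K × K := fun i => (x i, y i)

@[simp] theorem fstW_pairW (x y : Fin a → K) : fstW (pairW x y) = x := rfl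

@[simp] theorem sndW_pairW (x y : Fin a → K) : sndW (pairW x y) = y := rfl

theorem pairW_eq (x : Fin a → K × K) : pairW (fstW x) (sndW x) = x := rfl

theorem pairWord_ext {x y : Fin a → K × K} : x = y ↔ fstW x = fstW y ∧ sndW x = sndW y :=
  ⟨by rintro rfl; simp, fun h => by rw [← pairW_eq x, ← pairW_eq y, h.1, h.2]⟩

theorem sum_pairW [Fintype K] {M : Type*} [AddCommMonoid M] (F : (Fin a → K × K) → M) :
    ∑ x, F x = ∑ y : Fin a → K, ∑ z : Fin a → K, F (pairW y z) := by
  rw [← Fintype.sum_prod_type', ← (Equiv.arrowProdEquivProdArrow (Fin a) (fun _ => K)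
    (fun _ => K)).symm.sum_comp]
  rfl

/-- The matrix of the superoperator with Kraus operators `f (- ⊗ |s⟩)`, with the two copies of every
wire paired up. -/
def superop [Fintype K] (f : Mx K (a + s) b) : Mx (K × K) a b :=
  Matrix.of fun y x => ∑ i : Fin s → K,
    f (fstW y) (Fin.append (fstW x) i) * star (f (sndW y) (Fin.append (sndW x) i))

/-- The matrix of conjugation by `f`. -/
def dbl (f : Mx K a b) : Mx (K × K) a b :=
  Matrix.of fun y x => f (fstW y) (fstW x) * star (f (sndW y) (sndW x))

variable [DecidableEq K]

theorem dbl_relabel (σ : Fin b ≃ Fin a) : dbl (relabel σ : Mx K a b) = relabel σ := by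
  ext y x
  have : (y = x ∘ σ) ↔ fstW y = fstW x ∘ σ ∧ sndW y = sndW x ∘ σ := pairWord_ext
  simp only [dbl, Matrix.of_apply, relabel_apply, this, ite_and]
  split_ifs <;> simp

theorem dbl_cup (n : ℕ) : dbl (cup n : Mx K 0 (n + n)) = cup n := by
  ext y x
  have : lft y = rgt y ↔ lft (fstW y) = rgt (fstW y) ∧ lft (sndW y) = rgt (sndW y) := pairWord_ext
  simp only [dbl, Matrix.of_apply, cup_apply, this, ite_and]
  split_ifs <;> simp

theorem dbl_conjTranspose (f : Mx K a b) :
    dbl f.conjTranspose = (dbl f).conjTranspose := by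
  ext y x
  simp [dbl]

variable [Fintype K]

theorem superop_pure (f : Mx K a b) :
    superop (f * (relabel (rightE a) : Mx K (a + 0) a)) = dbl f := by
  ext y x
  simp only [superop, Matrix.of_apply, mul_relabel, ← lft_eq_rightE, lft_append, dbl]
  simp

theorem mul_tens_one_apply (f : Mx K (a + s) b) (g : Mx K (b + t) c) (z : Fin c → K)
    (x : Fin a → K) (i : Fin s → K) (j : Fin t → K) :
    (g * tens f (1 : Mx K t t) * (relabel (assocE a s t).symm : Mx K _ _)) z
        (Fin.append x (Fin.append i j)) =
      ∑ y : Fin b → K, g z (Fin.append y j) * f y (Fin.append x i) := by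
  rw [mul_relabel, Matrix.mul_apply, sum_word]
  refine Finset.sum_congr rfl fun y _ => ?_
  have h : lft (Fin.append x (Fin.append i j) ∘ (assocE a s t).symm) = Fin.append x i :=
    word_ext (by simp [lft_lft_assocE_symm]) (by simp [rgt_lft_assocE_symm])
  simp [tens_apply, h, rgt_assocE_symm, Matrix.one_apply]

theorem superop_comp (f : Mx K (a + s) b) (g : Mx K (b + t) c) :
    superop (g * tens f (1 : Mx K t t) * (relabel (assocE a s t).symm : Mx K _ _)) =
      superop g * superop f := by
  ext z x
  simp only [superop, Matrix.mul_apply (M := Matrix.of _), Matrix.of_apply, sum_pairW, fstW_pairW,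
    sndW_pairW]
  rw [sum_word]
  simp only [mul_tens_one_apply, star_sum, Finset.sum_mul_sum]
  rw [Finset.sum_comm]
  simp only [Finset.sum_comm (s := (Finset.univ : Finset (Fin s → K)))
    (t := (Finset.univ : Finset (Fin b → K)))]
  rw [Finset.sum_comm]
  refine Finset.sum_congr rfl fun y _ => ?_
  rw [Finset.sum_comm]
  refine Finset.sum_congr rfl fun y' _ => Finset.sum_congr rfl fun j _ =>
    Finset.sum_congr rfl fun i _ => ?_
  rw [star_mul']
  ring

theorem superop_tens {a' b' s' : ℕ} (f : Mx K (a + s) b) (g : Mx K (a' + s') b')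
    (h : Mx K ((a + a') + (s + s')) (b + b'))
    (hm : ∀ y x, h y x = tens f g y (Fin.append
      (Fin.append (lft (lft x)) (lft (rgt x))) (Fin.append (rgt (lft x)) (rgt (rgt x))))) :
    superop h = tens (superop f) (superop g) := by
  ext y x
  simp only [superop, Matrix.of_apply, hm, tens_apply, sum_word, lft_append, rgt_append,
    Finset.sum_mul_sum, star_mul']
  refine Finset.sum_congr rfl fun i _ => Finset.sum_congr rfl fun j _ => ?_
  exact mul_mul_mul_comm _ _ _ _

theorem superop_dag (f : Mx K (a + s) b) (m : Mx K (b + s) a)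
    (hm : ∀ y x, m y x = star (f (lft x) (Fin.append y (rgt x)))) :
    superop m = (superop f).conjTranspose := by
  ext y x
  simp only [superop, Matrix.of_apply, Matrix.conjTranspose_apply, hm, lft_append, rgt_append]
  simp [mul_comm]

/-- The interchange of the two middle tensor factors. -/
theorem mul_interchange {a a' e : ℕ} (h : Mx K ((a + s) + (a' + t)) e) (y : Fin e → K)
    (x : Fin ((a + a') + (s + t)) → K) :
    (h * ((relabel (assocE a s (a' + t)).symm : Mx K _ _) *
      tens (1 : Mx K a a) (relabel (assocE s a' t) : Mx K _ _) *
      tens (1 : Mx K a a) (tens (relabel (braidE a' s) : Mx K _ _) (1 : Mx K t t)) *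
      tens (1 : Mx K a a) (relabel (assocE a' s t).symm : Mx K _ _) *
      (relabel (assocE a a' (s + t)) : Mx K _ _))) y x =
    h y (Fin.append (Fin.append (lft (lft x)) (lft (rgt x)))
      (Fin.append (rgt (lft x)) (rgt (rgt x)))) := by
  simp only [← relabel_refl, tens_relabel, relabel_mul_relabel]
  rw [mul_relabel]
  congr 1
  simp only [Equiv.coe_trans, ← Function.comp_assoc]
  refine word_ext (word_ext ?_ ?_) (word_ext ?_ ?_) <;>
  simp only [lft_assocE, lft_rgt_assocE, rgt_rgt_assocE, lft_lft_assocE_symm, rgt_lft_assocE_symm,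
    rgt_assocE_symm, lft_braidE, rgt_braidE, lft_tensE, rgt_tensE, Equiv.coe_refl,
    Function.comp_id, lft_append, rgt_append]

/-- Bending the environment wire of the adjoint. -/
theorem bend_apply (f : Mx K (a + s) b) (y : Fin a → K) (x : Fin (b + s) → K) :
    ((relabel (rightE a) : Mx K _ _) *
      tens (1 : Mx K a a) (cup s : Mx K 0 (s + s)).conjTranspose *
      (relabel (assocE a s s) : Mx K _ _) * tens f.conjTranspose (1 : Mx K s s)) y x =
    star (f (lft x) (Fin.append y (rgt x))) := by
  have h : ∀ (u : Fin a → K) (v w : Fin s → K),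
      lft (Fin.append u (Fin.append v w) ∘ (assocE a s s).symm) = Fin.append u v := fun u v w =>
    word_ext (by simp [lft_lft_assocE_symm]) (by simp [rgt_lft_assocE_symm])
  have h' : lft (y ∘ (rightE a).symm) = y := rfl
  rw [Matrix.mul_assoc, Matrix.mul_assoc, relabel_mul, Matrix.mul_apply]
  simp only [relabel_mul, tens_apply, sum_word, lft_append, rgt_append, h, h', rgt_assocE_symm,
    Matrix.conjTranspose_apply, cup_apply, Matrix.one_apply]
  simp

/-- Bending both wires transposes a matrix. -/
theorem mate_apply (f : Mx K a b) (x : Fin a → K) (y : Fin b → K) :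
    ((relabel (leftE a) : Mx K _ _) *
      tens (cup b : Mx K 0 (b + b)).conjTranspose (1 : Mx K a a) *
      (relabel (assocE b b a).symm : Mx K _ _) * tens (1 : Mx K b b) (tens f (1 : Mx K a a)) *
      tens (1 : Mx K b b) (cup a : Mx K 0 (a + a)) *
      (relabel (rightE b).symm : Mx K _ _)) x y = f y x := by
  rw [mul_relabel]
  simp only [Matrix.mul_assoc, relabel_mul]
  rw [Matrix.mul_apply]
  simp only [relabel_mul, tens_mul_tens, Matrix.one_mul]
  have h : ∀ w : Fin (b + b + a) → K, lft (w ∘ (assocE b b a).symm.symm) = lft (lft w) := fun _ => rfl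
  have h0 : lft (y ∘ (rightE b).symm) = y := rfl
  have h1 : rgt (x ∘ (leftE a).symm) = x := by
    rw [rgt_eq_leftE]; funext i; simp
  have h2 : ∀ (u v : Fin b → K) (w : Fin a → K) z,
      (tens f (1 : Mx K a a) * (cup a : Mx K 0 (a + a))) (Fin.append v w) z = f v w := by
    intro u v w z
    rw [Matrix.mul_apply]
    simp [sum_word, tens_apply, cup_apply, Matrix.one_apply]
  have h3 : ∀ (u v : Fin b → K) (w : Fin a → K),
      rgt (Fin.append (Fin.append u v) w ∘ (assocE b b a).symm.symm) = Fin.append v w :=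
    fun u v w => word_ext (by simp [lft_rgt_assocE]) (by simp [rgt_rgt_assocE])
  simp only [tens_apply, sum_word, lft_append, rgt_append, h, h0, h1, h3,
    Matrix.conjTranspose_apply, cup_apply, Matrix.one_apply]
  simp [h2 y]

end Mx

namespace Stab

open Mx

variable {p : ℕ} [Fact p.Prime]

/-- A representative `(f, S)` of a morphism `X ⟶ Y` of `CPM(Stab_p)`: a map `f : X ⊗ S ⟶ Y`. -/
structure Dilation (X Y : Stab p) where
  env : Stab p
  map : X ⊗ env ⟶ Y

/-- The conjugate `f_* = (f†)^* : X^* ⟶ Y^*`. -/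
def conj {X Y : Stab p} (f : X ⟶ Y) : Xᘁ ⟶ Yᘁ := (DaggerCategory.dag f)ᘁ

/-- The doubled map `X ⊗ X^* ⟶ Y ⊗ Y^*` of `f : X ⊗ S ⟶ Y`: the tensor product of `f` and its
conjugate, with the wires `S` and `S^*` connected by a cup. (In this category, the duals
`X^* ⊗ S^*` and `(X ⊗ S)^*` coincide.) -/
def Dilation.double {X Y : Stab p} (r : Dilation X Y) : X ⊗ Xᘁ ⟶ Y ⊗ Yᘁ :=
  (ρ_ (X ⊗ Xᘁ)).inv ≫ (X ⊗ Xᘁ) ◁ η_ r.env r.envᘁ ≫ tensorμ X Xᘁ r.env r.envᘁ ≫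
    (r.map ⊗ₘ (conj r.map : Xᘁ ⊗ r.envᘁ ⟶ Yᘁ))

theorem conj_val {X Y : Stab p} (f : X ⟶ Y) :
    (conj f).1 = (f.1.conjTranspose).transpose := by
  ext y x
  exact mate_apply f.1.conjTranspose y x

theorem Dilation.double_val {X Y : Stab p} (r : Dilation X Y)
    (y : Fin (Y.wires + Y.wires) → ZMod p) (x : Fin (X.wires + X.wires) → ZMod p) :
    r.double.1 y x = superop r.map.1 (pairW (lft y) (rgt y)) (pairW (lft x) (rgt x)) := by
  have h : r.double.1 = (tens r.map.1 (conj r.map).1 *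
      ((relabel (assocE X.wires r.env.wires (X.wires + r.env.wires)).symm : Mx (ZMod p) _ _) *
      tens (1 : Mx (ZMod p) X.wires X.wires)
        (relabel (assocE r.env.wires X.wires r.env.wires) : Mx (ZMod p) _ _) *
      tens (1 : Mx (ZMod p) X.wires X.wires)
        (tens (relabel (braidE X.wires r.env.wires) : Mx (ZMod p) _ _)
          (1 : Mx (ZMod p) r.env.wires r.env.wires)) *
      tens (1 : Mx (ZMod p) X.wires X.wires)
        (relabel (assocE X.wires r.env.wires r.env.wires).symm : Mx (ZMod p) _ _) *
      (relabel (assocE X.wires X.wires (r.env.wires + r.env.wires)) : Mx (ZMod p) _ _))) *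
      tens (1 : Mx (ZMod p) (X.wires + X.wires) (X.wires + X.wires))
        (cup r.env.wires : Mx (ZMod p) 0 (r.env.wires + r.env.wires)) *
      (relabel (rightE (X.wires + X.wires)).symm : Mx (ZMod p) _ _) := rfl
  have h0 : lft (x ∘ (rightE (X.wires + X.wires)).symm) = x := rfl
  rw [h, mul_relabel, Matrix.mul_apply]
  simp only [tens_apply, sum_word (a := X.wires + X.wires), h0, lft_append,
    rgt_append, sum_word (a := r.env.wires), cup_apply, Matrix.one_apply, conj_val]
  simp only [superop, Matrix.of_apply, fstW_pairW, sndW_pairW]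
  simp only [mul_ite, mul_one, mul_zero, Finset.sum_ite_eq, Finset.sum_ite_eq',
    Finset.mem_univ, if_true, Finset.sum_ite_irrel, Finset.sum_const_zero]
  refine Finset.sum_congr rfl fun i _ => (mul_interchange _ _ _).trans ?_
  simp [tens_apply]

/-- Two representatives define the same morphism of `CPM(Stab_p)` when their doubled maps agree. -/
instance dilationSetoid (X Y : Stab p) : Setoid (Dilation X Y) :=
  Setoid.ker Dilation.double

theorem dilation_rel_iff {X Y : Stab p} (r t : Dilation X Y) :
    r ≈ t ↔ superop r.map.1 = superop t.map.1 := by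
  change r.double = t.double ↔ _
  constructor
  · intro h
    ext y x
    have := r.double_val (Fin.append (fstW y) (sndW y)) (Fin.append (fstW x) (sndW x))
    rw [h, t.double_val] at this
    simpa [pairW_eq] using this.symm
  · intro h
    apply Subtype.ext
    ext y x
    rw [r.double_val, t.double_val, h]

namespace Dilation

/-- A pure map, with trivial environment. -/
def pure {X Y : Stab p} (f : X ⟶ Y) : Dilation X Y := ⟨𝟙_ _, (ρ_ X).hom ≫ f⟩

/-- Sequential composition; the environments are tensored. -/
def comp {X Y Z : Stab p} (r : Dilation X Y) (t : Dilation Y Z) : Dilation X Z :=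
  ⟨r.env ⊗ t.env, (α_ X r.env t.env).inv ≫ r.map ▷ t.env ≫ t.map⟩

/-- Parallel composition; the environments are tensored. -/
def tensor {X Y X' Y' : Stab p} (r : Dilation X Y) (t : Dilation X' Y') :
    Dilation (X ⊗ X') (Y ⊗ Y') :=
  ⟨r.env ⊗ t.env, tensorμ X X' r.env t.env ≫ (r.map ⊗ₘ t.map)⟩

/-- The adjoint, whose outgoing environment wire is bent round to an incoming one. -/
def dag {X Y : Stab p} (r : Dilation X Y) : Dilation Y X :=
  ⟨r.envᘁ, DaggerCategory.dag r.map ▷ r.envᘁ ≫ (α_ X r.env r.envᘁ).hom ≫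
    X ◁ DaggerCategory.dag (η_ r.env r.envᘁ) ≫ (ρ_ X).hom⟩

theorem superop_pure {X Y : Stab p} (f : X ⟶ Y) : superop (pure f).map.1 = dbl f.1 :=
  Mx.superop_pure f.1

theorem superop_comp {X Y Z : Stab p} (r : Dilation X Y) (t : Dilation Y Z) :
    superop (r.comp t).map.1 = superop t.map.1 * superop r.map.1 :=
  Mx.superop_comp r.map.1 t.map.1

theorem superop_tensor {X Y X' Y' : Stab p} (r : Dilation X Y) (t : Dilation X' Y') :
    superop (r.tensor t).map.1 = tens (superop r.map.1) (superop t.map.1) :=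
  Mx.superop_tens r.map.1 t.map.1 _ fun y x => mul_interchange (tens r.map.1 t.map.1) y x

theorem superop_dag {X Y : Stab p} (r : Dilation X Y) :
    superop r.dag.map.1 = (superop r.map.1).conjTranspose :=
  Mx.superop_dag r.map.1 _ fun y x => bend_apply r.map.1 y x

end Dilation

end Stab

/-- The `†`-compact closed category `CPM(Stab_p)` of mixed qupit stabiliser maps. It has the objects
of `Stab_p`, and its morphisms are the equivalence classes `[f, S]`. -/
structure CPMStab (p : ℕ) where
  of ::
  base : Stab p

namespace CPMStab

open Mx Stab

variable {p : ℕ} [Fact p.Prime]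

instance : CategoryStruct (CPMStab p) where
  Hom X Y := Quotient (dilationSetoid X.base Y.base)
  id X := Quotient.mk _ (Dilation.pure (𝟙 X.base))
  comp := Quotient.map₂ (fun r t => r.comp t) (by
    intro r r' hr t t' ht
    rw [dilation_rel_iff] at *
    rw [Dilation.superop_comp, Dilation.superop_comp, hr, ht])

/-- The superoperator matrix of a morphism; it determines the morphism. -/
def toMx {X Y : CPMStab p} (f : X ⟶ Y) : Mx (ZMod p × ZMod p) X.base.wires Y.base.wires :=
  Quotient.lift (fun r : Dilation X.base Y.base => superop r.map.1)
    (fun _ _ h => (dilation_rel_iff _ _).1 h) f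

theorem toMx_injective {X Y : CPMStab p} {f g : X ⟶ Y} (h : toMx f = toMx g) : f = g := by
  revert h
  refine Quotient.inductionOn₂ f g fun r t h => Quotient.sound ((dilation_rel_iff r t).2 h)

theorem toMx_comp {X Y Z : CPMStab p} (f : X ⟶ Y) (g : Y ⟶ Z) : toMx (f ≫ g) = toMx g * toMx f :=
  Quotient.inductionOn₂ f g fun r t => Dilation.superop_comp r t

theorem dbl_one {K : Type} [DecidableEq K] {n : ℕ} : dbl (1 : Mx K n n) = 1 := by
  rw [← relabel_refl, dbl_relabel, relabel_refl]

theorem dbl_mul {K : Type} [Fintype K] {a b c : ℕ} (f : Mx K a b) (g : Mx K b c) :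
    dbl (g * f) = dbl g * dbl f := by
  ext y x
  simp only [dbl, Matrix.of_apply, Matrix.mul_apply, sum_pairW, fstW_pairW, sndW_pairW, star_sum,
    Finset.sum_mul_sum, star_mul']
  refine Finset.sum_congr rfl fun i _ => Finset.sum_congr rfl fun j _ => by ring

theorem toMx_id (X : CPMStab p) : toMx (𝟙 X) = 1 :=
  (Dilation.superop_pure (𝟙 X.base)).trans dbl_one

instance : Category (CPMStab p) where
  id_comp f := toMx_injective (by rw [toMx_comp, toMx_id, Matrix.mul_one])
  comp_id f := toMx_injective (by rw [toMx_comp, toMx_id, Matrix.one_mul])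
  assoc f g h := toMx_injective (by simp only [toMx_comp, Matrix.mul_assoc])

variable (p) in
/-- The canonical functor `Stab_p ⥤ CPM(Stab_p)`, sending `f` to `[f, I]`. -/
def pure : Stab p ⥤ CPMStab p where
  obj X := ⟨X⟩
  map f := Quotient.mk _ (Dilation.pure f)
  map_id _ := rfl
  map_comp f g := toMx_injective (by
    rw [toMx_comp]
    exact (Dilation.superop_pure (f ≫ g)).trans ((dbl_mul f.1 g.1).trans
      (congrArg₂ (· * ·) (Dilation.superop_pure g).symm (Dilation.superop_pure f).symm)))

theorem toMx_pure {X Y : Stab p} (f : X ⟶ Y) : toMx ((pure p).map f) = dbl f.1 :=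
  Dilation.superop_pure f

/-- The tensor product of morphisms. -/
def tensor {X Y X' Y' : CPMStab p} (f : X ⟶ Y) (g : X' ⟶ Y') :
    (⟨X.base ⊗ X'.base⟩ : CPMStab p) ⟶ ⟨Y.base ⊗ Y'.base⟩ :=
  Quotient.map₂ (fun r t => r.tensor t) (by
    intro r r' hr t t' ht
    rw [dilation_rel_iff] at *
    rw [Dilation.superop_tensor, Dilation.superop_tensor, hr, ht]) f g

theorem toMx_tensor {X Y X' Y' : CPMStab p} (f : X ⟶ Y) (g : X' ⟶ Y') :
    toMx (tensor f g) = tens (toMx f) (toMx g) :=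
  Quotient.inductionOn₂ f g fun r t => Dilation.superop_tensor r t

instance : MonoidalCategoryStruct (CPMStab p) where
  tensorObj X Y := ⟨X.base ⊗ Y.base⟩
  tensorUnit := ⟨𝟙_ (Stab p)⟩
  tensorHom f g := tensor f g
  whiskerLeft X _ _ f := tensor (𝟙 X) f
  whiskerRight f Y := tensor f (𝟙 Y)
  associator X Y Z := (pure p).mapIso (α_ X.base Y.base Z.base)
  leftUnitor X := (pure p).mapIso (λ_ X.base)
  rightUnitor X := (pure p).mapIso (ρ_ X.base)

theorem toMx_tensorHom {X Y X' Y' : CPMStab p} (f : X ⟶ Y) (g : X' ⟶ Y') :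
    toMx (f ⊗ₘ g) = tens (toMx f) (toMx g) := toMx_tensor f g

theorem toMx_associator_hom (X Y Z : CPMStab p) : toMx (α_ X Y Z).hom =
    relabel (assocE X.base.wires Y.base.wires Z.base.wires) :=
  (toMx_pure _).trans (dbl_relabel _)

theorem toMx_associator_inv (X Y Z : CPMStab p) : toMx (α_ X Y Z).inv =
    relabel (assocE X.base.wires Y.base.wires Z.base.wires).symm :=
  (toMx_pure _).trans (dbl_relabel _)

theorem toMx_leftUnitor_hom (X : CPMStab p) : toMx (λ_ X).hom = relabel (leftE X.base.wires) :=
  (toMx_pure _).trans (dbl_relabel _)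

theorem toMx_leftUnitor_inv (X : CPMStab p) :
    toMx (λ_ X).inv = relabel (leftE X.base.wires).symm :=
  (toMx_pure _).trans (dbl_relabel _)

theorem toMx_rightUnitor_hom (X : CPMStab p) : toMx (ρ_ X).hom = relabel (rightE X.base.wires) :=
  (toMx_pure _).trans (dbl_relabel _)

theorem toMx_rightUnitor_inv (X : CPMStab p) :
    toMx (ρ_ X).inv = relabel (rightE X.base.wires).symm :=
  (toMx_pure _).trans (dbl_relabel _)

instance : MonoidalCategory (CPMStab p) := MonoidalCategory.ofTensorHom
  (id_tensorHom_id := fun X Y => toMx_injective (by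
    rw [toMx_tensorHom, toMx_id, toMx_id]; exact tens_one.trans (toMx_id (X ⊗ Y)).symm))
  (id_tensorHom := fun _ _ _ _ => rfl)
  (tensorHom_id := fun _ _ => rfl)
  (tensorHom_comp_tensorHom := fun f₁ f₂ g₁ g₂ => toMx_injective (by
    simp only [toMx_comp, toMx_tensorHom]
    exact tens_mul_tens _ _ _ _))
  (associator_naturality := fun f₁ f₂ f₃ => toMx_injective (by
    simp only [toMx_comp, toMx_tensorHom, toMx_associator_hom]
    exact associator_natural _ _ _))
  (leftUnitor_naturality := fun f => toMx_injective (by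
    simp only [toMx_comp, toMx_tensorHom, toMx_leftUnitor_hom, toMx_id]
    exact leftUnitor_natural _))
  (rightUnitor_naturality := fun f => toMx_injective (by
    simp only [toMx_comp, toMx_tensorHom, toMx_rightUnitor_hom, toMx_id]
    exact rightUnitor_natural _))
  (pentagon := fun W X Y Z => toMx_injective (by
    simp only [toMx_comp, toMx_tensorHom, toMx_associator_hom, toMx_id]
    exact relabel_pentagon W.base.wires X.base.wires Y.base.wires Z.base.wires))
  (triangle := fun X Y => toMx_injective (by
    simp only [toMx_comp, toMx_tensorHom, toMx_associator_hom, toMx_leftUnitor_hom,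
      toMx_rightUnitor_hom, toMx_id]
    exact relabel_triangle X.base.wires Y.base.wires))

theorem toMx_whiskerLeft (X : CPMStab p) {Y Z : CPMStab p} (f : Y ⟶ Z) :
    toMx (X ◁ f) = tens 1 (toMx f) := by
  rw [← MonoidalCategory.id_tensorHom, toMx_tensorHom, toMx_id]

theorem toMx_whiskerRight {Y Z : CPMStab p} (f : Y ⟶ Z) (X : CPMStab p) :
    toMx (f ▷ X) = tens (toMx f) 1 := by
  rw [← MonoidalCategory.tensorHom_id, toMx_tensorHom, toMx_id]

/-- The symmetry, as a pure map. -/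
def braidIso (X Y : CPMStab p) : X ⊗ Y ≅ Y ⊗ X := (pure p).mapIso (β_ X.base Y.base)

theorem toMx_braiding (X Y : CPMStab p) :
    toMx (braidIso X Y).hom = relabel (braidE X.base.wires Y.base.wires) :=
  (toMx_pure _).trans (dbl_relabel _)

instance : SymmetricCategory (CPMStab p) where
  braiding X Y := braidIso X Y
  braiding_naturality_right X _ _ f := toMx_injective (by
    rw [toMx_comp, toMx_comp, toMx_braiding, toMx_braiding, toMx_whiskerLeft, toMx_whiskerRight]
    exact braiding_natural _ _)
  braiding_naturality_left f Z := toMx_injective (by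
    rw [toMx_comp, toMx_comp, toMx_braiding, toMx_braiding, toMx_whiskerLeft, toMx_whiskerRight]
    exact braiding_natural _ _)
  hexagon_forward X Y Z := toMx_injective (by
    simp only [toMx_comp, toMx_braiding, toMx_whiskerLeft, toMx_whiskerRight, toMx_associator_hom]
    exact relabel_hexagon X.base.wires Y.base.wires Z.base.wires)
  hexagon_reverse X Y Z := toMx_injective (by
    simp only [toMx_comp, toMx_braiding, toMx_whiskerLeft, toMx_whiskerRight, toMx_associator_inv]
    exact relabel_hexagon' X.base.wires Y.base.wires Z.base.wires)
  symmetry X Y := toMx_injective (by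
    rw [toMx_comp, toMx_braiding, toMx_braiding, toMx_id]
    exact relabel_symmetry X.base.wires Y.base.wires)

/-- The cup, as a pure map. -/
def cupHom (X : CPMStab p) : 𝟙_ (CPMStab p) ⟶ X ⊗ ⟨X.baseᘁ⟩ := (pure p).map (η_ X.base X.baseᘁ)

/-- The cap, as a pure map. -/
def capHom (X : CPMStab p) : (⟨X.baseᘁ⟩ : CPMStab p) ⊗ X ⟶ 𝟙_ (CPMStab p) :=
  (pure p).map (ε_ X.base X.baseᘁ)

theorem toMx_cup (X : CPMStab p) : toMx (cupHom X) = cup X.base.wires :=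
  (toMx_pure _).trans (dbl_cup _)

theorem toMx_cap (X : CPMStab p) :
    toMx (capHom X) = (cup X.base.wires : Mx _ 0 (X.base.wires + X.base.wires)).conjTranspose :=
  (toMx_pure _).trans ((dbl_conjTranspose _).trans (congrArg _ (dbl_cup _)))

instance : RightRigidCategory (CPMStab p) where
  rightDual X :=
    { rightDual := ⟨X.baseᘁ⟩
      exact :=
        { coevaluation' := cupHom X
          evaluation' := capHom X
          coevaluation_evaluation' := toMx_injective (by
            rw [toMx_comp, toMx_comp, toMx_comp, toMx_whiskerLeft, toMx_whiskerRight,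
              toMx_associator_inv, toMx_rightUnitor_hom, toMx_leftUnitor_inv, toMx_cup, toMx_cap]
            exact cup_snake X.base.wires)
          evaluation_coevaluation' := toMx_injective (by
            rw [toMx_comp, toMx_comp, toMx_comp, toMx_whiskerLeft, toMx_whiskerRight,
              toMx_associator_hom, toMx_leftUnitor_hom, toMx_rightUnitor_inv, toMx_cup, toMx_cap]
            exact cup_snake' X.base.wires) } }

/-- The dagger. -/
def dagger {X Y : CPMStab p} (f : X ⟶ Y) : Y ⟶ X :=
  Quotient.map (fun r => r.dag) (by
    intro r r' hr
    rw [dilation_rel_iff] at *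
    rw [Dilation.superop_dag, Dilation.superop_dag, hr]) f

theorem toMx_dagger {X Y : CPMStab p} (f : X ⟶ Y) : toMx (dagger f) = (toMx f).conjTranspose :=
  Quotient.inductionOn f fun r => Dilation.superop_dag r

theorem dagger_pure {X Y : Stab p} (f : X ⟶ Y) :
    dagger ((pure p).map f) = (pure p).map (DaggerCategory.dag f) :=
  toMx_injective (by
    rw [toMx_dagger, toMx_pure, toMx_pure]
    exact (dbl_conjTranspose _).symm)

instance : DaggerCompactCategory (CPMStab p) where
  dag f := dagger f
  dag_id X := toMx_injective (by rw [toMx_dagger, toMx_id, Matrix.conjTranspose_one])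
  dag_comp f g := toMx_injective (by
    simp only [toMx_dagger, toMx_comp, Matrix.conjTranspose_mul])
  dag_dag f := toMx_injective (by
    rw [toMx_dagger, toMx_dagger, Matrix.conjTranspose_conjTranspose])
  dag_tensorHom f g := toMx_injective (by
    rw [toMx_dagger, toMx_tensorHom, toMx_tensorHom, toMx_dagger, toMx_dagger]
    exact conjTranspose_tens _ _)
  dag_associator_hom X Y Z := (dagger_pure _).trans
    (congrArg (pure p).map (DaggerSymmetricCategory.dag_associator_hom X.base Y.base Z.base))
  dag_leftUnitor_hom X := (dagger_pure _).trans
    (congrArg (pure p).map (DaggerSymmetricCategory.dag_leftUnitor_hom X.base))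
  dag_rightUnitor_hom X := (dagger_pure _).trans
    (congrArg (pure p).map (DaggerSymmetricCategory.dag_rightUnitor_hom X.base))
  dag_braiding_hom X Y := (dagger_pure _).trans
    (congrArg (pure p).map (DaggerSymmetricCategory.dag_braiding_hom X.base Y.base))
  dag_cap X := (dagger_pure _).trans
    ((congrArg (pure p).map (DaggerCompactCategory.dag_cap X.base)).trans
      ((pure p).map_comp _ _))

end CPMStab

/-! ### Affine coisotropic relations -/

open LinearMap (BilinForm)

section Forms

variable {k : Type*} [Field k] {V W V' W' U : Type*} [AddCommGroup V] [Module k V]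
  [AddCommGroup W] [Module k W] [AddCommGroup V'] [Module k V'] [AddCommGroup W'] [Module k W']
  [AddCommGroup U] [Module k U]

/-- The orthogonal direct sum of two bilinear forms. -/
def sumForm (B : BilinForm k V) (C : BilinForm k W) : BilinForm k (V × W) :=
  B.compl₁₂ (LinearMap.fst k V W) (LinearMap.fst k V W) +
    C.compl₁₂ (LinearMap.snd k V W) (LinearMap.snd k V W)

theorem sumForm_apply (B : BilinForm k V) (C : BilinForm k W) (x y : V × W) :
    sumForm B C x y = B x.1 y.1 + C x.2 y.2 := rfl

/-- An affine subspace is coisotropic if it is empty or its linear component `S` contains its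
symplectic complement. -/
def IsCoisotropic (B : BilinForm k V) (S : AffineSubspace k V) : Prop :=
  (S : Set V).Nonempty → B.orthogonal S.direction ≤ S.direction

/-- Composition of affine relations. -/
def affComp (R : AffineSubspace k (V × W)) (S : AffineSubspace k (W × U)) :
    AffineSubspace k (V × U) where
  carrier := {x | ∃ w, (x.1, w) ∈ R ∧ (w, x.2) ∈ S}
  smul_vsub_vadd_mem' := by
    rintro c x y z ⟨w, h₁, h₂⟩ ⟨w', h₁', h₂'⟩ ⟨w'', h₁'', h₂''⟩
    exact ⟨c • (w - w') + w'', R.smul_vsub_vadd_mem c h₁ h₁' h₁'', S.smul_vsub_vadd_mem c h₂ h₂' h₂''⟩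

/-- The direct sum of affine relations. -/
def affTensor (R : AffineSubspace k (V × W)) (S : AffineSubspace k (V' × W')) :
    AffineSubspace k ((V × V') × (W × W')) where
  carrier := {x | (x.1.1, x.2.1) ∈ R ∧ (x.1.2, x.2.2) ∈ S}
  smul_vsub_vadd_mem' := by
    rintro c x y z ⟨h₁, h₂⟩ ⟨h₁', h₂'⟩ ⟨h₁'', h₂''⟩
    exact ⟨R.smul_vsub_vadd_mem c h₁ h₁' h₁'', S.smul_vsub_vadd_mem c h₂ h₂' h₂''⟩

/-- The converse of an affine relation. -/
def affConverse (R : AffineSubspace k (V × W)) : AffineSubspace k (W × V) where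
  carrier := {x | (x.2, x.1) ∈ R}
  smul_vsub_vadd_mem' := by
    intro c x y z h h' h''
    exact R.smul_vsub_vadd_mem c h h' h''

/-- The graph of a linear map, as an affine relation. -/
def affGraph (f : V →ₗ[k] W) : AffineSubspace k (V × W) := f.graph.toAffineSubspace

theorem mem_affComp (R : AffineSubspace k (V × W)) (S : AffineSubspace k (W × U)) (v : V) (u : U) :
    (v, u) ∈ affComp R S ↔ ∃ w, (v, w) ∈ R ∧ (w, u) ∈ S := Iff.rfl

theorem mem_affTensor (R : AffineSubspace k (V × W)) (S : AffineSubspace k (V' × W'))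
    (v : V) (v' : V') (w : W) (w' : W') :
    ((v, v'), (w, w')) ∈ affTensor R S ↔ (v, w) ∈ R ∧ (v', w') ∈ S := Iff.rfl

theorem mem_affConverse (R : AffineSubspace k (V × W)) (v : V) (w : W) :
    (w, v) ∈ affConverse R ↔ (v, w) ∈ R := Iff.rfl

theorem mem_affGraph (f : V →ₗ[k] W) (v : V) (w : W) : (v, w) ∈ affGraph f ↔ w = f v := Iff.rfl

theorem isCoisotropic_submodule {B : BilinForm k V} {S : Submodule k V} (h : B.orthogonal S ≤ S) :
    IsCoisotropic B S.toAffineSubspace := by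
  intro _
  rwa [Submodule.toAffineSubspace_direction]

theorem orthogonal_comp [FiniteDimensional k W] {BV : BilinForm k V} {BW : BilinForm k W}
    {BU : BilinForm k U} (hW : BW.Nondegenerate) (alt : BW.IsAlt) (A : Submodule k (V × W))
    (B : Submodule k (W × U)) (v : V) (u : U)
    (h : ∀ a w c, (a, w) ∈ A → (w, c) ∈ B → -BV a v + BU c u = 0) :
    ∃ w, (v, w) ∈ (sumForm (-BV) BW).orthogonal A ∧ (w, u) ∈ (sumForm (-BW) BU).orthogonal B := by
  let δ : (A × B) →ₗ[k] W :=
    (LinearMap.snd k V W ∘ₗ A.subtype) ∘ₗ LinearMap.fst k A B -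
      (LinearMap.fst k W U ∘ₗ B.subtype) ∘ₗ LinearMap.snd k A B
  let φ : Module.Dual k (A × B) :=
    -(BV.flip v ∘ₗ LinearMap.fst k V W ∘ₗ A.subtype ∘ₗ LinearMap.fst k A B) +
      BU.flip u ∘ₗ LinearMap.snd k W U ∘ₗ B.subtype ∘ₗ LinearMap.snd k A B
  have hφ : φ ∈ (LinearMap.ker δ).dualAnnihilator := by
    rw [Submodule.mem_dualAnnihilator]
    rintro ⟨⟨⟨a, w⟩, ha⟩, ⟨⟨w', c⟩, hc⟩⟩ hx
    have hx : w - w' = 0 := hx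
    obtain rfl := sub_eq_zero.1 hx
    exact h a w c ha hc
  rw [← LinearMap.range_dualMap_eq_dualAnnihilator_ker] at hφ
  obtain ⟨ψ, hψ⟩ := hφ
  set w₀ := (BW.toDual hW).symm ψ with hw₀
  have key : ∀ x : A × B, φ x = BW w₀ (δ x) := by
    intro x
    rw [← hψ, hw₀, LinearMap.BilinForm.apply_toDual_symm_apply]
    rfl
  refine ⟨w₀, ?_, ?_⟩
  · rintro ⟨a, w⟩ ha
    have := key (⟨(a, w), ha⟩, 0)
    simp [φ, δ] at this
    change -BV a v + BW w w₀ = 0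
    linear_combination this - alt.neg_eq w w₀
  · rintro ⟨w, c⟩ hc
    have := key (0, ⟨(w, c), hc⟩)
    simp [φ, δ] at this
    change -BW w w₀ + BU c u = 0
    linear_combination this + alt.neg_eq w w₀

theorem isCoisotropic_affComp [FiniteDimensional k W] {BV : BilinForm k V} {BW : BilinForm k W}
    {BU : BilinForm k U} (hW : BW.Nondegenerate) (alt : BW.IsAlt) {R : AffineSubspace k (V × W)}
    {S : AffineSubspace k (W × U)} (hR : IsCoisotropic (sumForm (-BV) BW) R)
    (hS : IsCoisotropic (sumForm (-BW) BU) S) :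
    IsCoisotropic (sumForm (-BV) BU) (affComp R S) := by
  rintro ⟨⟨v₀, u₀⟩, w₀, hR₀, hS₀⟩
  have hdir : ∀ a w c, (a, w) ∈ R.direction → (w, c) ∈ S.direction →
      (a, c) ∈ (affComp R S).direction := by
    intro a w c h₁ h₂
    rw [← AffineSubspace.vadd_mem_iff_mem_direction (a, c)
      (show (v₀, u₀) ∈ affComp R S from ⟨w₀, hR₀, hS₀⟩)]
    exact ⟨w + w₀, AffineSubspace.vadd_mem_of_mem_direction h₁ hR₀,
      AffineSubspace.vadd_mem_of_mem_direction h₂ hS₀⟩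
  rintro ⟨v, u⟩ hvu
  obtain ⟨w, h₁, h₂⟩ := orthogonal_comp hW alt R.direction S.direction v u
    (fun a w c ha hc => hvu (a, c) (hdir a w c ha hc))
  exact hdir v w u (hR ⟨_, hR₀⟩ h₁) (hS ⟨_, hS₀⟩ h₂)

theorem isCoisotropic_affTensor {BV : BilinForm k V} {BW : BilinForm k W} {BV' : BilinForm k V'}
    {BW' : BilinForm k W'} {R : AffineSubspace k (V × W)} {S : AffineSubspace k (V' × W')}
    (hR : IsCoisotropic (sumForm (-BV) BW) R) (hS : IsCoisotropic (sumForm (-BV') BW') S) :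
    IsCoisotropic (sumForm (-sumForm BV BV') (sumForm BW BW')) (affTensor R S) := by
  rintro ⟨⟨⟨v₀, v₀'⟩, ⟨w₀, w₀'⟩⟩, hR₀, hS₀⟩
  have hdir : ∀ a a' b b', (a, b) ∈ R.direction → (a', b') ∈ S.direction →
      ((a, a'), (b, b')) ∈ (affTensor R S).direction := by
    intro a a' b b' h₁ h₂
    rw [← AffineSubspace.vadd_mem_iff_mem_direction ((a, a'), (b, b'))
      (show ((v₀, v₀'), (w₀, w₀')) ∈ affTensor R S from ⟨hR₀, hS₀⟩)]
    exact ⟨AffineSubspace.vadd_mem_of_mem_direction h₁ hR₀,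
      AffineSubspace.vadd_mem_of_mem_direction h₂ hS₀⟩
  rintro ⟨⟨v, v'⟩, ⟨w, w'⟩⟩ h
  refine hdir v v' w w' (hR ⟨_, hR₀⟩ ?_) (hS ⟨_, hS₀⟩ ?_)
  · rintro ⟨a, b⟩ hab
    have : -(BV a v + BV' 0 v') + (BW b w + BW' 0 w') = 0 :=
      h ((a, 0), (b, 0)) (hdir a 0 b 0 hab S.direction.zero_mem)
    simpa [sumForm_apply] using this
  · rintro ⟨a, b⟩ hab
    have : -(BV 0 v + BV' a v') + (BW 0 w + BW' b w') = 0 :=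
      h ((0, a), (0, b)) (hdir 0 a 0 b R.direction.zero_mem hab)
    simpa [sumForm_apply] using this

theorem isCoisotropic_affConverse {BV : BilinForm k V} {BW : BilinForm k W}
    {R : AffineSubspace k (V × W)} (hR : IsCoisotropic (sumForm (-BV) BW) R) :
    IsCoisotropic (sumForm (-BW) BV) (affConverse R) := by
  rintro ⟨⟨w₀, v₀⟩, h₀⟩
  have hdir : ∀ a b, (a, b) ∈ R.direction ↔ (b, a) ∈ (affConverse R).direction := by
    intro a b
    rw [← AffineSubspace.vadd_mem_iff_mem_direction (a, b) h₀,
      ← AffineSubspace.vadd_mem_iff_mem_direction (b, a)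
      (show (w₀, v₀) ∈ affConverse R from h₀)]
    rfl
  rintro ⟨w, v⟩ h
  refine (hdir v w).1 (hR ⟨_, h₀⟩ ?_)
  rintro ⟨a, b⟩ hab
  have : -BW b w + BV a v = 0 := h (b, a) ((hdir a b).1 hab)
  change -BV a v + BW b w = 0
  linear_combination -this

theorem isCoisotropic_affGraph {BV : BilinForm k V} {BW : BilinForm k W} (hW : BW.Nondegenerate)
    (e : V ≃ₗ[k] W) (he : ∀ x y, BW (e x) (e y) = BV x y) :
    IsCoisotropic (sumForm (-BV) BW) (affGraph e.toLinearMap) := by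
  refine isCoisotropic_submodule ?_
  rintro ⟨v, w⟩ h
  have h' : ∀ x, BW (e x) (w - e v) = 0 := by
    intro x
    have : -BV x v + BW (e x) w = 0 := h (x, e x) rfl
    rw [map_sub, he]
    linear_combination this
  refine sub_eq_zero.1 (hW.2 _ fun y => ?_)
  simpa using h' (e.symm y)

theorem sumForm_nondegenerate {B : BilinForm k V} {C : BilinForm k W} (hB : B.Nondegenerate)
    (hC : C.Nondegenerate) : (sumForm B C).Nondegenerate := by
  refine ⟨?_, ?_⟩
  · rintro ⟨v, w⟩ h
    refine Prod.ext (hB.1 v fun y => ?_) (hC.1 w fun y => ?_)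
    · simpa [sumForm_apply] using h (y, 0)
    · simpa [sumForm_apply] using h (0, y)
  · rintro ⟨v, w⟩ h
    refine Prod.ext (hB.2 v fun y => ?_) (hC.2 w fun y => ?_)
    · simpa [sumForm_apply] using h (y, 0)
    · simpa [sumForm_apply] using h (0, y)

end Forms

/-- The objects of `ACR`: finite-dimensional symplectic vector spaces over `𝔽_p`. -/
structure ACR (p : ℕ) [Fact p.Prime] where
  carrier : Type
  [addCommGroup : AddCommGroup carrier]
  [module : Module (ZMod p) carrier]
  [finiteDimensional : FiniteDimensional (ZMod p) carrier]
  form : BilinForm (ZMod p) carrier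
  isAlt : form.IsAlt
  nondegenerate : form.Nondegenerate

namespace ACR

attribute [instance] addCommGroup module finiteDimensional

variable {p : ℕ} [Fact p.Prime]

/-- The morphisms `V ⟶ W` of `ACR`: affine coisotropic subspaces of `(V ⊕ W, -ω_V ⊕ ω_W)`. -/
def Rel (V W : ACR p) : Type :=
  {R : AffineSubspace (ZMod p) (V.carrier × W.carrier) // IsCoisotropic (sumForm (-V.form) W.form) R}

/-- The graph of a linear symplectomorphism. -/
def graph {V W : ACR p} (e : V.carrier ≃ₗ[ZMod p] W.carrier)
    (he : ∀ x y, W.form (e x) (e y) = V.form x y) : Rel V W :=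
  ⟨affGraph e.toLinearMap, isCoisotropic_affGraph W.nondegenerate e he⟩

theorem Rel.ext {V W : ACR p} {R S : Rel V W} (h : ∀ v w, (v, w) ∈ R.1 ↔ (v, w) ∈ S.1) : R = S :=
  Subtype.ext (SetLike.ext fun x => h x.1 x.2)

instance : Category (ACR p) where
  Hom V W := Rel V W
  id V := graph (LinearEquiv.refl _ _) fun _ _ => rfl
  comp {V W U} R S := ⟨affComp R.1 S.1, isCoisotropic_affComp W.nondegenerate W.isAlt R.2 S.2⟩
  id_comp R := Rel.ext fun v w => by
    simp only [mem_affComp, graph, mem_affGraph]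
    simp
  comp_id R := Rel.ext fun v w => by
    simp only [mem_affComp, graph, mem_affGraph]
    simp
  assoc R S T := Rel.ext fun v w => by
    simp only [mem_affComp]
    exact ⟨fun ⟨a, ⟨b, h₁, h₂⟩, h₃⟩ => ⟨b, h₁, a, h₂, h₃⟩,
      fun ⟨b, h₁, a, h₂, h₃⟩ => ⟨a, ⟨b, h₁, h₂⟩, h₃⟩⟩

theorem hom_ext {V W : ACR p} {R S : V ⟶ W} (h : ∀ v w, (v, w) ∈ R.1 ↔ (v, w) ∈ S.1) : R = S :=
  Rel.ext h

theorem mem_comp {V W U : ACR p} (R : V ⟶ W) (S : W ⟶ U) (v : V.carrier) (u : U.carrier) :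
    (v, u) ∈ (R ≫ S).1 ↔ ∃ w, (v, w) ∈ R.1 ∧ (w, u) ∈ S.1 := Iff.rfl

/-- The isomorphism given by a linear symplectomorphism. -/
def graphIso {V W : ACR p} (e : V.carrier ≃ₗ[ZMod p] W.carrier)
    (he : ∀ x y, W.form (e x) (e y) = V.form x y) : V ≅ W where
  hom := graph e he
  inv := graph e.symm fun x y => by rw [← he, e.apply_symm_apply, e.apply_symm_apply]
  hom_inv_id := hom_ext fun v w => by
    change (∃ x, x = e v ∧ w = e.symm x) ↔ w = v
    simp
  inv_hom_id := hom_ext fun v w => by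
    change (∃ x, x = e.symm v ∧ w = e x) ↔ w = v
    simp

theorem mem_graphIso_hom {V W : ACR p} (e : V.carrier ≃ₗ[ZMod p] W.carrier)
    (he : ∀ x y, W.form (e x) (e y) = V.form x y) (v : V.carrier) (w : W.carrier) :
    (v, w) ∈ (graphIso e he).hom.1 ↔ w = e v := Iff.rfl

theorem mem_graphIso_inv {V W : ACR p} (e : V.carrier ≃ₗ[ZMod p] W.carrier)
    (he : ∀ x y, W.form (e x) (e y) = V.form x y) (v : V.carrier) (w : W.carrier) :
    (w, v) ∈ (graphIso e he).inv.1 ↔ v = e.symm w := Iff.rfl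

/-- The orthogonal direct sum `(V ⊕ W, ω_V ⊕ ω_W)`. -/
def sum (V W : ACR p) : ACR p where
  carrier := V.carrier × W.carrier
  form := sumForm V.form W.form
  isAlt x := by
    change V.form x.1 x.1 + W.form x.2 x.2 = 0
    rw [V.isAlt, W.isAlt, add_zero]
  nondegenerate := sumForm_nondegenerate V.nondegenerate W.nondegenerate

variable (p) in
/-- The zero symplectic vector space. -/
def zero : ACR p where
  carrier := PUnit
  form := 0
  isAlt _ := rfl
  nondegenerate := ⟨fun _ _ => rfl, fun _ _ => rfl⟩

/-- The dual `(V, -ω_V)`. -/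
def dual (V : ACR p) : ACR p where
  carrier := V.carrier
  form := -V.form
  isAlt x := by
    change -V.form x x = 0
    rw [V.isAlt, neg_zero]
  nondegenerate := by
    refine ⟨fun x h => V.nondegenerate.1 x fun y => ?_, fun x h => V.nondegenerate.2 x fun y => ?_⟩
    · exact neg_eq_zero.1 (h y)
    · exact neg_eq_zero.1 (h y)

/-- The direct sum of relations. -/
def tensor {V V' W W' : ACR p} (R : V ⟶ W) (S : V' ⟶ W') : sum V V' ⟶ sum W W' :=
  ⟨affTensor R.1 S.1, isCoisotropic_affTensor R.2 S.2⟩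

instance : MonoidalCategoryStruct (ACR p) where
  tensorObj := sum
  tensorUnit := zero p
  tensorHom R S := tensor R S
  whiskerLeft V _ _ R := tensor (𝟙 V) R
  whiskerRight R V := tensor R (𝟙 V)
  associator U V W := graphIso (V := sum (sum U V) W) (W := sum U (sum V W))
    (LinearEquiv.prodAssoc (ZMod p) U.carrier V.carrier W.carrier)
    fun _ _ => (add_assoc _ _ _).symm
  leftUnitor V := graphIso (V := sum (zero p) V) (W := V)
    (LinearEquiv.uniqueProd : (PUnit × V.carrier) ≃ₗ[ZMod p] V.carrier) fun _ _ => (zero_add _).symm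
  rightUnitor V := graphIso (V := sum V (zero p)) (W := V)
    (LinearEquiv.prodUnique : (V.carrier × PUnit) ≃ₗ[ZMod p] V.carrier) fun _ _ => (add_zero _).symm

theorem mem_tensorHom {V V' W W' : ACR p} (R : V ⟶ W) (S : V' ⟶ W') (v : V.carrier)
    (v' : V'.carrier) (w : W.carrier) (w' : W'.carrier) :
    (((v, v'), (w, w')) : (V ⊗ V').carrier × (W ⊗ W').carrier) ∈ (R ⊗ₘ S).1 ↔
      (v, w) ∈ R.1 ∧ (v', w') ∈ S.1 := Iff.rfl

/-- The relation `R` is the graph of the function `f`. -/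
def IsGraph {V W : ACR p} (R : V ⟶ W) (f : V.carrier → W.carrier) : Prop :=
  ∀ v w, (v, w) ∈ R.1 ↔ w = f v

theorem mem_id {V : ACR p} : IsGraph (𝟙 V) id := fun _ _ => Iff.rfl

theorem isGraph_assoc (U V W : ACR p) : IsGraph (α_ U V W).hom
    (fun x : (U.carrier × V.carrier) × W.carrier => (x.1.1, x.1.2, x.2)) := fun _ _ => Iff.rfl

theorem isGraph_assoc_inv (U V W : ACR p) : IsGraph (α_ U V W).inv
    (fun x : U.carrier × V.carrier × W.carrier => ((x.1, x.2.1), x.2.2)) := fun _ _ => Iff.rfl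

theorem isGraph_left (V : ACR p) :
    IsGraph (λ_ V).hom (fun x : PUnit × V.carrier => x.2) := fun _ _ => Iff.rfl

theorem isGraph_right (V : ACR p) :
    IsGraph (ρ_ V).hom (fun x : V.carrier × PUnit => x.1) := fun _ _ => Iff.rfl

theorem IsGraph.comp {V W U : ACR p} {R : V ⟶ W} {S : W ⟶ U} {f : V.carrier → W.carrier}
    {g : W.carrier → U.carrier} (h : IsGraph R f) (h' : IsGraph S g) :
    IsGraph (R ≫ S) fun v => g (f v) := fun v u =>
  ⟨fun ⟨w, hw, hu⟩ => ((h' _ _).1 hu).trans (congrArg g ((h _ _).1 hw)),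
    fun hu => ⟨f v, (h _ _).2 rfl, (h' _ _).2 hu⟩⟩

theorem IsGraph.tensor {V W V' W' : ACR p} {R : V ⟶ W} {S : V' ⟶ W'} {f : V.carrier → W.carrier}
    {g : V'.carrier → W'.carrier} (h : IsGraph R f) (h' : IsGraph S g) :
    IsGraph (R ⊗ₘ S) (fun v : V.carrier × V'.carrier => (f v.1, g v.2)) := fun v w =>
  (and_congr (h _ _) (h' _ _)).trans (Prod.ext_iff (x := w) (y := (f v.1, g v.2))).symm

theorem IsGraph.eq {V W : ACR p} {R S : V ⟶ W} {f : V.carrier → W.carrier} (h : IsGraph R f)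
    (h' : IsGraph S f) : R = S :=
  hom_ext fun v w => (h v w).trans (h' v w).symm

instance : MonoidalCategory (ACR p) := MonoidalCategory.ofTensorHom
  (id_tensorHom_id := fun V W => (mem_id.tensor mem_id).eq mem_id)
  (id_tensorHom := fun _ _ _ _ => rfl)
  (tensorHom_id := fun _ _ => rfl)
  (tensorHom_comp_tensorHom := fun f₁ f₂ g₁ g₂ => hom_ext fun ⟨v, w⟩ ⟨v', w'⟩ => by
    constructor
    · rintro ⟨⟨a, b⟩, ⟨h₁, h₂⟩, h₃, h₄⟩
      exact ⟨⟨a, h₁, h₃⟩, ⟨b, h₂, h₄⟩⟩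
    · rintro ⟨⟨a, h₁, h₃⟩, ⟨b, h₂, h₄⟩⟩
      exact ⟨⟨a, b⟩, ⟨h₁, h₂⟩, h₃, h₄⟩)
  (associator_naturality := fun f₁ f₂ f₃ => hom_ext fun ⟨⟨u, v⟩, w⟩ ⟨u', v', w'⟩ => by
    constructor
    · rintro ⟨⟨⟨a, b⟩, c⟩, ⟨⟨h₁, h₂⟩, h₃⟩, h₄⟩
      obtain ⟨rfl, rfl, rfl⟩ : u' = a ∧ v' = b ∧ w' = c := by
        simpa using (show (u', v', w') = (a, b, c) from h₄)
      exact ⟨(u, v, w), rfl, h₁, h₂, h₃⟩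
    · rintro ⟨⟨a, b, c⟩, h₄, h₁, h₂, h₃⟩
      obtain ⟨rfl, rfl, rfl⟩ : a = u ∧ b = v ∧ c = w := by
        simpa using (show (a, b, c) = (u, v, w) from h₄)
      exact ⟨((u', v'), w'), ⟨⟨h₁, h₂⟩, h₃⟩, rfl⟩)
  (leftUnitor_naturality := fun {V W} f => hom_ext fun ⟨u, v⟩ w => by
    constructor
    · rintro ⟨⟨a, b⟩, ⟨h₁, h₂⟩, h₃⟩
      obtain rfl : w = b := h₃
      exact ⟨v, rfl, h₂⟩
    · rintro ⟨b, h₁, h₂⟩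
      obtain rfl : b = v := h₁
      exact ⟨(u, w), ⟨rfl, h₂⟩, rfl⟩)
  (rightUnitor_naturality := fun {V W} f => hom_ext fun ⟨v, u⟩ w => by
    constructor
    · rintro ⟨⟨b, a⟩, ⟨h₂, h₁⟩, h₃⟩
      obtain rfl : w = b := h₃
      exact ⟨v, rfl, h₂⟩
    · rintro ⟨b, h₁, h₂⟩
      obtain rfl : b = v := h₁
      exact ⟨(w, u), ⟨h₂, rfl⟩, rfl⟩)
  (pentagon := fun _ _ _ _ => IsGraph.eq
    (((isGraph_assoc _ _ _).tensor mem_id).comp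
      ((isGraph_assoc _ _ _).comp (mem_id.tensor (isGraph_assoc _ _ _))))
    ((isGraph_assoc _ _ _).comp (isGraph_assoc _ _ _)))
  (triangle := fun _ _ => IsGraph.eq
    ((isGraph_assoc _ _ _).comp (mem_id.tensor (isGraph_left _)))
    ((isGraph_right _).tensor mem_id))

/-- The symmetry of the direct sum. -/
def braidIso (V W : ACR p) : V ⊗ W ≅ W ⊗ V :=
  graphIso (V := sum V W) (W := sum W V) (LinearEquiv.prodComm (ZMod p) V.carrier W.carrier)
    fun _ _ => add_comm _ _

theorem isGraph_braid (V W : ACR p) : IsGraph (braidIso V W).hom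
    (fun x : V.carrier × W.carrier => (x.2, x.1)) := fun _ _ => Iff.rfl

instance : SymmetricCategory (ACR p) where
  braiding := braidIso
  braiding_naturality_right X Y Z f := hom_ext fun ⟨x, y⟩ ⟨z, x'⟩ => by
    constructor
    · rintro ⟨⟨a, b⟩, ⟨h₁, h₂⟩, h₃⟩
      obtain rfl : a = x := h₁
      obtain ⟨rfl, rfl⟩ := Prod.mk.inj (show (z, x') = (b, a) from h₃)
      exact ⟨(y, x'), rfl, h₂, rfl⟩
    · rintro ⟨⟨a, b⟩, h₁, h₂, h₃⟩
      obtain ⟨rfl, rfl⟩ := Prod.mk.inj (show (a, b) = (y, x) from h₁)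
      obtain rfl : x' = b := h₃
      exact ⟨(x', z), ⟨rfl, h₂⟩, rfl⟩
  braiding_naturality_left f Z := hom_ext fun ⟨x, z⟩ ⟨z', y⟩ => by
    constructor
    · rintro ⟨⟨a, b⟩, ⟨h₁, h₂⟩, h₃⟩
      obtain rfl : b = z := h₂
      obtain ⟨rfl, rfl⟩ := Prod.mk.inj (show (z', y) = (b, a) from h₃)
      exact ⟨(z', x), rfl, rfl, h₁⟩
    · rintro ⟨⟨a, b⟩, h₁, h₂, h₃⟩
      obtain ⟨rfl, rfl⟩ := Prod.mk.inj (show (a, b) = (z, x) from h₁)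
      obtain rfl : z' = a := h₂
      exact ⟨(y, z'), ⟨h₃, rfl⟩, rfl⟩
  hexagon_forward _ _ _ := IsGraph.eq
    ((isGraph_assoc _ _ _).comp ((isGraph_braid _ _).comp (isGraph_assoc _ _ _)))
    (((isGraph_braid _ _).tensor mem_id).comp
      ((isGraph_assoc _ _ _).comp (mem_id.tensor (isGraph_braid _ _))))
  hexagon_reverse X Y Z := IsGraph.eq
    ((isGraph_assoc_inv _ _ _).comp ((isGraph_braid _ _).comp (isGraph_assoc_inv _ _ _)))
    ((mem_id.tensor (isGraph_braid _ _)).comp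
      ((isGraph_assoc_inv _ _ _).comp ((isGraph_braid _ _).tensor mem_id)))
  symmetry X Y := (graphIso (V := sum X Y) (W := sum Y X) _ fun _ _ => add_comm _ _).hom_inv_id

/-- The converse relation. -/
def converse {V W : ACR p} (R : V ⟶ W) : W ⟶ V :=
  ⟨affConverse R.1, isCoisotropic_affConverse R.2⟩

/-- The cup `{(•, (v, v))}`. -/
def cup (V : ACR p) : zero p ⟶ sum V (dual V) :=
  ⟨Submodule.toAffineSubspace
      { carrier := {x : PUnit × (V.carrier × V.carrier) | x.2.1 = x.2.2}
        add_mem' := fun {x y} hx hy => congrArg₂ (· + ·) hx hy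
        zero_mem' := rfl
        smul_mem' := fun c _ hx => congrArg (c • ·) hx },
    isCoisotropic_submodule (by
      rintro ⟨u, a, b⟩ h
      refine sub_eq_zero.1 (V.nondegenerate.2 _ fun y => ?_)
      have : -(0 : ZMod p) + (V.form y a + -V.form y b) = 0 := h (PUnit.unit, y, y) rfl
      rw [map_sub]
      linear_combination this)⟩

theorem mem_cup (V : ACR p) (u : PUnit) (a b : V.carrier) : (u, (a, b)) ∈ (cup V).1 ↔ a = b :=
  Iff.rfl

theorem mem_converse {V W : ACR p} (R : V ⟶ W) (v : V.carrier) (w : W.carrier) :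
    (w, v) ∈ (converse R).1 ↔ (v, w) ∈ R.1 := Iff.rfl

theorem converse_graphIso {V W : ACR p} (e : V.carrier ≃ₗ[ZMod p] W.carrier)
    (he : ∀ x y, W.form (e x) (e y) = V.form x y) :
    converse (graphIso e he).hom = (graphIso e he).inv :=
  hom_ext fun _ _ => eq_comm.trans (LinearEquiv.eq_symm_apply e).symm

/-- The cap `{((v, v), •)}`. -/
def cap (V : ACR p) : sum (dual V) V ⟶ zero p :=
  converse (cup V ≫ (braidIso V (dual V)).hom)

theorem mem_cap (V : ACR p) (u : PUnit) (a b : V.carrier) :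
    ((a, b), u) ∈ (cap V).1 ↔ a = b := by
  constructor
  · rintro ⟨⟨c, d⟩, h₁, h₂⟩
    obtain ⟨rfl, rfl⟩ := Prod.mk.inj (show (a, b) = (d, c) from h₂)
    exact ((mem_cup V u b a).1 h₁).symm
  · rintro rfl
    exact ⟨(a, a), rfl, rfl⟩

instance : RightRigidCategory (ACR p) where
  rightDual V :=
    { rightDual := dual V
      exact :=
        { coevaluation' := cup V
          evaluation' := cap V
          coevaluation_evaluation' := hom_ext fun ⟨v, u⟩ ⟨u', v'⟩ => by
            constructor
            · rintro ⟨⟨a, b, c⟩, ⟨h₁, h₂⟩, ⟨⟨d, e⟩, f⟩, h₃, h₄, h₅⟩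
              obtain rfl : a = v := h₁
              obtain rfl : b = c := h₂
              obtain ⟨h, rfl⟩ := Prod.mk.inj (show ((d, e), f) = ((a, b), b) from h₃)
              obtain ⟨rfl, rfl⟩ := Prod.mk.inj h
              obtain rfl : d = e := (mem_cap V u' d e).1 h₄
              obtain rfl : v' = d := h₅
              exact ⟨v', rfl, rfl⟩
            · rintro ⟨a, h₁, h₂⟩
              obtain rfl : a = v := h₁
              obtain rfl : v' = a := congrArg Prod.snd
                (show (u', v') = (PUnit.unit, a) from h₂)
              exact ⟨(v', v', v'), ⟨rfl, rfl⟩, ((v', v'), v'), rfl,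
                (mem_cap V u' v' v').2 rfl, rfl⟩
          evaluation_coevaluation' := hom_ext fun ⟨u, v⟩ ⟨v', u'⟩ => by
            constructor
            · rintro ⟨⟨⟨a, b⟩, c⟩, ⟨h₁, h₂⟩, ⟨d, e, f⟩, h₃, h₄, h₅⟩
              obtain rfl : c = v := h₂
              obtain rfl : a = b := h₁
              obtain ⟨rfl, h⟩ := Prod.mk.inj (show (d, e, f) = (a, a, c) from h₃)
              obtain ⟨rfl, rfl⟩ := Prod.mk.inj h
              obtain rfl : v' = e := h₄
              obtain rfl : v' = f := (mem_cap V u' v' f).1 h₅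
              exact ⟨v', rfl, rfl⟩
            · rintro ⟨a, h₁, h₂⟩
              obtain rfl : a = v := h₁
              obtain rfl : v' = a := congrArg Prod.fst
                (show (v', u') = (a, PUnit.unit) from h₂)
              exact ⟨((v', v'), v'), ⟨rfl, rfl⟩, (v', v', v'), rfl,
                rfl, (mem_cap V u' v' v').2 rfl⟩ } }

instance : DaggerCompactCategory (ACR p) where
  dag R := converse R
  dag_id V := hom_ext fun v w => ⟨fun h => Eq.symm h, fun h => Eq.symm h⟩
  dag_comp R S := hom_ext fun v w =>
    ⟨fun ⟨a, h₁, h₂⟩ => ⟨a, h₂, h₁⟩, fun ⟨a, h₁, h₂⟩ => ⟨a, h₂, h₁⟩⟩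
  dag_dag _ := rfl
  dag_tensorHom _ _ := rfl
  dag_associator_hom _ _ _ := converse_graphIso _ _
  dag_leftUnitor_hom _ := converse_graphIso _ _
  dag_rightUnitor_hom _ := converse_graphIso _ _
  dag_braiding_hom _ _ := converse_graphIso _ _
  dag_cap V := rfl

end ACR

/-! ### Phase space and the discrete Wigner transform -/

namespace Wigner

open Mx

variable {p : ℕ} [Fact p.Prime]

/-! For odd `p` the operators on `n` qupits have a second basis, the phase-point operators, indexed
by the symplectic space `Phase p n`. They are orthogonal of squared norm `p ^ n`
(`wignerF_mul_conjTranspose`), so rewriting superoperators in this basis is a conjugation: the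
Wigner transform `wig` is faithful and respects composition, tensor products and, up to a power of
`p`, adjoints.

The central claim is that a mixed stabiliser map becomes a power of `p` times the indicator function
of an affine coisotropic relation (`HasRel`). Expanding phase-point operators in Weyl operators
shows that a stabiliser state gives a translate of a Lagrangian subspace (`wig_ket`), that a
Clifford operator gives the graph of an affine symplectomorphism (`wig_clifford`), and that the
maximally mixed state, through which environments enter, gives the full relation (`hasRel_disc`).
The property survives composition because the intermediate points linking two given endpoints form
an empty set or a translate of one fixed subspace, so every nonzero entry acquires the same factor
(`HasRel.comp`). The relation is the support of the transform. It is therefore unique, insensitive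
to nonzero scalars and functorial. Transposition negates momenta, which reverses the symplectic
form; this matches the cups with the duals `(V, -ω)`.

Faithfulness on the projectivisation holds because two maps with the same relation differ by a power
of `p` (`HasRel.exists_smul`), and these powers are invertible scalars, obtained by doubling powers
of `√p` (`exists_scalar_iso`).

For fullness, bending inputs into outputs turns a nonempty relation into a translate of a
coisotropic subspace `C`. The quotient of `C` by its radical is symplectic, and the graph of its
identification with a conjugate environment space is a Lagrangian subspace projecting onto `C`
(`exists_lagrangian`). A stabiliser state for this subspace exists by averaging over the stabiliser
group (`exists_fixed`), and discarding the environment leaves `C` (`exists_realizable_state`). The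
empty relation factors through two incompatible positions of one wire. Essential surjectivity is the
existence of symplectic bases (`exists_symplectic_basis`). -/

/-- The phase space of `n` qupits: a point lists a position and a momentum for every wire. -/
abbrev Phase (p n : ℕ) : Type := Fin n → ZMod p × ZMod p

section Words

variable {m n : ℕ}

theorem fstW_add (v w : Phase p n) : fstW (v + w) = fstW v + fstW w := rfl
theorem sndW_add (v w : Phase p n) : sndW (v + w) = sndW v + sndW w := rfl
theorem fstW_neg (v : Phase p n) : fstW (-v) = -fstW v := rfl
theorem sndW_neg (v : Phase p n) : sndW (-v) = -sndW v := rfl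
theorem fstW_smul (c : ZMod p) (v : Phase p n) : fstW (c • v) = c • fstW v := rfl
theorem sndW_smul (c : ZMod p) (v : Phase p n) : sndW (c • v) = c • sndW v := rfl
@[simp] theorem fstW_zero : fstW (0 : Phase p n) = 0 := rfl
@[simp] theorem sndW_zero : sndW (0 : Phase p n) = 0 := rfl

end Words

/-- The standard symplectic form on phase space. -/
def omega (p n : ℕ) [Fact p.Prime] : BilinForm (ZMod p) (Phase p n) :=
  LinearMap.mk₂ (ZMod p) (fun v w => sndW v ⬝ᵥ fstW w - fstW v ⬝ᵥ sndW w)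
    (fun v v' w => by simp only [fstW_add, sndW_add, add_dotProduct]; ring)
    (fun c v w => by simp only [fstW_smul, sndW_smul, smul_dotProduct, smul_eq_mul]; ring)
    (fun v w w' => by simp only [fstW_add, sndW_add, dotProduct_add]; ring)
    (fun c v w => by simp only [fstW_smul, sndW_smul, dotProduct_smul, smul_eq_mul]; ring)

variable {m n : ℕ}

theorem omega_apply (v w : Phase p n) :
    omega p n v w = sndW v ⬝ᵥ fstW w - fstW v ⬝ᵥ sndW w := rfl

theorem omega_isAlt : (omega p n).IsAlt := fun v => by
  rw [omega_apply, dotProduct_comm, sub_self]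

theorem omega_swap (v w : Phase p n) : omega p n w v = -omega p n v w :=
  (omega_isAlt.neg_eq v w).symm

theorem omega_nondegenerate : (omega p n).Nondegenerate := by
  have h : ∀ v : Phase p n, (∀ w, omega p n v w = 0) → v = 0 := by
    intro v hv
    refine pairWord_ext.2 ⟨dotProduct_eq _ _ fun w => ?_, dotProduct_eq _ _ fun w => ?_⟩
    · simpa [omega_apply] using hv (pairW 0 w)
    · simpa [omega_apply] using hv (pairW w 0)
  refine ⟨h, fun v hv => h v fun w => ?_⟩
  rw [omega_swap, hv, neg_zero]

theorem omega_word (v w : Phase p (m + n)) :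
    omega p (m + n) v w = omega p m (lft v) (lft w) + omega p n (rgt v) (rgt w) := by
  simp only [omega_apply, dotProduct_word]
  change sndW (lft v) ⬝ᵥ fstW (lft w) + sndW (rgt v) ⬝ᵥ fstW (rgt w) -
    (fstW (lft v) ⬝ᵥ sndW (lft w) + fstW (rgt v) ⬝ᵥ sndW (rgt w)) = _
  ring

theorem omega_comp (σ : Fin n ≃ Fin m) (v w : Phase p m) :
    omega p n (v ∘ σ) (w ∘ σ) = omega p m v w := by
  have h (a b : Fin m → ZMod p) : (a ∘ σ) ⬝ᵥ (b ∘ σ) = a ⬝ᵥ b := by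
    simp only [dotProduct, Function.comp_apply]
    exact σ.sum_comp fun i => a i * b i
  exact congrArg₂ (· - ·) (h (sndW v) (fstW w)) (h (fstW v) (sndW w))

/-! #### Character sums -/

/-- Orthogonality of characters: a nontrivial character sums to zero over a finite group, and
injectivity of `ZMod.stdAddChar` makes its composite with `f` trivial only for `f = 0`. -/
theorem sum_stdAddChar_linear {M : Type*} [AddCommGroup M] [Module (ZMod p) M] [Fintype M]
    (f : M →ₗ[ZMod p] ZMod p) [Decidable (f = 0)] :
    ∑ x, ZMod.stdAddChar (f x) = if f = 0 then (Fintype.card M : ℂ) else 0 := by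
  classical
  have h := AddChar.sum_eq_ite
    ((ZMod.stdAddChar (N := p)).compAddMonoidHom f.toAddMonoidHom)
  have h0 : (ZMod.stdAddChar (N := p)).compAddMonoidHom f.toAddMonoidHom = 0 ↔ f = 0 := by
    constructor
    · intro h
      ext x
      refine ZMod.injective_stdAddChar ?_
      have := DFunLike.congr_fun h x
      simpa using this
    · rintro rfl
      ext x
      simp
  simp only [h0] at h
  exact h

theorem sum_stdAddChar_dotProduct (z : Fin n → ZMod p) :
    ∑ k, ZMod.stdAddChar (z ⬝ᵥ k) = if z = 0 then (p : ℂ) ^ n else 0 := by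
  classical
  have h := sum_stdAddChar_linear (p := p) (dotProductBilin (ZMod p) (ZMod p) z)
  have h0 : dotProductBilin (ZMod p) (ZMod p) z = 0 ↔ z = 0 := by
    constructor
    · intro h
      exact dotProduct_eq _ _ fun w => by simpa using LinearMap.congr_fun h w
    · rintro rfl
      simp
  simp only [h0] at h
  simpa using h

theorem p_ne_zero : (p : ℂ) ≠ 0 := by
  exact_mod_cast (Fact.out : p.Prime).ne_zero

/-! #### The Wigner transform -/

/-- The matrix entries of all phase-point operators. -/
noncomputable def wignerF (p n : ℕ) [Fact p.Prime] : Mx (ZMod p × ZMod p) n n :=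
  -- With `u = (q, m)`, the phase-point operator `A_u` reflects positions through `q` (the condition
  -- `j + k = 2q`) and adds a momentum phase. Indices are arranged so that applying this matrix to a
  -- vectorised operator `ρ` gives `tr (A_u ρ)` in row `u`.
  Matrix.of fun u x => if fstW x + sndW x = (2 : ZMod p) • fstW u then
    ZMod.stdAddChar (sndW u ⬝ᵥ (sndW x - fstW x)) else 0

theorem wignerF_apply (u x : Phase p n) : wignerF p n u x =
    if fstW x + sndW x = (2 : ZMod p) • fstW u then
      ZMod.stdAddChar (sndW u ⬝ᵥ (sndW x - fstW x)) else 0 := rfl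

theorem wignerF_pairW (u : Phase p n) (j k : Fin n → ZMod p) : wignerF p n u (pairW j k) =
    if j + k = (2 : ZMod p) • fstW u then ZMod.stdAddChar (sndW u ⬝ᵥ (k - j)) else 0 := rfl

theorem star_stdAddChar (a : ZMod p) :
    star (ZMod.stdAddChar a : ℂ) = ZMod.stdAddChar (-a) :=
  (AddChar.map_neg_eq_conj _ _).symm

theorem wignerF_comp (σ : Fin n ≃ Fin m) (u x : Phase p m) :
    wignerF p n (u ∘ σ) (x ∘ σ) = wignerF p m u x := by
  have h (a b : Fin m → ZMod p) : (a ∘ σ) ⬝ᵥ (b ∘ σ) = a ⬝ᵥ b := by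
    simp only [dotProduct, Function.comp_apply]
    exact σ.sum_comp fun i => a i * b i
  have h1 : fstW (x ∘ σ) + sndW (x ∘ σ) = (2 : ZMod p) • fstW (u ∘ σ) ↔
      fstW x + sndW x = (2 : ZMod p) • fstW u := by
    constructor
    · intro h
      funext i
      have := congrFun h (σ.symm i)
      simpa [fstW, sndW] using this
    · intro h
      funext i
      exact congrFun h (σ i)
  have h2 : sndW (u ∘ σ) ⬝ᵥ (sndW (x ∘ σ) - fstW (x ∘ σ)) = sndW u ⬝ᵥ (sndW x - fstW x) :=
    h (sndW u) (sndW x - fstW x)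
  simp only [wignerF_apply, h1, h2]

theorem wignerF_tens : tens (wignerF p m) (wignerF p n) = wignerF p (m + n) := by
  ext u x
  have h1 : fstW x + sndW x = (2 : ZMod p) • fstW u ↔
      fstW (lft x) + sndW (lft x) = (2 : ZMod p) • fstW (lft u) ∧
      fstW (rgt x) + sndW (rgt x) = (2 : ZMod p) • fstW (rgt u) :=
    ⟨fun h => ⟨congrArg lft h, congrArg rgt h⟩, fun h => word_ext h.1 h.2⟩
  have h2 : sndW u ⬝ᵥ (sndW x - fstW x) = sndW (lft u) ⬝ᵥ (sndW (lft x) - fstW (lft x)) +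
      sndW (rgt u) ⬝ᵥ (sndW (rgt x) - fstW (rgt x)) := dotProduct_word _ _
  simp only [tens_apply, wignerF_apply, h1, h2, ite_and, AddChar.map_add_eq_mul]
  split_ifs <;> simp

section Odd

variable [NeZero (2 : ZMod p)]

/-- The reflection condition determines `k` from `j` and forces equal positions since `2` is
invertible. What remains is a character sum over `j` with frequency `-2` times the difference of
momenta, which vanishes unless the momenta agree too. -/
theorem wignerF_mul_conjTranspose :
    wignerF p n * (wignerF p n).conjTranspose = (p : ℂ) ^ n • 1 := by
  have h2 : (2 : ZMod p) ≠ 0 := two_ne_zero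
  ext u w
  simp only [Matrix.mul_apply, Matrix.conjTranspose_apply, sum_pairW, wignerF_pairW]
  have key : ∀ j k : Fin n → ZMod p,
      ((if j + k = (2 : ZMod p) • fstW u then ZMod.stdAddChar (sndW u ⬝ᵥ (k - j)) else 0) *
        star (if j + k = (2 : ZMod p) • fstW w then ZMod.stdAddChar (sndW w ⬝ᵥ (k - j)) else 0) : ℂ)
      = if k = (2 : ZMod p) • fstW u - j then (if fstW u = fstW w then
          ZMod.stdAddChar ((sndW u - sndW w) ⬝ᵥ ((2 : ZMod p) • fstW u)) *
            ZMod.stdAddChar ((-(2 : ZMod p) • (sndW u - sndW w)) ⬝ᵥ j) else 0) else 0 := by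
    intro j k
    by_cases h : k = (2 : ZMod p) • fstW u - j
    · subst h
      have e1 : (2 : ZMod p) • fstW u = (2 : ZMod p) • fstW w ↔ fstW u = fstW w :=
        (smul_right_injective _ h2).eq_iff
      simp only [add_sub_cancel, if_true, e1]
      split_ifs with h3
      · rw [star_stdAddChar, ← AddChar.map_add_eq_mul, ← AddChar.map_add_eq_mul]
        congr 1
        simp only [dotProduct_sub, sub_dotProduct, smul_dotProduct, dotProduct_smul, smul_eq_mul,
          neg_smul, neg_dotProduct]
        ring
      · simp
    · rw [if_neg (fun h' => h (eq_sub_of_add_eq' h')), if_neg h, zero_mul]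
  simp only [key, Finset.sum_ite_eq', Finset.mem_univ, if_true]
  by_cases h : fstW u = fstW w
  · simp only [h, if_true, ← Finset.mul_sum, sum_stdAddChar_dotProduct]
    by_cases h' : sndW u = sndW w
    · have : u = w := pairWord_ext.2 ⟨h, h'⟩
      simp [this]
    · have h3 : u ≠ w := fun e => h' (by rw [e])
      simp [h3, h2, sub_ne_zero.2 h']
  · have h3 : u ≠ w := fun e => h (by rw [e])
    simp [h, h3]

/-- One-sided inverses of square matrices are two-sided; this is completeness of the phase-point
operators. -/
theorem conjTranspose_mul_wignerF :
    (wignerF p n).conjTranspose * wignerF p n = (p : ℂ) ^ n • 1 := by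
  have hp : (p : ℂ) ^ n ≠ 0 := pow_ne_zero _ p_ne_zero
  have h : (((p : ℂ) ^ n)⁻¹ • wignerF p n) * (wignerF p n).conjTranspose = 1 := by
    rw [Matrix.smul_mul, wignerF_mul_conjTranspose, smul_smul, inv_mul_cancel₀ hp, one_smul]
  have h := mul_eq_one_comm.1 h
  rw [Matrix.mul_smul] at h
  rw [← h, smul_smul, mul_inv_cancel₀ hp, one_smul]

end Odd

/-- The Wigner transform of a superoperator. -/
noncomputable def wig {a b : ℕ} (M : Mx (ZMod p × ZMod p) a b) : Mx (ZMod p × ZMod p) a b :=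
  -- For odd `p` the factor turns the conjugate transpose into the inverse of `wignerF p a`, so this
  -- is a change of basis and composition needs no further constants.
  ((p : ℂ) ^ a)⁻¹ • (wignerF p b * M * (wignerF p a).conjTranspose)

theorem wignerF_zero_wires (u x : Phase p 0) : wignerF p 0 u x = 1 := by
  rw [wignerF_apply, if_pos (Subsingleton.elim _ _), Matrix.dotProduct_of_isEmpty,
    AddChar.map_zero_eq_one]

theorem wig_state_apply (M : Mx (ZMod p × ZMod p) 0 n) (u : Phase p n) (z : Phase p 0) :
    wig M u z = ∑ x, wignerF p n u x * M x z := by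
  rw [wig, pow_zero, inv_one, one_smul, Matrix.mul_apply]
  simp only [Matrix.conjTranspose_apply, wignerF_zero_wires, star_one, mul_one]
  rw [Fintype.sum_subsingleton _ z, Matrix.mul_apply]

variable {a b c d : ℕ}

theorem wig_smul (s : ℂ) (M : Mx (ZMod p × ZMod p) a b) : wig (s • M) = s • wig M := by
  simp only [wig, Matrix.mul_smul, Matrix.smul_mul, smul_comm s]

theorem wig_tens (M : Mx (ZMod p × ZMod p) a b) (N : Mx (ZMod p × ZMod p) c d) :
    wig (tens M N) = tens (wig M) (wig N) := by
  rw [wig, ← wignerF_tens, ← wignerF_tens, conjTranspose_tens, tens_mul_tens, tens_mul_tens]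
  ext u x
  simp only [wig, Matrix.smul_apply, tens_apply, smul_eq_mul, pow_add, mul_inv]
  ring

/-- The normalisation of `wig` depends on the input dimension only, so exchanging input and output
costs a power of `p`. This is harmless where only the support and a uniform power of `p` matter. -/
theorem wig_conjTranspose (M : Mx (ZMod p × ZMod p) a b) :
    wig M.conjTranspose = ((p : ℂ) ^ a * ((p : ℂ) ^ b)⁻¹) • (wig M).conjTranspose := by
  have hp : (p : ℂ) ^ a ≠ 0 := pow_ne_zero _ p_ne_zero
  have hs : star (((p : ℂ) ^ a)⁻¹) = ((p : ℂ) ^ a)⁻¹ := by simp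
  rw [wig, wig, Matrix.conjTranspose_smul, hs, smul_smul, mul_right_comm, mul_inv_cancel₀ hp, one_mul,
    Matrix.conjTranspose_mul, Matrix.conjTranspose_mul, Matrix.conjTranspose_conjTranspose,
    Matrix.mul_assoc]

section Odd

variable [NeZero (2 : ZMod p)]

/-- The adjacent factors `wignerFᴴ * wignerF` in the middle equal `p ^ b`, which the normalisation
of the second transform cancels. -/
theorem wig_mul (M : Mx (ZMod p × ZMod p) a b) (N : Mx (ZMod p × ZMod p) b c) :
    wig (N * M) = wig N * wig M := by
  have hp : (p : ℂ) ^ b ≠ 0 := pow_ne_zero _ p_ne_zero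
  have h : wignerF p c * N * (wignerF p b).conjTranspose *
      (wignerF p b * M * (wignerF p a).conjTranspose) =
      (p : ℂ) ^ b • (wignerF p c * (N * M) * (wignerF p a).conjTranspose) := by
    rw [Matrix.mul_assoc, Matrix.mul_assoc (wignerF p b), ← Matrix.mul_assoc _ (wignerF p b),
      conjTranspose_mul_wignerF, Matrix.smul_mul, Matrix.one_mul, Matrix.mul_smul]
    simp only [Matrix.mul_assoc]
  rw [wig, wig, wig, Matrix.smul_mul, Matrix.mul_smul, h, smul_smul, smul_smul, mul_right_comm,
    inv_mul_cancel₀ hp, one_mul]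

theorem wig_relabel (σ : Fin b ≃ Fin a) :
    wig (relabel σ : Mx (ZMod p × ZMod p) a b) = relabel σ := by
  have hp : (p : ℂ) ^ a ≠ 0 := pow_ne_zero _ p_ne_zero
  have h : wignerF p b * (relabel σ : Mx (ZMod p × ZMod p) a b) =
      (relabel σ : Mx (ZMod p × ZMod p) a b) * wignerF p a :=
    (relabel_natural fun y x => (wignerF_comp σ y x).symm).symm
  rw [wig, h, Matrix.mul_assoc, wignerF_mul_conjTranspose, Matrix.mul_smul, Matrix.mul_one, smul_smul,
    inv_mul_cancel₀ hp, one_smul]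

theorem wig_injective {M N : Mx (ZMod p × ZMod p) a b} (h : wig M = wig N) : M = N := by
  have hp (k : ℕ) : (p : ℂ) ^ k ≠ 0 := pow_ne_zero _ p_ne_zero
  have key (M : Mx (ZMod p × ZMod p) a b) :
      (wignerF p b).conjTranspose * wig M * wignerF p a = (p : ℂ) ^ b • M := by
    rw [wig, Matrix.mul_smul, Matrix.smul_mul, Matrix.mul_assoc, Matrix.mul_assoc,
      conjTranspose_mul_wignerF, Matrix.mul_smul, Matrix.mul_one, Matrix.mul_smul, smul_smul,
      inv_mul_cancel₀ (hp a), one_smul, ← Matrix.mul_assoc, conjTranspose_mul_wignerF,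
      Matrix.smul_mul, Matrix.one_mul]
  have h' := key M
  rw [h, key N] at h'
  exact (smul_right_injective _ (hp b) h').symm

end Odd

end Wigner

namespace Wigner

open Mx

variable {p : ℕ} [Fact p.Prime] {n : ℕ}

/-! ### Weyl operators -/

/-- The Pauli operators with symmetrised phases. -/
noncomputable def weyl (y : ZMod p) (v : Phase p n) : Mx (ZMod p) n n :=
  -- Half of the phase `z ⬝ x` is absorbed so that, for odd `p`, the product phase becomes half the
  -- symplectic form and the adjoint of the operator at `v` with phase `0` is the one at `-v`.
  pauli (y + 2⁻¹ * (sndW v ⬝ᵥ fstW v)) (fstW v) (sndW v)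

theorem weyl_phase (y : ZMod p) : weyl y (0 : Phase p n) = pauli y 0 0 := by
  simp [weyl]

theorem weyl_zero : weyl (0 : ZMod p) (0 : Phase p n) = 1 := by
  rw [weyl_phase, pauli_zero]

theorem weyl_mem (y : ZMod p) (v : Phase p n) :
    weyl y v ∈ Matrix.unitaryGroup (Fin n → ZMod p) ℂ := pauli_mem _ _ _

theorem isPauli_iff {P : Mx (ZMod p) n n} : IsPauli P ↔ ∃ y v, P = weyl y v := by
  constructor
  · rintro ⟨y, x, z, rfl⟩
    exact ⟨y - 2⁻¹ * (z ⬝ᵥ x), pairW x z, by simp [weyl]⟩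
  · rintro ⟨y, v, rfl⟩
    exact ⟨_, _, _, rfl⟩

theorem weyl_apply (y : ZMod p) (v : Phase p n) (j k : Fin n → ZMod p) :
    weyl y v j k = if j = k + fstW v then
      ZMod.stdAddChar (y + 2⁻¹ * (sndW v ⬝ᵥ fstW v) + sndW v ⬝ᵥ k) else 0 := rfl

theorem weyl_eq_smul (y y' : ZMod p) (v : Phase p n) :
    weyl (y + y') v = (ZMod.stdAddChar y : ℂ) • weyl y' v := by
  ext j k
  simp only [weyl_apply, Matrix.smul_apply, smul_eq_mul, mul_ite, mul_zero,
    ← AddChar.map_add_eq_mul, add_assoc]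

theorem stdAddChar_ne_zero (y : ZMod p) : (ZMod.stdAddChar y : ℂ) ≠ 0 := by
  intro h
  have := AddChar.map_add_eq_mul (ZMod.stdAddChar (N := p)) y (-y)
  rw [h, zero_mul, add_neg_cancel, AddChar.map_zero_eq_one] at this
  exact one_ne_zero this

/-- The support of column `0` reveals the position shift; comparing the phases of all columns then
reveals the momentum and, from column `0`, the overall phase. -/
theorem weyl_injective {y y' : ZMod p} {v v' : Phase p n} (h : weyl y v = weyl y' v') :
    y = y' ∧ v = v' := by
  have hx : fstW v = fstW v' := by
    have := congrFun (congrFun h (fstW v)) 0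
    simp only [weyl_apply, zero_add, if_true] at this
    by_contra hne
    rw [if_neg hne] at this
    exact stdAddChar_ne_zero _ this
  have hk : ∀ k : Fin n → ZMod p, y + 2⁻¹ * (sndW v ⬝ᵥ fstW v) + sndW v ⬝ᵥ k =
      y' + 2⁻¹ * (sndW v' ⬝ᵥ fstW v') + sndW v' ⬝ᵥ k := by
    intro k
    have := congrFun (congrFun h (k + fstW v)) k
    simp only [weyl_apply, if_true] at this
    rw [if_pos (by rw [hx])] at this
    exact ZMod.injective_stdAddChar this
  have h0 := hk 0
  simp only [dotProduct_zero, add_zero] at h0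
  have hz : sndW v = sndW v' := dotProduct_eq _ _ fun k => by
    have := hk k
    rw [h0] at this
    exact add_left_cancel this
  have hv : v = v' := pairWord_ext.2 ⟨hx, hz⟩
  subst hv
  exact ⟨add_right_cancel h0, rfl⟩

/-- A nonzero shift has no diagonal entries, and without a shift the trace is a character sum over
positions. This is what shows that the stabiliser projector in `exists_fixed` does not vanish. -/
theorem trace_weyl (y : ZMod p) (v : Phase p n) :
    (weyl y v).trace = if v = 0 then (p : ℂ) ^ n * ZMod.stdAddChar y else 0 := by
  have hv : v = 0 ↔ fstW v = 0 ∧ sndW v = 0 := pairWord_ext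
  simp only [Matrix.trace, Matrix.diag_apply, weyl_apply, left_eq_add, hv]
  by_cases hx : fstW v = 0
  · simp only [hx, if_true, AddChar.map_add_eq_mul, ← Finset.mul_sum, sum_stdAddChar_dotProduct,
      dotProduct_zero, mul_zero, AddChar.map_zero_eq_one, mul_one, true_and]
    split_ifs <;> ring
  · simp [hx]

section Odd

variable [NeZero (2 : ZMod p)]

/-- The symmetrised phases replace the one-sided cocycle `z ⬝ x'` of `pauli_mul` by its
antisymmetrisation: this is the Heisenberg multiplication law. -/
theorem weyl_mul (y y' : ZMod p) (v v' : Phase p n) :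
    weyl y v * weyl y' v' = weyl (y + y' + 2⁻¹ * omega p n v v') (v + v') := by
  have h2 : (2 : ZMod p) ≠ 0 := two_ne_zero
  rw [weyl, weyl, pauli_mul, weyl]
  congr 1
  simp only [fstW_add, sndW_add, add_dotProduct, dotProduct_add, omega_apply,
    dotProduct_comm (fstW v)]
  field_simp
  ring

theorem weyl_conjTranspose (y : ZMod p) (v : Phase p n) :
    (weyl y v).conjTranspose = weyl (-y) (-v) := by
  have h2 : (2 : ZMod p) ≠ 0 := two_ne_zero
  rw [weyl, pauli_conjTranspose, weyl]
  congr 1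
  simp only [fstW_neg, sndW_neg, neg_dotProduct, dotProduct_neg]
  field_simp
  ring

/-- Exchanging the factors changes the sign of `2⁻¹ * omega p n v v'` in the phase, so commutation
means that this phase equals its negative. -/
theorem weyl_commute (y y' : ZMod p) (v v' : Phase p n) :
    weyl y v * weyl y' v' = weyl y' v' * weyl y v ↔ omega p n v v' = 0 := by
  have h2 : (2 : ZMod p) ≠ 0 := two_ne_zero
  rw [weyl_mul, weyl_mul, omega_swap v v', add_comm v' v, add_comm y' y]
  constructor
  · intro h
    have := (weyl_injective h).1
    have := add_left_cancel this
    field_simp at this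
    refine (mul_eq_zero.1 ?_).resolve_left h2
    linear_combination this
  · intro h
    rw [h, neg_zero]

/-- The phase-point operators are the symplectic Fourier transform of the Weyl operators. -/
theorem sum_weyl (u : Phase p n) (j k : Fin n → ZMod p) :
    ∑ v, ZMod.stdAddChar (omega p n u v) * weyl 0 v j k =
      (p : ℂ) ^ n * wignerF p n u (pairW k j) := by
  have h2 : (2 : ZMod p) ≠ 0 := two_ne_zero
  rw [sum_pairW]
  -- An entry `(j, k)` sees only the shift `x = j - k`; the remaining sum over momenta `z` forces
  -- the midpoint of `j` and `k` to be the position of `u`.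
  have key : ∀ x z : Fin n → ZMod p,
      ZMod.stdAddChar (omega p n u (pairW x z)) * weyl 0 (pairW x z) j k =
      if x = j - k then ZMod.stdAddChar (sndW u ⬝ᵥ (j - k)) *
        ZMod.stdAddChar (((2⁻¹ : ZMod p) • (j + k) - fstW u) ⬝ᵥ z) else 0 := by
    intro x z
    rw [weyl_apply]
    simp only [fstW_pairW, sndW_pairW]
    have hx : j = k + x ↔ x = j - k := by
      constructor
      · rintro rfl; simp
      · rintro rfl; simp
    simp only [hx]
    split_ifs with h
    · subst h
      rw [← AddChar.map_add_eq_mul, ← AddChar.map_add_eq_mul]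
      congr 1
      simp only [omega_apply, fstW_pairW, sndW_pairW, dotProduct_sub, sub_dotProduct,
        smul_dotProduct, add_dotProduct, dotProduct_comm z, smul_eq_mul]
      field_simp
      ring
    · rw [mul_zero]
  simp only [key]
  rw [Finset.sum_comm]
  simp only [Finset.sum_ite_eq', Finset.mem_univ, if_true, ← Finset.mul_sum,
    sum_stdAddChar_dotProduct]
  have h3 : (2⁻¹ : ZMod p) • (j + k) - fstW u = 0 ↔ k + j = (2 : ZMod p) • fstW u := by
    rw [sub_eq_zero, inv_smul_eq_iff₀ h2, add_comm j k]
  rw [wignerF_pairW]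
  simp only [h3]
  split_ifs <;> ring

end Odd

end Wigner

namespace Wigner

open Mx

variable {p : ℕ} [Fact p.Prime] {n : ℕ}

/-! ### Stabiliser groups and isotropic subspaces -/

/-- A functional on `L` extends to phase space and is then represented through the nondegenerate
form. This is how the phases of a stabiliser group become a single phase point. -/
theorem exists_omega_eq (L : Submodule (ZMod p) (Phase p n)) (g : L →ₗ[ZMod p] ZMod p) :
    ∃ b, ∀ v : L, omega p n b v = g v := by
  obtain ⟨g', hg'⟩ := LinearMap.exists_extend g
  refine ⟨((omega p n).toDual omega_nondegenerate).symm g', fun v => ?_⟩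
  rw [LinearMap.BilinForm.apply_toDual_symm_apply, ← hg']
  rfl

variable [NeZero (2 : ZMod p)]

/-- The stabiliser group with Weyl operators indexed by an isotropic subspace and phases given by
pairing with a phase point. -/
def stabGroup (L : Submodule (ZMod p) (Phase p n)) (hL : ∀ v ∈ L, ∀ w ∈ L, omega p n v w = 0)
    (b : Phase p n) : Subgroup (Matrix.unitaryGroup (Fin n → ZMod p) ℂ) where
  carrier := {s | ∃ v ∈ L, s.1 = weyl (omega p n b v) v}
  one_mem' := ⟨0, L.zero_mem, by rw [map_zero, weyl_zero]; rfl⟩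
  mul_mem' := by
    rintro s t ⟨v, hv, hs⟩ ⟨w, hw, ht⟩
    refine ⟨v + w, L.add_mem hv hw, ?_⟩
    rw [Submonoid.coe_mul, hs, ht, weyl_mul, hL v hv w hw, map_add, mul_zero, add_zero]
  inv_mem' := by
    rintro s ⟨v, hv, hs⟩
    refine ⟨-v, L.neg_mem hv, ?_⟩
    change star s.1 = _
    rw [hs, Matrix.star_eq_conjTranspose, weyl_conjTranspose, map_neg]

theorem isPhaseFree_stabGroup (L : Submodule (ZMod p) (Phase p n))
    (hL : ∀ v ∈ L, ∀ w ∈ L, omega p n v w = 0) (b : Phase p n) :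
    IsPhaseFree (stabGroup L hL b) where
  isPauli := by
    rintro s ⟨v, -, hs⟩
    exact isPauli_iff.2 ⟨_, v, hs⟩
  comm := by
    rintro s ⟨v, hv, hs⟩ t ⟨w, hw, ht⟩
    refine Subtype.ext ?_
    rw [Submonoid.coe_mul, Submonoid.coe_mul, hs, ht, weyl_commute]
    exact hL v hv w hw
  phase := by
    rintro s ⟨v, hv, hs⟩ y hy
    rw [hs, ← weyl_phase] at hy
    obtain ⟨h1, rfl⟩ := weyl_injective hy
    rw [← h1, map_zero]

theorem weyl_sub_mem {S : Subgroup (Matrix.unitaryGroup (Fin n → ZMod p) ℂ)}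
    {s t : Matrix.unitaryGroup (Fin n → ZMod p) ℂ} (hs : s ∈ S) (ht : t ∈ S) {y y' : ZMod p}
    {v w : Phase p n} (h : s.1 = weyl y v) (h' : t.1 = weyl y' w) :
    ∃ r ∈ S, r.1 = weyl (y - y' + 2⁻¹ * omega p n v (-w)) (v - w) := by
  refine ⟨s * t⁻¹, S.mul_mem hs (S.inv_mem ht), ?_⟩
  change s.1 * star t.1 = _
  rw [h, h', Matrix.star_eq_conjTranspose, weyl_conjTranspose, weyl_mul, sub_eq_add_neg, sub_eq_add_neg]

/-- The quotient of `s` by `t` is a pure phase in the group, hence trivial. -/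
theorem phase_unique {S : Subgroup (Matrix.unitaryGroup (Fin n → ZMod p) ℂ)}
    (hS : IsPhaseFree S) {s t : Matrix.unitaryGroup (Fin n → ZMod p) ℂ} (hs : s ∈ S) (ht : t ∈ S)
    {y y' : ZMod p} {v : Phase p n} (h : s.1 = weyl y v) (h' : t.1 = weyl y' v) : y = y' := by
  obtain ⟨r, hr, e⟩ := weyl_sub_mem hs ht h h'
  rw [map_neg, omega_isAlt v, neg_zero, mul_zero, add_zero, sub_self, weyl_phase] at e
  exact sub_eq_zero.1 (hS.phase r hr _ e)

/-- The phase points occurring in `S` form an additive subgroup, hence a subspace over the prime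
field. Commutativity makes it isotropic; absence of pure phases gives each of its vectors a unique
phase. On an isotropic subspace these phases are additive, hence linear, and are represented by
pairing with some `b`. -/
theorem exists_eq_stabGroup {S : Subgroup (Matrix.unitaryGroup (Fin n → ZMod p) ℂ)}
    (hS : IsPhaseFree S) : ∃ L hL b, S = stabGroup (n := n) L hL b := by
  have hiso : ∀ {s t y y' v w}, s ∈ S → t ∈ S → s.1 = weyl y v → t.1 = weyl (n := n) y' w →
      omega p n v w = 0 := by
    intro s t y y' v w hs ht h h'
    have := congrArg Subtype.val (hS.comm s hs t ht)
    rw [Submonoid.coe_mul, Submonoid.coe_mul, h, h', weyl_commute] at this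
    exact this
  let A : AddSubgroup (Phase p n) :=
    { carrier := {v | ∃ s ∈ S, ∃ y, s.1 = weyl y v}
      zero_mem' := ⟨1, S.one_mem, 0, weyl_zero.symm⟩
      add_mem' := by
        rintro v w ⟨s, hs, y, h⟩ ⟨t, ht, y', h'⟩
        refine ⟨s * t, S.mul_mem hs ht, y + y', ?_⟩
        rw [Submonoid.coe_mul, h, h', weyl_mul, hiso hs ht h h', mul_zero, add_zero]
      neg_mem' := by
        rintro v ⟨s, hs, y, h⟩
        refine ⟨s⁻¹, S.inv_mem hs, -y, ?_⟩
        change star s.1 = _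
        rw [h, Matrix.star_eq_conjTranspose, weyl_conjTranspose] }
  let L := AddSubgroup.toZModSubmodule p A
  have hmem : ∀ v, v ∈ L ↔ ∃ s ∈ S, ∃ y, s.1 = weyl y v := fun v => Iff.rfl
  have hL : ∀ v ∈ L, ∀ w ∈ L, omega p n v w = 0 := by
    rintro v ⟨s, hs, y, h⟩ w ⟨t, ht, y', h'⟩
    exact hiso hs ht h h'
  choose s hs a ha using fun v : L => (hmem v).1 v.2
  have hadd : ∀ v w : L, a (v + w) = a v + a w := by
    intro v w
    refine phase_unique hS (hs (v + w)) (S.mul_mem (hs v) (hs w)) (ha (v + w)) ?_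
    rw [Submonoid.coe_mul, ha, ha, weyl_mul, hL v v.2 w w.2, mul_zero, add_zero]
    rfl
  obtain ⟨b, hb⟩ := exists_omega_eq L (AddMonoidHom.toZModLinearMap p (AddMonoidHom.mk' a hadd))
  have hb : ∀ v : L, omega p n b v = a v := hb
  refine ⟨L, hL, b, Subgroup.ext fun t => ⟨fun ht => ?_, ?_⟩⟩
  · obtain ⟨y, v, h⟩ := isPauli_iff.1 (hS.isPauli t ht)
    have hv : v ∈ L := (hmem v).2 ⟨t, ht, y, h⟩
    refine ⟨v, hv, ?_⟩
    rw [hb ⟨v, hv⟩, h, phase_unique hS ht (hs ⟨v, hv⟩) h (ha ⟨v, hv⟩)]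
  · rintro ⟨v, hv, h⟩
    have : t = s ⟨v, hv⟩ := Subtype.ext (by rw [h, ha ⟨v, hv⟩, hb ⟨v, hv⟩])
    rw [this]
    exact hs _

/-- A vector orthogonal to `L` can be adjoined to `L` without losing isotropy, keeping the same `b`,
so maximality already puts it in `L`. Conversely, a larger phase-free group commutes with everything
from `L`, so its phase points lie in the orthogonal complement and hence in `L`, where the phases
are already determined. -/
theorem isStabiliserGroup_stabGroup_iff {L : Submodule (ZMod p) (Phase p n)}
    {hL : ∀ v ∈ L, ∀ w ∈ L, omega p n v w = 0} {b : Phase p n} :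
    IsStabiliserGroup (stabGroup L hL b) ↔ (omega p n).orthogonal L ≤ L := by
  constructor
  · intro h v hv
    have hv0 : ∀ w ∈ L, omega p n w v = 0 := fun w hw => hv w hw
    have hv0' : ∀ w ∈ L, omega p n v w = 0 := fun w hw => by rw [omega_swap, hv0 w hw, neg_zero]
    have hL' : ∀ x ∈ L ⊔ Submodule.span (ZMod p) {v}, ∀ y ∈ L ⊔ Submodule.span (ZMod p) {v},
        omega p n x y = 0 := by
      intro x hx y hy
      obtain ⟨w, hw, _, hc, rfl⟩ := Submodule.mem_sup.1 hx
      obtain ⟨c, rfl⟩ := Submodule.mem_span_singleton.1 hc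
      obtain ⟨w', hw', _, hc', rfl⟩ := Submodule.mem_sup.1 hy
      obtain ⟨c', rfl⟩ := Submodule.mem_span_singleton.1 hc'
      simp [hL w hw w' hw', hv0 w hw, hv0' w' hw', omega_isAlt v]
    have hle : stabGroup L hL b ≤ stabGroup _ hL' b := by
      rintro s ⟨w, hw, hs⟩
      exact ⟨w, Submodule.mem_sup_left hw, hs⟩
    obtain ⟨w, hw, e⟩ := h.2 (isPhaseFree_stabGroup _ hL' b) hle
      (show (⟨weyl (omega p n b v) v, weyl_mem _ _⟩ : Matrix.unitaryGroup _ ℂ) ∈ _ from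
        ⟨v, Submodule.mem_sup_right (Submodule.mem_span_singleton_self v), rfl⟩)
    rw [(weyl_injective e).2]
    exact hw
  · intro h
    refine ⟨isPhaseFree_stabGroup L hL b, fun T hT hle t ht => ?_⟩
    obtain ⟨y, v, e⟩ := isPauli_iff.1 (hT.isPauli t ht)
    have hmem : ∀ w ∈ L, (⟨weyl (omega p n b w) w, weyl_mem _ _⟩ : Matrix.unitaryGroup _ ℂ) ∈ T :=
      fun w hw => hle ⟨w, hw, rfl⟩
    have hv : v ∈ L := h fun w hw => by
      have := congrArg Subtype.val (hT.comm _ (hmem w hw) t ht)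
      rw [Submonoid.coe_mul, Submonoid.coe_mul, e, weyl_commute] at this
      exact this
    refine ⟨v, hv, ?_⟩
    rw [e, phase_unique hT ht (hmem v hv) e rfl]

/-- Every isotropic subspace with phases stabilises some unit vector. -/
theorem exists_fixed {L : Submodule (ZMod p) (Phase p n)}
    (hL : ∀ v ∈ L, ∀ w ∈ L, omega p n v w = 0) (b : Phase p n) :
    ∃ ψ : (Fin n → ZMod p) → ℂ, ∑ x, ‖ψ x‖ ^ 2 = 1 ∧
      ∀ v ∈ L, Matrix.mulVec (weyl (omega p n b v) v) ψ = ψ := by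
  classical
  -- `P` is the sum over the stabiliser group, an unnormalised projector. Left multiplication by a
  -- group element permutes the summands, so every column of `P` is fixed; only the identity
  -- contributes to the trace, so some column is nonzero and can be normalised.
  let P : Mx (ZMod p) n n := ∑ v : L, weyl (omega p n b v) (v : Phase p n)
  have hP : ∀ w ∈ L, weyl (omega p n b w) w * P = P := by
    intro w hw
    rw [Finset.mul_sum]
    refine Fintype.sum_equiv (Equiv.addLeft (⟨w, hw⟩ : L)) _ _ fun v => ?_
    rw [weyl_mul, hL w hw v v.2, mul_zero, add_zero, ← map_add]
    rfl
  have htr : P.trace = (p : ℂ) ^ n := by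
    rw [Matrix.trace_sum]
    simp only [trace_weyl, ZeroMemClass.coe_eq_zero]
    simp
  have hP0 : P ≠ 0 := by
    intro h
    rw [h, Matrix.trace_zero] at htr
    exact pow_ne_zero n p_ne_zero htr.symm
  obtain ⟨j, k, hjk⟩ : ∃ j k, P j k ≠ 0 := by
    by_contra! h
    exact hP0 (Matrix.ext h)
  let N : ℝ := ∑ x, ‖P x k‖ ^ 2
  have hN : 0 < N := Finset.sum_pos' (fun _ _ => by positivity)
    ⟨j, Finset.mem_univ _, by positivity⟩
  refine ⟨((√N)⁻¹ : ℂ) • fun x => P x k, ?_, fun v hv => ?_⟩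
  · simp only [Pi.smul_apply, smul_eq_mul, norm_mul, norm_inv, Complex.norm_real, mul_pow, inv_pow,
      Real.norm_eq_abs, sq_abs, Real.sq_sqrt hN.le, ← Finset.mul_sum]
    exact inv_mul_cancel₀ hN.ne'
  · rw [Matrix.mulVec_smul]
    congr 1
    funext x
    exact congrFun (congrFun (hP v hv) x) k

theorem isStab_of_lagrangian {L : Submodule (ZMod p) (Phase p n)}
    (hL : ∀ v ∈ L, ∀ w ∈ L, omega p n v w = 0) (hL' : (omega p n).orthogonal L ≤ L)
    (b : Phase p n) : ∃ ψ : (Fin n → ZMod p) → ℂ, IsStab (ket ψ) ∧ ∑ x, ‖ψ x‖ ^ 2 = 1 ∧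
      ∀ v ∈ L, Matrix.mulVec (weyl (omega p n b v) v) ψ = ψ := by
  obtain ⟨ψ, h1, h2⟩ := exists_fixed hL b
  refine ⟨ψ, .state ψ ⟨h1, stabGroup L hL b, isStabiliserGroup_stabGroup_iff.2 hL', ?_⟩, h1, h2⟩
  rintro s ⟨v, hv, hs⟩
  rw [hs]
  exact h2 v hv

/-! ### The Wigner function of a stabiliser state -/

/-- On `L` the vector is an eigenvector of the Weyl operator. Off `L`, the inclusion `hL'` yields a
stabiliser that fails to commute with the Weyl operator; inserting this stabiliser multiplies the
expectation by a nontrivial phase without changing it, so the expectation is zero. -/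
theorem expectation_weyl {L : Submodule (ZMod p) (Phase p n)}
    (hL' : (omega p n).orthogonal L ≤ L) {b : Phase p n}
    {ψ : (Fin n → ZMod p) → ℂ} (h1 : ∑ x, ‖ψ x‖ ^ 2 = 1)
    (h2 : ∀ v ∈ L, Matrix.mulVec (weyl (omega p n b v) v) ψ = ψ) (v : Phase p n)
    [Decidable (v ∈ L)] :
    star ψ ⬝ᵥ Matrix.mulVec (weyl 0 v) ψ = if v ∈ L then ZMod.stdAddChar (-omega p n b v) else 0 := by
  split_ifs with hv
  · have : star ψ ⬝ᵥ ψ = 1 := by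
      have h3 : ∀ x, star ψ x * ψ x = ((‖ψ x‖ ^ 2 : ℝ) : ℂ) := fun x => by
        rw [Pi.star_apply, mul_comm]
        push_cast
        exact Complex.mul_conj' _
      rw [dotProduct, Finset.sum_congr rfl fun x _ => h3 x, ← Complex.ofReal_sum, h1,
        Complex.ofReal_one]
    rw [← neg_add_cancel (omega p n b v), weyl_eq_smul, Matrix.smul_mulVec, h2 v hv, dotProduct_smul,
      this, smul_eq_mul, mul_one]
  · obtain ⟨w, hw, hwv⟩ : ∃ w ∈ L, omega p n w v ≠ 0 := by
      by_contra! h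
      exact hv (hL' h)
    set e := star ψ ⬝ᵥ Matrix.mulVec (weyl 0 v) ψ
    set W := weyl (omega p n b w) w with hW
    have hWW : W.conjTranspose * W = 1 := Matrix.mem_unitaryGroup_iff'.1 (weyl_mem _ _)
    have hcomm : weyl 0 v * W = (ZMod.stdAddChar (omega p n v w) : ℂ) • (W * weyl 0 v) := by
      have h2 : (2 : ZMod p) ≠ 0 := two_ne_zero
      rw [hW, weyl_mul, weyl_mul, ← weyl_eq_smul, omega_swap v w, add_comm v w]
      congr 1
      field_simp
      ring
    have key : e = ZMod.stdAddChar (omega p n v w) * e := by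
      calc e = star ψ ⬝ᵥ Matrix.mulVec (weyl 0 v * W) ψ := by
              rw [← Matrix.mulVec_mulVec, h2 w hw]
        _ = ZMod.stdAddChar (omega p n v w) * (star ψ ⬝ᵥ Matrix.mulVec W (Matrix.mulVec (weyl 0 v) ψ)) := by
              rw [hcomm, Matrix.smul_mulVec, dotProduct_smul, Matrix.mulVec_mulVec, smul_eq_mul]
        _ = ZMod.stdAddChar (omega p n v w) * e := by
              congr 1
              -- Each copy of `ψ` is replaced by `W ψ`: the left copy supplies the adjoint that
              -- cancels `W` by unitarity, and the right copy is folded back into `ψ`.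
              conv_lhs => rw [← h2 w hw, Matrix.star_mulVec, ← Matrix.dotProduct_mulVec,
                Matrix.mulVec_mulVec, ← hW, hWW, Matrix.one_mulVec, h2 w hw]
    have hne : (ZMod.stdAddChar (omega p n v w) : ℂ) ≠ 1 := by
      intro h
      rw [← AddChar.map_zero_eq_one (ZMod.stdAddChar (N := p))] at h
      rw [omega_swap, ZMod.injective_stdAddChar h, neg_zero] at hwv
      exact hwv rfl
    have : (1 - ZMod.stdAddChar (omega p n v w)) * e = 0 := by linear_combination key
    exact (mul_eq_zero.1 this).resolve_left (sub_ne_zero.2 hne.symm)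

/-- By `sum_weyl` the Wigner function is the symplectic Fourier transform of the Weyl expectations,
which are phases supported on `L`. The result is a character sum over `L` with frequency `u - b`,
nonzero exactly when `u - b` is orthogonal to `L`, that is, lies in `L`. The dimension of `L` is
left in the exponent because only a power of `p` is needed. -/
theorem wig_ket {L : Submodule (ZMod p) (Phase p n)}
    (hL : ∀ v ∈ L, ∀ w ∈ L, omega p n v w = 0) (hL' : (omega p n).orthogonal L ≤ L)
    {b : Phase p n} {ψ : (Fin n → ZMod p) → ℂ} (h1 : ∑ x, ‖ψ x‖ ^ 2 = 1)
    (h2 : ∀ v ∈ L, Matrix.mulVec (weyl (omega p n b v) v) ψ = ψ) (u : Phase p n) (z : Phase p 0)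
    [Decidable (u - b ∈ L)] :
    wig (dbl (ket ψ)) u z =
      if u - b ∈ L then (p : ℂ) ^ ((Module.finrank (ZMod p) L : ℤ) - n) else 0 := by
  classical
  have hp : (p : ℂ) ^ n ≠ 0 := pow_ne_zero _ p_ne_zero
  have key : (p : ℂ) ^ n * wig (dbl (ket ψ)) u z =
      if u - b ∈ L then (p : ℂ) ^ Module.finrank (ZMod p) L else 0 := by
    calc (p : ℂ) ^ n * wig (dbl (ket ψ)) u z
        = ∑ j, ∑ k, ((p : ℂ) ^ n * wignerF p n u (pairW j k)) * (ψ j * star (ψ k)) := by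
          rw [wig_state_apply, sum_pairW, Finset.mul_sum]
          refine Finset.sum_congr rfl fun j _ => ?_
          rw [Finset.mul_sum]
          refine Finset.sum_congr rfl fun k _ => ?_
          rw [mul_assoc]
          rfl
      _ = ∑ v, ZMod.stdAddChar (omega p n u v) * (star ψ ⬝ᵥ Matrix.mulVec (weyl 0 v) ψ) := by
          simp only [← sum_weyl, dotProduct, Matrix.mulVec, Finset.mul_sum, Finset.sum_mul,
            Pi.star_apply]
          rw [Finset.sum_comm]
          simp only [Finset.sum_comm (s := (Finset.univ : Finset (Fin n → ZMod p)))
            (t := (Finset.univ : Finset (Phase p n)))]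
          refine Finset.sum_congr rfl fun v _ => Finset.sum_congr rfl fun k _ =>
            Finset.sum_congr rfl fun j _ => by ring
      _ = ∑ v : L, ZMod.stdAddChar ((omega p n (u - b) ∘ₗ L.subtype) v) := by
          simp only [expectation_weyl hL' h1 h2, mul_ite, mul_zero, ← AddChar.map_add_eq_mul]
          rw [← Finset.sum_filter, Finset.sum_subtype (p := fun v => v ∈ L) _ (by simp)]
          refine Finset.sum_congr rfl fun v _ => ?_
          rw [LinearMap.comp_apply, map_sub, LinearMap.sub_apply, sub_eq_add_neg]
          rfl
      _ = _ := by
          have h0 : omega p n (u - b) ∘ₗ L.subtype = 0 ↔ u - b ∈ L := by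
            constructor
            · intro h
              refine hL' fun v hv => ?_
              change omega p n v (u - b) = 0
              rw [omega_swap, neg_eq_zero]
              exact LinearMap.congr_fun h ⟨v, hv⟩
            · intro h
              ext v
              exact hL _ h v v.2
          rw [sum_stdAddChar_linear]
          simp only [h0]
          rw [Module.card_eq_pow_finrank (K := ZMod p), ZMod.card]
          push_cast
          rfl
  rw [← mul_right_inj' hp, key]
  split_ifs
  · rw [zpow_sub₀ p_ne_zero, zpow_natCast, zpow_natCast, mul_div_cancel₀ _ hp]
  · rw [mul_zero]

end Wigner

namespace Wigner

open Mx

variable {p : ℕ} [Fact p.Prime] {n : ℕ}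

/-! ### Clifford operators act by affine symplectomorphisms -/

/-- The phase-point operators. -/
noncomputable def phasePoint (u : Phase p n) : Mx (ZMod p) n n :=
  Matrix.of fun j k => wignerF p n u (pairW k j)

/-- Phase-point operators are Hermitian: transposing an entry reverses the sign of its phase. -/
theorem star_wignerF_pairW (u : Phase p n) (j k : Fin n → ZMod p) :
    star (wignerF p n u (pairW j k)) = wignerF p n u (pairW k j) := by
  rw [wignerF_pairW, wignerF_pairW, add_comm k j]
  split_ifs
  · rw [star_stdAddChar, ← dotProduct_neg, neg_sub]
  · exact star_zero _

/-- Column `u` of the conjugate transpose is the vectorised phase-point operator, and `dbl U` acts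
on vectorised operators as conjugation by `U`. -/
theorem dbl_mul_conjTranspose_wignerF (U : Mx (ZMod p) n n) (y u : Phase p n) :
    (dbl U * (wignerF p n).conjTranspose) y u =
      (U * phasePoint u * U.conjTranspose) (fstW y) (sndW y) := by
  simp only [Matrix.mul_apply, Matrix.conjTranspose_apply, sum_pairW, star_wignerF_pairW,
    Finset.sum_mul]
  rw [Finset.sum_comm]
  refine Finset.sum_congr rfl fun k _ => Finset.sum_congr rfl fun j _ => ?_
  change U (fstW y) j * star (U (sndW y) k) * _ = U (fstW y) j * _ * star (U (sndW y) k)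
  rw [mul_right_comm]
  rfl

variable [NeZero (2 : ZMod p)]

theorem smul_phasePoint (u : Phase p n) : (p : ℂ) ^ n • phasePoint u =
    ∑ v, (ZMod.stdAddChar (omega p n u v) : ℂ) • weyl 0 v := by
  ext j k
  rw [Matrix.smul_apply, smul_eq_mul, Matrix.sum_apply]
  exact (sum_weyl u j k).symm

/-- Conjugation preserves products, so `weyl_mul` computed before and after it shows that `g` is
additive and relates the defect of additivity of the phases `a` to the change of the symplectic
form. The defect is symmetric and the form antisymmetric, so both vanish. Additive maps are linear
over the prime field, and preserving a nondegenerate form makes `g` injective. -/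
theorem exists_symplectic_of_isClifford {U : Mx (ZMod p) n n} (hU : IsClifford U) :
    ∃ (g : Phase p n ≃ₗ[ZMod p] Phase p n) (b : Phase p n),
      (∀ v w, omega p n (g v) (g w) = omega p n v w) ∧
      ∀ v, U * weyl 0 v * U.conjTranspose = weyl (omega p n b (g v)) (g v) := by
  have h2 : (2 : ZMod p) ≠ 0 := two_ne_zero
  have hUU : U.conjTranspose * U = 1 := Matrix.mem_unitaryGroup_iff'.1 hU.1
  choose a g hag using fun v : Phase p n => isPauli_iff.1 (hU.2 _ (isPauli_iff.2 ⟨0, v, rfl⟩))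
  have key : ∀ v w, g (v + w) = g v + g w ∧
      2⁻¹ * omega p n v w + a (v + w) = a v + a w + 2⁻¹ * omega p n (g v) (g w) := by
    intro v w
    have h : (U * weyl 0 v * U.conjTranspose) * (U * weyl 0 w * U.conjTranspose) =
        U * (weyl 0 v * weyl 0 w) * U.conjTranspose := by
      have : (U * weyl 0 v * U.conjTranspose) * (U * weyl 0 w * U.conjTranspose) =
        U * (weyl 0 v * (U.conjTranspose * U) * weyl 0 w) * U.conjTranspose := by
        simp only [Matrix.mul_assoc]
      rw [this, hUU, Matrix.mul_one]
    rw [hag, hag, weyl_mul, weyl_mul, add_zero, zero_add, ← add_zero (2⁻¹ * omega p n v w),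
      weyl_eq_smul (2⁻¹ * omega p n v w), Matrix.mul_smul, Matrix.smul_mul, hag,
      ← weyl_eq_smul] at h
    obtain ⟨h3, h4⟩ := weyl_injective h
    exact ⟨h4.symm, h3.symm⟩
  -- Subtracting the phase identity for `(w, v)` from that for `(v, w)` eliminates `a` and isolates
  -- the form.
  have hω : ∀ v w, omega p n (g v) (g w) = omega p n v w := by
    intro v w
    have h3 := (key v w).2
    have h4 := (key w v).2
    rw [omega_swap v w, omega_swap (g v) (g w), add_comm w v] at h4
    have h5 : (2⁻¹ * 2 : ZMod p) = 1 := inv_mul_cancel₀ h2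
    linear_combination (omega p n v w - omega p n (g v) (g w)) * h5 - h3 + h4
  have ha : ∀ v w, a (v + w) = a v + a w := by
    intro v w
    have h3 := (key v w).2
    rw [hω] at h3
    linear_combination h3
  let g' : Phase p n →ₗ[ZMod p] Phase p n :=
    AddMonoidHom.toZModLinearMap p (AddMonoidHom.mk' g fun v w => (key v w).1)
  have hg' : Function.Injective g' := by
    rw [injective_iff_map_eq_zero]
    intro v hv
    refine omega_nondegenerate.1 v fun w => ?_
    rw [← hω, show g v = 0 from hv, map_zero, LinearMap.zero_apply]
  let e := LinearEquiv.ofInjectiveEndo g' hg'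
  have he : ∀ v, e v = g v := fun v => rfl
  let a' : Phase p n →ₗ[ZMod p] ZMod p := AddMonoidHom.toZModLinearMap p (AddMonoidHom.mk' a ha)
  -- The phase functional is transported along the inverse of `e`, since `b` is to be paired with
  -- the image `g v` and not with `v`.
  refine ⟨e, ((omega p n).toDual omega_nondegenerate).symm (a' ∘ₗ e.symm.toLinearMap), hω,
    fun v => ?_⟩
  rw [LinearMap.BilinForm.apply_toDual_symm_apply, hag, LinearMap.comp_apply,
    LinearEquiv.coe_coe, LinearEquiv.symm_apply_apply]
  rfl

/-- In the Weyl expansion of a phase-point operator, conjugation reindexes the sum by `g` and adds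
the phase of pairing with `b`; the result is the phase-point operator at `g u + b`. Orthogonality
then turns the permutation of phase-point operators into a permutation matrix. -/
theorem wig_clifford {U : Mx (ZMod p) n n} (hU : IsClifford U) :
    ∃ (g : Phase p n ≃ₗ[ZMod p] Phase p n) (b : Phase p n),
      (∀ v w, omega p n (g v) (g w) = omega p n v w) ∧
      ∀ w u, wig (dbl U) w u = if w = g u + b then 1 else 0 := by
  have hp : (p : ℂ) ^ n ≠ 0 := pow_ne_zero _ p_ne_zero
  obtain ⟨g, b, hg, hgb⟩ := exists_symplectic_of_isClifford hU
  refine ⟨g, b, hg, fun w u => ?_⟩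
  have key : U * phasePoint u * U.conjTranspose = phasePoint (g u + b) := by
    refine smul_right_injective _ hp ?_
    change (p : ℂ) ^ n • _ = (p : ℂ) ^ n • _
    rw [← Matrix.smul_mul, ← Matrix.mul_smul, smul_phasePoint, smul_phasePoint, Finset.mul_sum,
      Finset.sum_mul]
    refine Fintype.sum_equiv g.toEquiv _ _ fun v => ?_
    rw [Matrix.mul_smul, Matrix.smul_mul, hgb, ← weyl_eq_smul]
    change _ = (ZMod.stdAddChar (omega p n (g u + b) (g v)) : ℂ) • weyl 0 (g v)
    rw [← weyl_eq_smul, map_add, LinearMap.add_apply, hg, add_zero]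
  rw [wig, Matrix.mul_assoc, Matrix.smul_apply, Matrix.mul_apply]
  simp only [dbl_mul_conjTranspose_wignerF, key]
  have h : ∀ y, phasePoint (g u + b) (fstW y) (sndW y) =
      (wignerF p n).conjTranspose y (g u + b) := fun y =>
    (star_wignerF_pairW (g u + b) (fstW y) (sndW y)).symm
  simp only [h]
  rw [← Matrix.mul_apply, wignerF_mul_conjTranspose, Matrix.smul_apply, smul_smul,
    inv_mul_cancel₀ hp, one_smul, Matrix.one_apply]

end Wigner

namespace Wigner

open Mx

variable {p : ℕ} [Fact p.Prime]

/-! ### Superoperators whose Wigner transform is supported uniformly on a relation -/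

/-- The standard symplectic space of `n` qupits. -/
abbrev std (p n : ℕ) [Fact p.Prime] : ACR p where
  carrier := Phase p n
  form := omega p n
  isAlt := omega_isAlt
  nondegenerate := omega_nondegenerate

/-- A translate of a coisotropic linear relation. -/
def affHom {V W : ACR p} (S : Submodule (ZMod p) (V.carrier × W.carrier))
    (hS : (sumForm (-V.form) W.form).orthogonal S ≤ S) (x : V.carrier × W.carrier) : V ⟶ W :=
  ⟨AffineSubspace.mk' x S, fun _ => by rwa [AffineSubspace.direction_mk']⟩

theorem mem_affHom {V W : ACR p} {S : Submodule (ZMod p) (V.carrier × W.carrier)}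
    {hS : (sumForm (-V.form) W.form).orthogonal S ≤ S} {x y : V.carrier × W.carrier} :
    y ∈ (affHom S hS x).1 ↔ y - x ∈ S := AffineSubspace.mem_mk'

variable {a b c d : ℕ}

/-- Two phase points are related by a relation of phase spaces. -/
def Related (R : std p a ⟶ std p b) (v : Phase p a) (w : Phase p b) : Prop :=
  ((v, w) : (std p a).carrier × (std p b).carrier) ∈ R.1

theorem related_ext {R S : std p a ⟶ std p b} (h : ∀ v w, Related R v w ↔ Related S v w) : R = S :=
  ACR.hom_ext h

/-- The linear component of a relation. -/
def direction (R : std p a ⟶ std p b) : Submodule (ZMod p) (Phase p a × Phase p b) :=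
  R.1.direction

theorem Related.add_iff {R : std p a ⟶ std p b} {v : Phase p a} {w : Phase p b} (h : Related R v w)
    (x : Phase p a) (y : Phase p b) : Related R (x + v) (y + w) ↔ (x, y) ∈ direction R :=
  AffineSubspace.vadd_mem_iff_mem_direction (s := R.1) (x, y) h

theorem Related.iff_sub {R : std p a ⟶ std p b} {v : Phase p a} {w : Phase p b} (h : Related R v w)
    (x : Phase p a) (y : Phase p b) : Related R x y ↔ (x - v, y - w) ∈ direction R := by
  rw [← h.add_iff, sub_add_cancel, sub_add_cancel]

/-- Permutation of wires, as a linear map of phase spaces. -/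
def relabelEquiv (σ : Fin b ≃ Fin a) : Phase p a ≃ₗ[ZMod p] Phase p b :=
  LinearEquiv.funCongrLeft (ZMod p) (ZMod p × ZMod p) σ

/-- Permutation of wires, as a symplectomorphism. -/
def relabelIso (σ : Fin b ≃ Fin a) : std p a ≅ std p b :=
  ACR.graphIso (V := std p a) (W := std p b) (relabelEquiv σ) fun v w => omega_comp σ v w

/-- Juxtaposition of words, as a linear equivalence. -/
def wordEquiv (p a b : ℕ) : (Phase p a × Phase p b) ≃ₗ[ZMod p] Phase p (a + b) where
  toFun x := Fin.append x.1 x.2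
  invFun x := (lft x, rgt x)
  left_inv x := by simp
  right_inv x := by simp
  map_add' x y := word_ext (by rw [lft_append]; funext i; simp [lft])
    (by rw [rgt_append]; funext i; simp [rgt])
  map_smul' r x := word_ext (by rw [lft_append]; funext i; simp [lft])
    (by rw [rgt_append]; funext i; simp [rgt])

/-- Phase spaces of composite systems are direct sums. -/
def wordIso (p a b : ℕ) [Fact p.Prime] : std p a ⊗ std p b ≅ std p (a + b) :=
  ACR.graphIso (V := ACR.sum (std p a) (std p b)) (W := std p (a + b)) (wordEquiv p a b) fun v w => by
    change omega p (a + b) (Fin.append v.1 v.2) (Fin.append w.1 w.2) =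
      omega p a v.1 w.1 + omega p b v.2 w.2
    simp only [omega_word, lft_append, rgt_append]

/-- The tensor product of relations between phase spaces. -/
def relTens (R : std p a ⟶ std p b) (S : std p c ⟶ std p d) : std p (a + c) ⟶ std p (b + d) :=
  (wordIso p a c).inv ≫ (R ⊗ₘ S) ≫ (wordIso p b d).hom

theorem related_relTens (R : std p a ⟶ std p b) (S : std p c ⟶ std p d) (v : Phase p (a + c))
    (w : Phase p (b + d)) : Related (relTens R S) v w ↔
      Related R (lft v) (lft w) ∧ Related S (rgt v) (rgt w) := by
  constructor
  · rintro ⟨⟨x, x'⟩, h1, ⟨y, y'⟩, ⟨h2, h3⟩, h4⟩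
    obtain ⟨rfl, rfl⟩ := Prod.mk.inj (show (x, x') = (lft v, rgt v) from h1)
    have h4 : w = Fin.append y y' := h4
    rw [show lft w = y by rw [h4, lft_append], show rgt w = y' by rw [h4, rgt_append]]
    exact ⟨h2, h3⟩
  · rintro ⟨h2, h3⟩
    exact ⟨(lft v, rgt v), rfl, (lft w, rgt w), ⟨h2, h3⟩, (append_lft_rgt w).symm⟩

/-- The Wigner transform of `M` is a power of `p` times the indicator function of `R`. -/
def HasRel (M : Mx (ZMod p × ZMod p) a b) (R : std p a ⟶ std p b) : Prop :=
  -- The exponent is not recorded, as relations see maps only up to scalars. The zero matrix is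
  -- included: it has the empty relation and any exponent.
  ∃ k : ℤ, ∀ (w : Phase p b) (v : Phase p a),
    (Related R v w → wig M w v = (p : ℂ) ^ k) ∧
    (¬Related R v w → wig M w v = 0)

namespace HasRel

variable {M : Mx (ZMod p × ZMod p) a b} {R : std p a ⟶ std p b}

theorem related_iff (h : HasRel M R) (v : Phase p a) (w : Phase p b) :
    Related R v w ↔ wig M w v ≠ 0 := by
  obtain ⟨k, hk⟩ := h
  constructor
  · intro h
    rw [(hk w v).1 h]
    exact zpow_ne_zero _ p_ne_zero
  · intro h
    by_contra h'
    exact h ((hk w v).2 h')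

/-- The relation is the support of the Wigner transform, which a nonzero scalar does not change. -/
theorem eq_of_smul (h : HasRel M R) {s : ℂ} (hs : s ≠ 0) {S : std p a ⟶ std p b}
    (h' : HasRel (s • M) S) : R = S :=
  related_ext fun v w => by
    rw [h.related_iff v w, h'.related_iff v w, wig_smul, Matrix.smul_apply, smul_ne_zero_iff]
    exact (and_iff_right hs).symm

theorem unique (h : HasRel M R) {S : std p a ⟶ std p b} (h' : HasRel M S) : R = S :=
  h.eq_of_smul one_ne_zero (by rwa [one_smul])

theorem conjTranspose (h : HasRel M R) : HasRel M.conjTranspose (ACR.converse R) := by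
  obtain ⟨k, hk⟩ := h
  -- The shift by `a - b` is the normalisation factor of `wig_conjTranspose`; powers of `p` are
  -- real, so conjugation leaves them alone.
  refine ⟨a - b + k, fun v w => ⟨fun h => ?_, fun h => ?_⟩⟩
  · rw [wig_conjTranspose, Matrix.smul_apply, Matrix.conjTranspose_apply, (hk w v).1 h,
      zpow_add₀ p_ne_zero, zpow_sub₀ p_ne_zero, zpow_natCast, zpow_natCast, smul_eq_mul, div_eq_mul_inv]
    simp
  · rw [wig_conjTranspose, Matrix.smul_apply, Matrix.conjTranspose_apply, (hk w v).2 h, star_zero,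
      smul_zero]

theorem tens (h : HasRel M R) {N : Mx (ZMod p × ZMod p) c d} {S : std p c ⟶ std p d}
    (h' : HasRel N S) : HasRel (Mx.tens M N) (relTens R S) := by
  obtain ⟨k, hk⟩ := h
  obtain ⟨l, hl⟩ := h'
  refine ⟨k + l, fun v w => ?_⟩
  rw [related_relTens, wig_tens, tens_apply]
  refine ⟨fun h => ?_, fun h => ?_⟩
  · rw [(hk _ _).1 h.1, (hl _ _).1 h.2, zpow_add₀ p_ne_zero]
  · by_cases h1 : Related R (lft w) (lft v)
    · rw [(hl _ _).2 fun h2 => h ⟨h1, h2⟩, mul_zero]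
    · rw [(hk _ _).2 h1, zero_mul]

section Odd

variable [NeZero (2 : ZMod p)]

/-- Matrices with the same relation are proportional. -/
theorem exists_smul (h : HasRel M R) {N : Mx (ZMod p × ZMod p) a b} (h' : HasRel N R) :
    ∃ k : ℤ, N = (p : ℂ) ^ k • M := by
  obtain ⟨k, hk⟩ := h
  obtain ⟨l, hl⟩ := h'
  refine ⟨l - k, wig_injective ?_⟩
  ext w v
  rw [wig_smul, Matrix.smul_apply, smul_eq_mul]
  by_cases h : Related R v w
  · rw [(hk w v).1 h, (hl w v).1 h, ← zpow_add₀ p_ne_zero, sub_add_cancel]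
  · rw [(hk w v).2 h, (hl w v).2 h, mul_zero]

/-- A matrix entry of the product counts the intermediate points linking `v` to `u`. If there is one
such point, all of them form its translate by `D`, a subspace independent of the endpoints; hence
all nonzero entries gain the same factor, the cardinality of `D`. -/
theorem comp (h : HasRel M R) {N : Mx (ZMod p × ZMod p) b c} {S : std p b ⟶ std p c}
    (h' : HasRel N S) : HasRel (N * M) (R ≫ S) := by
  classical
  obtain ⟨k, hk⟩ := h
  obtain ⟨l, hl⟩ := h'
  let D : Submodule (ZMod p) (Phase p b) :=
    (direction R).comap (LinearMap.inr (ZMod p) (Phase p a) (Phase p b)) ⊓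
      (direction S).comap (LinearMap.inl (ZMod p) (Phase p b) (Phase p c))
  refine ⟨k + l + Module.finrank (ZMod p) D, fun u v => ?_⟩
  rw [wig_mul, Matrix.mul_apply]
  have hterm : ∀ w : Phase p b, ¬ (Related R v w ∧
      Related S w u) → wig N u w * wig M w v = 0 := by
    intro w hw
    by_cases h1 : Related R v w
    · rw [(hl _ _).2 fun h2 => hw ⟨h1, h2⟩, zero_mul]
    · rw [(hk _ _).2 h1, mul_zero]
  constructor
  · rintro ⟨w₀, h1, h2⟩
    have h1 : Related R v w₀ := h1
    have h2 : Related S w₀ u := h2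
    change Phase p b at w₀
    have hD : ∀ w : Phase p b, wig N u w * wig M w v = if w - w₀ ∈ D then (p : ℂ) ^ (k + l) else 0 := by
      intro w
      have hmem : w - w₀ ∈ D ↔ (Related R v w ∧
          Related S w u) := by
        refine and_congr ?_ ?_
        · rw [h1.iff_sub, sub_self]
          rfl
        · rw [h2.iff_sub, sub_self]
          rfl
      split_ifs with h
      · obtain ⟨h3, h4⟩ := hmem.1 h
        rw [(hk _ _).1 h3, (hl _ _).1 h4, zpow_add₀ p_ne_zero, mul_comm]
      · exact hterm w fun h' => h (hmem.2 h')
    have hshift : ∑ w : Phase p b, (if w - w₀ ∈ D then (p : ℂ) ^ (k + l) else 0) =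
        ∑ w : Phase p b, if w ∈ D then (p : ℂ) ^ (k + l) else 0 :=
      Fintype.sum_equiv (Equiv.subRight w₀) _ _ fun w => rfl
    rw [Finset.sum_congr rfl fun w _ => hD w, hshift,
      ← Finset.sum_filter, Finset.sum_const, nsmul_eq_mul, ← Fintype.card_subtype,
      Module.card_eq_pow_finrank (K := ZMod p) (V := D), ZMod.card, zpow_add₀ p_ne_zero (k + l), mul_comm]
    push_cast
    rfl
  · intro h
    exact Finset.sum_eq_zero fun w _ => hterm w fun h' => h ⟨w, h'⟩

theorem relabel (σ : Fin b ≃ Fin a) :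
    HasRel (Mx.relabel σ : Mx (ZMod p × ZMod p) a b) (relabelIso σ).hom := by
  refine ⟨0, fun w v => ?_⟩
  rw [wig_relabel, relabel_apply, zpow_zero]
  exact ⟨fun h => if_pos h, fun h => if_neg h⟩

theorem one : HasRel (1 : Mx (ZMod p × ZMod p) a a) (𝟙 (std p a)) := by
  have h := relabel (p := p) (Equiv.refl (Fin a))
  rw [relabel_refl] at h
  exact h

end Odd

end HasRel

end Wigner

namespace Wigner

open Mx

variable {p : ℕ} [Fact p.Prime] {a b c d s : ℕ}

/-! ### Every mixed stabiliser map has a relation -/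

/-- The unnormalised maximally mixed state. -/
def disc (p s : ℕ) : Mx (ZMod p × ZMod p) 0 s :=
  Matrix.of fun x _ => if fstW x = sndW x then 1 else 0

theorem disc_pairW (j k : Fin s → ZMod p) (z : Fin 0 → ZMod p × ZMod p) :
    disc p s (pairW j k) z = if j = k then 1 else 0 := rfl

/-- The full relation. -/
def fullHom (V W : ACR p) : V ⟶ W := affHom ⊤ le_top 0

theorem related_fullHom (v : Phase p a) (w : Phase p b) :
    Related (fullHom (std p a) (std p b)) v w :=
  mem_affHom.2 Submodule.mem_top

/-- Summing over the environment index amounts to feeding the maximally mixed state into the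
environment wires. Mixed maps thus reduce to pure maps and the single extra generator `disc`. -/
theorem superop_eq (f : Mx (ZMod p) (a + s) b) :
    superop f = dbl f * tens (1 : Mx (ZMod p × ZMod p) a a) (disc p s) *
      (relabel (rightE a).symm : Mx (ZMod p × ZMod p) a (a + 0)) := by
  ext y x
  have h : lft (x ∘ (rightE a).symm) = x := rfl
  rw [mul_relabel, Matrix.mul_apply, sum_word]
  simp only [tens_apply, lft_append, rgt_append, h, Matrix.one_apply, ite_mul, one_mul, zero_mul,
    mul_ite, mul_zero, Finset.sum_ite_irrel, Finset.sum_const_zero, Finset.sum_ite_eq',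
    Finset.mem_univ, if_true]
  rw [sum_pairW]
  simp only [disc_pairW, mul_ite, mul_one, mul_zero, Finset.sum_ite_eq, Finset.mem_univ, if_true]
  refine Finset.sum_congr rfl fun i _ => ?_
  have h1 : fstW (Fin.append x (pairW i i)) = Fin.append (fstW x) i :=
    word_ext (by rw [lft_append]; funext k; simp [lft, fstW])
      (by rw [rgt_append]; funext k; simp [rgt, fstW, pairW])
  have h2 : sndW (Fin.append x (pairW i i)) = Fin.append (sndW x) i :=
    word_ext (by rw [lft_append]; funext k; simp [lft, sndW])
      (by rw [rgt_append]; funext k; simp [rgt, sndW, pairW])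
  simp only [dbl, Matrix.of_apply, h1, h2]

theorem dbl_tens (f : Mx (ZMod p) a b) (g : Mx (ZMod p) c d) :
    dbl (tens f g) = tens (dbl f) (dbl g) := by
  ext y x
  simp only [dbl, tens_apply, Matrix.of_apply, star_mul']
  exact mul_mul_mul_comm _ _ _ _

theorem dbl_scal (c : ℂ) : dbl (scal p c) = (c * star c) • (1 : Mx (ZMod p × ZMod p) 0 0) := by
  ext y x
  simp [dbl, scal, Subsingleton.elim y x]

theorem HasRel.smul {M : Mx (ZMod p × ZMod p) a b} {R : std p a ⟶ std p b} (h : HasRel M R)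
    (k : ℤ) : HasRel ((p : ℂ) ^ k • M) R := by
  obtain ⟨l, hl⟩ := h
  refine ⟨k + l, fun w v => ?_⟩
  rw [wig_smul, Matrix.smul_apply, smul_eq_mul, zpow_add₀ p_ne_zero]
  exact ⟨fun h => by rw [(hl w v).1 h], fun h => by rw [(hl w v).2 h, mul_zero]⟩

theorem sqrt_mul_star : ((√(p : ℝ) : ℝ) : ℂ) * star ((√(p : ℝ) : ℝ) : ℂ) = (p : ℂ) := by
  have : star ((√(p : ℝ) : ℝ) : ℂ) = ((√(p : ℝ) : ℝ) : ℂ) := Complex.conj_ofReal _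
  rw [this, ← Complex.ofReal_mul, Real.mul_self_sqrt (Nat.cast_nonneg p), Complex.ofReal_natCast]

section Odd

variable [NeZero (2 : ZMod p)]

/-- Every phase-point operator has trace one: on the diagonal the reflection condition reads `2j =
2q`, with the single solution `j = q`, where the phase is trivial. -/
theorem hasRel_disc : HasRel (disc p s) (fullHom (std p 0) (std p s)) := by
  have h2 : (2 : ZMod p) ≠ 0 := two_ne_zero
  refine ⟨0, fun w v => ⟨fun _ => ?_, fun h => absurd (related_fullHom v w) h⟩⟩
  rw [wig_state_apply, sum_pairW]
  have key : ∀ j k : Fin s → ZMod p, wignerF p s w (pairW j k) * disc p s (pairW j k) v =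
      if j = k then (if k = fstW w then 1 else 0) else 0 := by
    intro j k
    rw [disc_pairW, wignerF_pairW, mul_ite, mul_one, mul_zero]
    refine if_ctx_congr Iff.rfl (fun h => ?_) fun _ => rfl
    subst h
    have h3 : j + j = (2 : ZMod p) • fstW w ↔ j = fstW w := by
      rw [← two_smul (ZMod p) j, (smul_right_injective _ h2).eq_iff]
    simp only [h3, sub_self, dotProduct_zero, AddChar.map_zero_eq_one]
  simp only [key]
  simp

/-- The points related to the zero-wire phase space are kept explicit, with the translation `b`,
because fullness must later produce prescribed affine subspaces. -/
theorem hasRel_ket {L : Submodule (ZMod p) (Phase p a)}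
    (hL : ∀ v ∈ L, ∀ w ∈ L, omega p a v w = 0) (hL' : (omega p a).orthogonal L ≤ L)
    {b : Phase p a} {ψ : (Fin a → ZMod p) → ℂ} (h1 : ∑ x, ‖ψ x‖ ^ 2 = 1)
    (h2 : ∀ v ∈ L, Matrix.mulVec (weyl (omega p a b v) v) ψ = ψ) :
    ∃ R, HasRel (dbl (ket ψ)) R ∧ ∀ z u, Related R z u ↔ u - b ∈ L := by
  classical
  have hS : (sumForm (-(std p 0).form) (std p a).form).orthogonal
      (L.comap (LinearMap.snd (ZMod p) (Phase p 0) (Phase p a))) ≤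
      L.comap (LinearMap.snd (ZMod p) (Phase p 0) (Phase p a)) := by
    rintro ⟨z, u⟩ h
    refine hL' fun v hv => ?_
    have : -omega p 0 0 z + omega p a v u = 0 := h (0, v) hv
    rwa [map_zero, LinearMap.zero_apply, neg_zero, zero_add] at this
  refine ⟨affHom (V := std p 0) (W := std p a) _ hS (0, b),
    ⟨(Module.finrank (ZMod p) L : ℤ) - a, fun u z => ?_⟩, fun z u => mem_affHom⟩
  rw [wig_ket hL hL' h1 h2]
  exact ⟨fun h => if_pos (mem_affHom.1 h), fun h => if_neg fun h' => h (mem_affHom.2 h')⟩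

theorem exists_hasRel_state {ψ : (Fin a → ZMod p) → ℂ} (hψ : IsStabiliserState ψ) :
    ∃ R, HasRel (dbl (ket ψ)) R := by
  obtain ⟨h1, S, hS, h2⟩ := hψ
  obtain ⟨L, hL, b, rfl⟩ := exists_eq_stabGroup hS.1
  obtain ⟨R, hR, -⟩ := hasRel_ket hL (isStabiliserGroup_stabGroup_iff.1 hS) (b := b) h1
    fun v hv => h2 ⟨_, weyl_mem _ _⟩ ⟨v, hv, rfl⟩
  exact ⟨R, hR⟩

theorem exists_hasRel_clifford {U : Mx (ZMod p) a a} (hU : IsClifford U) :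
    ∃ R, HasRel (dbl U) R := by
  obtain ⟨g, b, hg, h⟩ := wig_clifford hU
  have hS : (sumForm (-(std p a).form) (std p a).form).orthogonal g.toLinearMap.graph ≤
      g.toLinearMap.graph := by
    have := isCoisotropic_affGraph (BV := omega p a) omega_nondegenerate g hg
      ⟨(0, 0), (mem_affGraph _ _ _).2 (map_zero _).symm⟩
    rwa [affGraph, Submodule.toAffineSubspace_direction] at this
  refine ⟨affHom (V := std p a) (W := std p a) _ hS (0, b), 0, fun w v => ?_⟩
  have hmem : Related (affHom (V := std p a) (W := std p a) _ hS (0, b)) v w ↔ w = g v + b := by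
    refine mem_affHom.trans ?_
    change w - b = g (v - 0) ↔ _
    rw [sub_zero, sub_eq_iff_eq_add]
  rw [hmem, h, zpow_zero]
  exact ⟨fun h => if_pos h, fun h => if_neg h⟩

/-- Induction over the generation of stabiliser maps: doubling is compatible with all the
operations, and it turns the scalars `√p` and `1 / √p` into `p` and its inverse, which change only
the exponent. -/
theorem exists_hasRel_dbl {f : Mx (ZMod p) a b} (hf : IsStab f) : ∃ R, HasRel (dbl f) R := by
  induction hf with
  | state ψ hψ => exact exists_hasRel_state hψ
  | clifford U hU => exact exists_hasRel_clifford hU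
  | sqrt =>
    refine ⟨𝟙 _, ?_⟩
    rw [dbl_scal, sqrt_mul_star, ← zpow_one (p : ℂ)]
    exact HasRel.one.smul 1
  | invSqrt =>
    refine ⟨𝟙 _, ?_⟩
    rw [dbl_scal, star_div₀, star_one, div_mul_div_comm, one_mul, sqrt_mul_star, one_div,
      ← zpow_neg_one]
    exact HasRel.one.smul (-1)
  | comp f g _ _ ihf ihg =>
    obtain ⟨R, hR⟩ := ihf
    obtain ⟨S, hS⟩ := ihg
    exact ⟨R ≫ S, by rw [CPMStab.dbl_mul]; exact hR.comp hS⟩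
  | tens f g _ _ ihf ihg =>
    obtain ⟨R, hR⟩ := ihf
    obtain ⟨S, hS⟩ := ihg
    exact ⟨relTens R S, by rw [dbl_tens]; exact hR.tens hS⟩
  | dag f _ ih =>
    obtain ⟨R, hR⟩ := ih
    exact ⟨ACR.converse R, by rw [dbl_conjTranspose]; exact hR.conjTranspose⟩

theorem exists_hasRel {X Y : CPMStab p} (f : X ⟶ Y) : ∃ R, HasRel (CPMStab.toMx f) R := by
  refine Quotient.inductionOn f fun r => ?_
  obtain ⟨R, hR⟩ := exists_hasRel_dbl r.map.2
  have h : CPMStab.toMx (Quotient.mk _ r : X ⟶ Y) = superop r.map.1 := rfl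
  rw [h, superop_eq]
  exact ⟨_, (HasRel.relabel _).comp ((HasRel.one.tens hasRel_disc).comp hR)⟩

end Odd

end Wigner

namespace Wigner

open Mx

variable {p : ℕ} [Fact p.Prime] {a b c d n : ℕ}

/-! ### Scalars -/

theorem wordZero_ext {K : Type} (x y : Fin 0 → K) : x = y := Subsingleton.elim x y

theorem toMx_scale {X Y : CPMStab p} (s : 𝟙_ (CPMStab p) ⟶ 𝟙_ (CPMStab p)) (f : X ⟶ Y) :
    CPMStab.toMx (scale s f) = CPMStab.toMx s default default • CPMStab.toMx f := by
  rw [scale, CPMStab.toMx_comp, CPMStab.toMx_comp, CPMStab.toMx_tensorHom,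
    CPMStab.toMx_leftUnitor_hom, CPMStab.toMx_leftUnitor_inv]
  ext y x
  have h1 : rgt (y ∘ (leftE Y.base.wires).symm) = y := by
    rw [rgt_eq_leftE]; funext i; simp
  have h2 : rgt (x ∘ (leftE X.base.wires).symm) = x := by
    rw [rgt_eq_leftE]; funext i; simp
  refine (mul_relabel _ _ _ _).trans ((relabel_mul _ _ _ _).trans ?_)
  refine (tens_apply _ _ _ _).trans ?_
  rw [h1, h2]
  exact congrArg (· * CPMStab.toMx f y x)
    (congrArg₂ (CPMStab.toMx s) (wordZero_ext _ _) (wordZero_ext _ _))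

theorem toMx_scalar_ne_zero (s : 𝟙_ (CPMStab p) ≅ 𝟙_ (CPMStab p)) :
    CPMStab.toMx s.hom default default ≠ 0 := by
  intro h
  have h1 := congrArg CPMStab.toMx s.hom_inv_id
  rw [CPMStab.toMx_comp, CPMStab.toMx_id] at h1
  have h2 : CPMStab.toMx s.hom = 0 := by
    ext y x
    exact (congrArg₂ (CPMStab.toMx s.hom) (wordZero_ext _ _) (wordZero_ext _ _)).trans h
  rw [h2, Matrix.mul_zero] at h1
  exact zero_ne_one (congrFun (congrFun h1 default) default)

theorem isStab_scal_pow_inv (k : ℕ) : IsStab (scal p ((1 / √(p : ℝ) : ℂ) ^ k)) := by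
  induction k with
  | zero =>
    have : scal p ((1 / √(p : ℝ) : ℂ) ^ 0) = 1 := by
      ext i j
      simp [scal, Matrix.one_apply, Subsingleton.elim i j]
    rw [this]
    exact isStab_one
  | succ k ih =>
    have : scal p ((1 / √(p : ℝ) : ℂ) ^ (k + 1)) =
        scal p ((1 / √(p : ℝ) : ℂ) ^ k) * scal p (1 / √(p : ℝ)) := by
      ext i j
      simp [scal, Matrix.mul_apply, pow_succ]
    rw [this]
    exact .comp _ _ .invSqrt ih

theorem exists_scalar (k : ℤ) : ∃ s : 𝟙_ (CPMStab p) ⟶ 𝟙_ (CPMStab p),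
    CPMStab.toMx s = (p : ℂ) ^ k • (1 : Mx (ZMod p × ZMod p) 0 0) := by
  obtain ⟨k, rfl | rfl⟩ := k.eq_nat_or_neg
  · refine ⟨(CPMStab.pure p).map ⟨_, isStab_scal_pow k⟩, ?_⟩
    refine (CPMStab.toMx_pure _).trans ((dbl_scal _).trans ?_)
    rw [star_pow, ← mul_pow, sqrt_mul_star, zpow_natCast]
  · refine ⟨(CPMStab.pure p).map ⟨_, isStab_scal_pow_inv k⟩, ?_⟩
    refine (CPMStab.toMx_pure _).trans ((dbl_scal _).trans ?_)
    rw [star_pow, ← mul_pow, star_div₀, star_one, div_mul_div_comm, one_mul, sqrt_mul_star, zpow_neg,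
      zpow_natCast, one_div, inv_pow]

/-- Doubling powers of `√p` and its inverse yields all integer powers of `p`. These are exactly the
factors that a relation leaves undetermined, so dividing by invertible scalars is enough for
faithfulness. -/
theorem exists_scalar_iso (k : ℤ) : ∃ s : 𝟙_ (CPMStab p) ≅ 𝟙_ (CPMStab p),
    CPMStab.toMx s.hom default default = (p : ℂ) ^ k := by
  obtain ⟨s, hs⟩ := exists_scalar (p := p) k
  obtain ⟨t, ht⟩ := exists_scalar (p := p) (-k)
  refine ⟨⟨s, t, CPMStab.toMx_injective ?_, CPMStab.toMx_injective ?_⟩, ?_⟩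
  · rw [CPMStab.toMx_comp, hs, ht, CPMStab.toMx_id]
    refine (Matrix.smul_mul _ _ _).trans ?_
    rw [Matrix.one_mul, smul_smul, ← zpow_add₀ p_ne_zero, neg_add_cancel, zpow_zero, one_smul]
  · rw [CPMStab.toMx_comp, hs, ht, CPMStab.toMx_id]
    refine (Matrix.smul_mul _ _ _).trans ?_
    rw [Matrix.one_mul, smul_smul, ← zpow_add₀ p_ne_zero, add_neg_cancel, zpow_zero, one_smul]
  · rw [hs]
    simp

/-! ### The Wigner transform of the cup -/

/-- Negation of momenta. -/
def conjEquiv (p n : ℕ) : Phase p n ≃ₗ[ZMod p] Phase p n where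
  toFun v := pairW (fstW v) (-sndW v)
  invFun v := pairW (fstW v) (-sndW v)
  left_inv _ := pairWord_ext.2 ⟨rfl, neg_neg _⟩
  right_inv _ := pairWord_ext.2 ⟨rfl, neg_neg _⟩
  map_add' _ _ := pairWord_ext.2 ⟨rfl, neg_add _ _⟩
  map_smul' r v := pairWord_ext.2 ⟨rfl, (smul_neg r (sndW v)).symm⟩

theorem conjEquiv_conjEquiv (v : Phase p n) : conjEquiv p n (conjEquiv p n v) = v :=
  (conjEquiv p n).left_inv v

/-- Negating momenta is antisymplectic; this is what identifies a phase space with its dual in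
`ACR`. -/
theorem omega_conjEquiv (v w : Phase p n) :
    omega p n (conjEquiv p n v) (conjEquiv p n w) = -omega p n v w := by
  change (-sndW v) ⬝ᵥ fstW w - fstW v ⬝ᵥ (-sndW w) = -(sndW v ⬝ᵥ fstW w - fstW v ⬝ᵥ sndW w)
  rw [neg_dotProduct, dotProduct_neg]
  ring

/-- Complex conjugation of phase-point operators is the classical time reversal of phase space. -/
theorem star_wignerF (u x : Phase p n) :
    star (wignerF p n u x) = wignerF p n (conjEquiv p n u) x := by
  have h : wignerF p n (conjEquiv p n u) x = if fstW x + sndW x = (2 : ZMod p) • fstW u then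
      ZMod.stdAddChar ((-sndW u) ⬝ᵥ (sndW x - fstW x)) else 0 := rfl
  rw [h, wignerF_apply]
  split_ifs
  · rw [star_stdAddChar, neg_dotProduct]
  · exact star_zero _

theorem wignerF_append (u : Phase p (a + b)) (x : Phase p a) (y : Phase p b) :
    wignerF p (a + b) u (Fin.append x y) = wignerF p a (lft u) x * wignerF p b (rgt u) y := by
  rw [← wignerF_tens, tens_apply, lft_append, rgt_append]

/-! ### Comparison isomorphisms between wires and symplectic sums -/

/-- The dual symplectic space is isomorphic to the space itself. -/
def conjIso (p n : ℕ) [Fact p.Prime] : std p n ≅ ACR.dual (std p n) :=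
  ACR.graphIso (V := std p n) (W := ACR.dual (std p n)) (conjEquiv p n) fun v w => by
    change -omega p n (conjEquiv p n v) (conjEquiv p n w) = omega p n v w
    rw [omega_conjEquiv, neg_neg]

/-- The unit of `ACR` is the phase space of no wires. -/
def unitIso (p : ℕ) [Fact p.Prime] : 𝟙_ (ACR p) ≅ std p 0 :=
  ACR.graphIso (V := ACR.zero p) (W := std p 0)
    { toFun := fun _ => 0
      invFun := fun _ => PUnit.unit
      left_inv := fun _ => rfl
      right_inv := fun _ => Subsingleton.elim _ _
      map_add' := fun _ _ => (add_zero _).symm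
      map_smul' := fun _ _ => (smul_zero _).symm }
    fun _ _ => LinearMap.map_zero₂ _ _

theorem isGraph_eq_of {V W : ACR p} {R S : V ⟶ W} {f g : V.carrier → W.carrier}
    (h : ACR.IsGraph R f) (h' : ACR.IsGraph S g) (e : ∀ v, f v = g v) : R = S :=
  h.eq (funext e ▸ h')

theorem isGraph_wordIso : ACR.IsGraph (wordIso p a b).hom
    (fun x : Phase p a × Phase p b => Fin.append x.1 x.2) := fun _ _ => Iff.rfl

theorem isGraph_relabelIso (σ : Fin b ≃ Fin a) : ACR.IsGraph (relabelIso (p := p) σ).hom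
    (fun x : Phase p a => x ∘ σ) := fun _ _ => Iff.rfl

theorem isGraph_unitIso : ACR.IsGraph (unitIso p).hom (fun _ => (0 : Phase p 0)) :=
  fun _ _ => Iff.rfl

theorem append_append_assocE (x : Phase p a) (y : Phase p b) (z : Phase p c) :
    Fin.append (Fin.append x y) z ∘ assocE a b c = Fin.append x (Fin.append y z) :=
  word_ext (by rw [lft_assocE]; simp)
    (word_ext (by rw [lft_rgt_assocE]; simp) (by rw [rgt_rgt_assocE]; simp))

theorem append_zero_leftE (x : Phase p a) : Fin.append (0 : Phase p 0) x ∘ leftE a = x := by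
  rw [← rgt_eq_leftE, rgt_append]

theorem append_zero_rightE (x : Phase p a) : Fin.append x (0 : Phase p 0) ∘ rightE a = x := by
  rw [← lft_eq_rightE, lft_append]

theorem append_braidE (x : Phase p a) (y : Phase p b) :
    Fin.append x y ∘ braidE a b = Fin.append y x :=
  word_ext (by rw [lft_braidE]; simp) (by rw [rgt_braidE]; simp)

theorem word_comp_relTens (R : std p a ⟶ std p b) (S : std p c ⟶ std p d) :
    (wordIso p a c).hom ≫ relTens R S = (R ⊗ₘ S) ≫ (wordIso p b d).hom := by
  rw [relTens, Iso.hom_inv_id_assoc]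

theorem isUnitary_graphIso {V W : ACR p} (e : V.carrier ≃ₗ[ZMod p] W.carrier)
    (he : ∀ x y, W.form (e x) (e y) = V.form x y) : IsUnitary (ACR.graphIso e he).hom := by
  have h : DaggerCategory.dag (ACR.graphIso e he).hom = (ACR.graphIso e he).inv :=
    ACR.converse_graphIso e he
  rw [IsUnitary, h]
  exact ⟨Iso.hom_inv_id _, Iso.inv_hom_id _⟩

section Odd

variable [NeZero (2 : ZMod p)]

/-- The cup pairs the rows of `wignerF` without conjugating either, whereas orthogonality conjugates
one of them. The discrepancy negates momenta, so the cup becomes the graph of `conjEquiv` and not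
the diagonal. -/
theorem wig_cup (w : Phase p (n + n)) (z : Phase p 0) :
    wig (cup n : Mx (ZMod p × ZMod p) 0 (n + n)) w z =
      if lft w = conjEquiv p n (rgt w) then (p : ℂ) ^ n else 0 := by
  rw [wig_state_apply, sum_word]
  simp only [cup_apply, lft_append, rgt_append, wignerF_append, mul_ite, mul_one, mul_zero,
    Finset.sum_ite_eq, Finset.mem_univ, if_true]
  have h : ∀ x, wignerF p n (rgt w) x =
      (wignerF p n).conjTranspose x (conjEquiv p n (rgt w)) := fun x => by
    rw [Matrix.conjTranspose_apply, star_wignerF, conjEquiv_conjEquiv]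
  simp only [h]
  rw [← Matrix.mul_apply, wignerF_mul_conjTranspose, Matrix.smul_apply, Matrix.one_apply,
    smul_eq_mul, mul_ite, mul_one, mul_zero]

/-! ### The functor -/

/-- The relation of a mixed stabiliser map. -/
noncomputable def relOf {X Y : CPMStab p} (f : X ⟶ Y) :
    std p X.base.wires ⟶ std p Y.base.wires := (exists_hasRel f).choose

theorem hasRel_relOf {X Y : CPMStab p} (f : X ⟶ Y) : HasRel (CPMStab.toMx f) (relOf f) :=
  (exists_hasRel f).choose_spec

/-- Uniqueness removes the choice in `relOf`: each functoriality or coherence law follows by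
exhibiting one relation for the map concerned. -/
theorem relOf_eq {X Y : CPMStab p} {f : X ⟶ Y} {R : std p X.base.wires ⟶ std p Y.base.wires}
    (h : HasRel (CPMStab.toMx f) R) : relOf f = R :=
  (hasRel_relOf f).unique h

theorem relOf_scale {X Y : CPMStab p} (s : 𝟙_ (CPMStab p) ≅ 𝟙_ (CPMStab p)) (f : X ⟶ Y) :
    relOf f = relOf (scale s.hom f) :=
  (hasRel_relOf f).eq_of_smul (toMx_scalar_ne_zero s) (by
    rw [← toMx_scale]
    exact hasRel_relOf _)

theorem relOf_id (X : CPMStab p) : relOf (𝟙 X) = 𝟙 (std p X.base.wires) :=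
  relOf_eq (by rw [CPMStab.toMx_id]; exact HasRel.one)

theorem relOf_comp {X Y Z : CPMStab p} (f : X ⟶ Y) (g : Y ⟶ Z) :
    relOf (f ≫ g) = relOf f ≫ relOf g :=
  relOf_eq (by rw [CPMStab.toMx_comp]; exact (hasRel_relOf f).comp (hasRel_relOf g))

theorem relOf_dagger {X Y : CPMStab p} (f : X ⟶ Y) :
    relOf (CPMStab.dagger f) = ACR.converse (relOf f) :=
  relOf_eq (by rw [CPMStab.toMx_dagger]; exact (hasRel_relOf f).conjTranspose)

theorem relOf_tensorHom {X Y X' Y' : CPMStab p} (f : X ⟶ Y) (g : X' ⟶ Y') :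
    relOf (f ⊗ₘ g) = relTens (relOf f) (relOf g) :=
  relOf_eq (by
    rw [CPMStab.toMx_tensorHom]
    exact (hasRel_relOf f).tens (hasRel_relOf g))

theorem relOf_associator (X Y Z : CPMStab p) : relOf (α_ X Y Z).hom =
    (relabelIso (assocE X.base.wires Y.base.wires Z.base.wires)).hom :=
  relOf_eq (by rw [CPMStab.toMx_associator_hom]; exact HasRel.relabel _)

theorem relOf_leftUnitor (X : CPMStab p) : relOf (λ_ X).hom =
    (relabelIso (leftE X.base.wires)).hom :=
  relOf_eq (by rw [CPMStab.toMx_leftUnitor_hom]; exact HasRel.relabel _)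

theorem relOf_rightUnitor (X : CPMStab p) : relOf (ρ_ X).hom =
    (relabelIso (rightE X.base.wires)).hom :=
  relOf_eq (by rw [CPMStab.toMx_rightUnitor_hom]; exact HasRel.relabel _)

theorem relOf_braiding (X Y : CPMStab p) : relOf (CPMStab.braidIso X Y).hom =
    (relabelIso (braidE X.base.wires Y.base.wires)).hom :=
  relOf_eq (by rw [CPMStab.toMx_braiding]; exact HasRel.relabel _)

theorem related_relOf_cup (X : CPMStab p) (z : Phase p 0)
    (w : Phase p (X.base.wires + X.base.wires)) :
    Related (relOf (CPMStab.cupHom X)) z w ↔ lft w = conjEquiv p _ (rgt w) := by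
  have h := hasRel_relOf (CPMStab.cupHom X)
  rw [CPMStab.toMx_cup] at h
  refine (h.related_iff z w).trans ?_
  have e := wig_cup (p := p) w z
  constructor
  · intro hne
    by_contra h'
    exact hne (e.trans (if_neg h'))
  · intro h' h0
    exact pow_ne_zero _ p_ne_zero ((e.trans (if_pos h')).symm.trans h0)

variable (p) in
/-- The functor from mixed stabiliser maps up to scalars to affine coisotropic relations. -/
noncomputable def relFunctor : Proj (CPMStab p) ⥤ ACR p where
  obj X := std p X.obj.base.wires
  map := Quotient.lift (fun f => relOf f) (by
    rintro f _ ⟨s, rfl⟩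
    exact relOf_scale s f)
  map_id X := relOf_id X.obj
  map_comp := by
    rintro _ _ _ ⟨f⟩ ⟨g⟩
    exact relOf_comp f g

variable (p) in
/-- The monoidal structure of `relFunctor`. -/
noncomputable def relCoreMonoidal : (relFunctor p).CoreMonoidal where
  εIso := unitIso p
  μIso X Y := wordIso p X.obj.base.wires Y.obj.base.wires
  μIso_hom_natural_left := by
    rintro X Y ⟨f⟩ Z
    have h : relOf (f ▷ Z.obj) = relTens (relOf f) (𝟙 _) := by
      rw [← relOf_id, ← relOf_tensorHom, tensorHom_id]
    exact ((congrArg _ h).trans (word_comp_relTens _ _)).symm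
  μIso_hom_natural_right := by
    rintro X Y Z ⟨f⟩
    have h : relOf (Z.obj ◁ f) = relTens (𝟙 _) (relOf f) := by
      rw [← relOf_id, ← relOf_tensorHom, id_tensorHom]
    exact ((congrArg _ h).trans (word_comp_relTens _ _)).symm
  associativity X Y Z := by
    have h : (relFunctor p).map (α_ X Y Z).hom = _ := relOf_associator X.obj Y.obj Z.obj
    rw [h]
    -- Both sides are graphs of functions, so the coherence law becomes an identity between
    -- rearranged words.
    refine isGraph_eq_of ((isGraph_wordIso.tensor ACR.mem_id).comp
      (isGraph_wordIso.comp (isGraph_relabelIso _)))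
      ((ACR.isGraph_assoc _ _ _).comp ((ACR.mem_id.tensor isGraph_wordIso).comp isGraph_wordIso)) ?_
    rintro ⟨⟨x, y⟩, z⟩
    exact append_append_assocE x y z
  left_unitality X := by
    have h : (relFunctor p).map (λ_ X).hom = _ := relOf_leftUnitor X.obj
    rw [h]
    refine isGraph_eq_of (ACR.isGraph_left _) ((isGraph_unitIso.tensor ACR.mem_id).comp
      (isGraph_wordIso.comp (isGraph_relabelIso _))) ?_
    rintro ⟨x, y⟩
    exact (append_zero_leftE y).symm
  right_unitality X := by
    have h : (relFunctor p).map (ρ_ X).hom = _ := relOf_rightUnitor X.obj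
    rw [h]
    refine isGraph_eq_of (ACR.isGraph_right _) ((ACR.mem_id.tensor isGraph_unitIso).comp
      (isGraph_wordIso.comp (isGraph_relabelIso _))) ?_
    rintro ⟨x, y⟩
    exact (append_zero_rightE x).symm

variable (p) in
/-- The `†`-compact functor from mixed stabiliser maps up to scalars to affine coisotropic
relations. -/
noncomputable def relDagger : DaggerCompactFunctor (Proj (CPMStab p)) (ACR p) where
  functor := relFunctor p
  braided :=
    { toMonoidal := (relCoreMonoidal p).toMonoidal
      braided := fun X Y => by
        have h : (relFunctor p).map (β_ X Y).hom = _ := relOf_braiding X.obj Y.obj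
        rw [h]
        refine isGraph_eq_of (isGraph_wordIso.comp (isGraph_relabelIso _))
          ((ACR.isGraph_braid _ _).comp isGraph_wordIso) ?_
        rintro ⟨x, y⟩
        exact append_braidE x y }
  map_dag := by
    rintro _ _ ⟨f⟩
    exact relOf_dagger f
  unitary_unit := isUnitary_graphIso _ _
  unitary_tensor _ _ := isUnitary_graphIso _ _
  map_cup X := by
    -- By `wig_cup` the image of the cup relates a point to its momentum reversal, while the cup of
    -- `ACR` is diagonal. Reversing momenta on the second factor reconciles the two and is
    -- symplectic onto the dual.
    refine ⟨(conjIso p X.obj.base.wires).hom, isUnitary_graphIso _ _, ?_⟩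
    refine ACR.hom_ext ?_
    rintro u ⟨x, y⟩
    constructor
    · rintro ⟨z, -, w, h1, ⟨x', y'⟩, h2, h3, h4⟩
      have h1 := (related_relOf_cup X.obj z w).1 h1
      obtain ⟨rfl, rfl⟩ := Prod.mk.inj (show (x', y') = (lft w, rgt w) from h2)
      have h3 : x = lft w := h3
      have h4 : y = conjEquiv p _ (rgt w) := h4
      exact h3.trans (h1.trans h4.symm)
    · intro h
      obtain rfl : x = y := h
      let w : Phase p (X.obj.base.wires + X.obj.base.wires) := Fin.append x (conjEquiv p _ x)
      have hl : lft w = x := lft_append _ _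
      have hr : rgt w = conjEquiv p _ x := rgt_append _ _
      refine ⟨(0 : Phase p 0), rfl, w, (related_relOf_cup X.obj _ w).2 ?_, (lft w, rgt w), rfl, ?_, ?_⟩
      · exact hl.trans ((conjEquiv_conjEquiv x).symm.trans (congrArg _ hr.symm))
      · exact hl.symm
      · exact (conjEquiv_conjEquiv x).symm.trans (congrArg (conjEquiv p _) hr.symm)

end Odd

end Wigner

namespace Wigner

open Mx

variable {p : ℕ} [Fact p.Prime] {a b c d m n : ℕ}

theorem lft_sub (x y : Phase p (a + b)) : lft (x - y) = lft x - lft y := rfl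

theorem rgt_sub (x y : Phase p (a + b)) : rgt (x - y) = rgt x - rgt y := rfl

/-! ### Symplectic bases -/

theorem omega_succ (v w : Phase p (n + 1)) : omega p (n + 1) v w =
    (v 0).2 * (w 0).1 - (v 0).1 * (w 0).2 + omega p n (v ∘ Fin.succ) (w ∘ Fin.succ) := by
  simp only [omega_apply, dotProduct, Fin.sum_univ_succ]
  change (v 0).2 * (w 0).1 + ∑ i : Fin n, (v i.succ).2 * (w i.succ).1 -
    ((v 0).1 * (w 0).2 + ∑ i : Fin n, (v i.succ).1 * (w i.succ).2) =
    (v 0).2 * (w 0).1 - (v 0).1 * (w 0).2 + (∑ i : Fin n, (v i.succ).2 * (w i.succ).1 -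
    ∑ i : Fin n, (v i.succ).1 * (w i.succ).2)
  ring

/-- A subspace on which an alternating form is nondegenerate has a symplectic basis. -/
theorem exists_symplectic_basis {V : Type*} [AddCommGroup V] [Module (ZMod p) V]
    [FiniteDimensional (ZMod p) V] {B : BilinForm (ZMod p) V} (hB : B.IsAlt)
    (U : Submodule (ZMod p) V) (hU : ∀ x ∈ U, (∀ y ∈ U, B x y = 0) → x = 0) :
    ∃ (n : ℕ) (f : Phase p n →ₗ[ZMod p] V), LinearMap.range f = U ∧
      ∀ v w, B (f v) (f w) = omega p n v w := by
  induction hd : Module.finrank (ZMod p) U using Nat.strong_induction_on generalizing U with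
  | _ d ih =>
    subst hd
    by_cases h0 : U = ⊥
    · refine ⟨0, 0, by rw [h0, LinearMap.range_zero], fun v w => ?_⟩
      rw [wordZero_ext v 0, map_zero, map_zero, map_zero, LinearMap.zero_apply, LinearMap.zero_apply]
    obtain ⟨b, hb, hb0⟩ := Submodule.exists_mem_ne_zero_of_ne_bot h0
    obtain ⟨y, hy, hby⟩ : ∃ y ∈ U, B b y ≠ 0 := by
      by_contra! h
      exact hb0 (hU b hb h)
    -- The pair `(a, b)` spans a hyperbolic plane, with `a` in the role of position and `b` of
    -- momentum; the normalisation `B b a = 1` matches the sign convention of `omega`. The induction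
    -- on dimension continues in its orthogonal complement inside `U`.
    obtain ⟨a, ha, hba⟩ : ∃ a ∈ U, B b a = 1 :=
      ⟨(B b y)⁻¹ • y, U.smul_mem _ hy, by rw [map_smul, smul_eq_mul, inv_mul_cancel₀ hby]⟩
    have hab : B a b = -1 := by rw [← hB.neg_eq, hba]
    have haa : B a a = 0 := hB a
    have hbb : B b b = 0 := hB b
    let U' := U ⊓ (LinearMap.ker (B a) ⊓ LinearMap.ker (B b))
    have hmem : ∀ x, x ∈ U' ↔ x ∈ U ∧ B a x = 0 ∧ B b x = 0 := fun x => Iff.rfl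
    -- This is the orthogonal projection along the hyperbolic plane; it gives both the nondegeneracy
    -- of the form on `U'` and the spanning of `U`.
    have hproj : ∀ z ∈ U, z - B b z • a + B a z • b ∈ U' := by
      intro z hz
      refine (hmem _).2 ⟨U.add_mem (U.sub_mem hz (U.smul_mem _ ha)) (U.smul_mem _ hb), ?_, ?_⟩
      · simp [haa, hab]
      · simp [hba, hbb]
    have hlt : U' < U := by
      refine lt_of_le_of_ne inf_le_left fun h => ?_
      have := ((hmem b).1 (h ▸ hb)).2.1
      rw [hab] at this
      exact neg_ne_zero.2 one_ne_zero this
    obtain ⟨n, f, hf, hfB⟩ := ih _ (Submodule.finrank_lt_finrank_of_lt hlt) U' (by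
      intro x hx h
      obtain ⟨h1, h2, h3⟩ := (hmem x).1 hx
      refine hU x h1 fun z hz => ?_
      have := h _ (hproj z hz)
      have h4 : B x a = 0 := by rw [← hB.neg_eq, h2, neg_zero]
      have h5 : B x b = 0 := by rw [← hB.neg_eq, h3, neg_zero]
      simpa [h4, h5] using this) rfl
    have hfU : ∀ v, f v ∈ U' := fun v => hf ▸ LinearMap.mem_range_self f v
    have hfa : ∀ v, B a (f v) = 0 := fun v => ((hmem _).1 (hfU v)).2.1
    have hfb : ∀ v, B b (f v) = 0 := fun v => ((hmem _).1 (hfU v)).2.2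
    have haf : ∀ v, B (f v) a = 0 := fun v => by rw [← hB.neg_eq, hfa, neg_zero]
    have hbf : ∀ v, B (f v) b = 0 := fun v => by rw [← hB.neg_eq, hfb, neg_zero]
    let g : Phase p (n + 1) →ₗ[ZMod p] V :=
      ((LinearMap.fst (ZMod p) (ZMod p) (ZMod p)).smulRight a +
        (LinearMap.snd (ZMod p) (ZMod p) (ZMod p)).smulRight b) ∘ₗ LinearMap.proj 0 +
        f ∘ₗ LinearMap.funLeft (ZMod p) (ZMod p × ZMod p) Fin.succ
    have hg : ∀ v, g v = (v 0).1 • a + (v 0).2 • b + f (v ∘ Fin.succ) := fun v => rfl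
    refine ⟨n + 1, g, le_antisymm ?_ fun z hz => ?_, fun v w => ?_⟩
    · rintro _ ⟨v, rfl⟩
      rw [hg]
      exact U.add_mem (U.add_mem (U.smul_mem _ ha) (U.smul_mem _ hb)) (hfU _).1
    · obtain ⟨v, hv⟩ : z - B b z • a + B a z • b ∈ LinearMap.range f := hf ▸ hproj z hz
      -- The coordinates along `a` and `b` are recovered by pairing with the opposite basis vector,
      -- with a sign since `B a b = -1`.
      refine ⟨Fin.cons (B b z, -B a z) v, ?_⟩
      rw [hg]
      have h1 : (Fin.cons (B b z, -B a z) v : Phase p (n + 1)) ∘ Fin.succ = v := by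
        funext i; simp
      rw [h1, hv]
      simp only [Fin.cons_zero]
      module
    · rw [hg, hg, omega_succ, ← hfB]
      simp only [map_add, map_smul, LinearMap.add_apply, LinearMap.smul_apply, haa, hab, hba, hbb,
        hfa, hfb, haf, hbf, smul_eq_mul]
      ring

/-- Every symplectic vector space is isomorphic to a standard one. -/
theorem exists_iso_std (V : ACR p) : ∃ n, Nonempty (std p n ≅ V) := by
  obtain ⟨n, f, hf, hfB⟩ := exists_symplectic_basis V.isAlt ⊤
    fun x _ h => V.nondegenerate.1 x fun y => h y Submodule.mem_top
  have hinj : Function.Injective f := by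
    rw [injective_iff_map_eq_zero]
    intro v hv
    refine omega_nondegenerate.1 v fun w => ?_
    rw [← hfB, hv, map_zero, LinearMap.zero_apply]
  exact ⟨n, ⟨ACR.graphIso (V := std p n) (W := V)
    (LinearEquiv.ofBijective f ⟨hinj, LinearMap.range_eq_top.1 hf⟩) hfB⟩⟩

/-! ### Lagrangian purifications of coisotropic subspaces -/

/-- Every coisotropic subspace is the projection of a Lagrangian subspace of a larger system. -/
theorem exists_lagrangian (C : Submodule (ZMod p) (Phase p n))
    (hC : (omega p n).orthogonal C ≤ C) :
    ∃ (e : ℕ) (L : Submodule (ZMod p) (Phase p (n + e))),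
      (∀ v ∈ L, ∀ w ∈ L, omega p (n + e) v w = 0) ∧ (omega p (n + e)).orthogonal L ≤ L ∧
      ∀ u, u ∈ C ↔ ∃ s, Fin.append u s ∈ L := by
  -- Since `C` is coisotropic, `D` is contained in `C` and is the radical of the form restricted to
  -- `C`.
  set D := (omega p n).orthogonal C with hD
  have hDD : (omega p n).orthogonal D = C :=
    LinearMap.BilinForm.orthogonal_orthogonal omega_nondegenerate omega_isAlt.isRefl C
  have hCD : ∀ x ∈ C, ∀ y ∈ D, omega p n x y = 0 := fun x hx y hy => hy x hx
  have hDC : ∀ x ∈ D, ∀ y ∈ C, omega p n x y = 0 := fun x hx y hy => by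
    rw [omega_swap, hCD y hy x hx, neg_zero]
  -- `C ⊓ K` is a copy of the quotient of `C` by its radical. A vector of it orthogonal to all of `C
  -- ⊓ K` is orthogonal to `C`, hence lies in `D ⊓ K`, which is zero; so the form is nondegenerate
  -- there.
  obtain ⟨K, hK⟩ := Submodule.exists_isCompl D
  have hsplit : ∀ x ∈ C, ∃ y ∈ D, ∃ z ∈ C ⊓ K, y + z = x := by
    intro x hx
    obtain ⟨y, hy, z, hz, rfl⟩ := Submodule.mem_sup.1
      (hK.sup_eq_top ▸ Submodule.mem_top : x ∈ D ⊔ K)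
    refine ⟨y, hy, z, ⟨?_, hz⟩, rfl⟩
    have := C.sub_mem hx (hC hy)
    rwa [add_sub_cancel_left] at this
  obtain ⟨e, f, hf, hfB⟩ := exists_symplectic_basis omega_isAlt (C ⊓ K) (by
    intro x hx h
    have hxD : x ∈ D := by
      intro y hy
      obtain ⟨y₁, h1, y₂, h2, rfl⟩ := hsplit y hy
      change omega p n _ x = 0
      rw [map_add, LinearMap.add_apply, hDC y₁ h1 x hx.1, omega_swap, h y₂ h2, neg_zero, add_zero]
    exact Submodule.disjoint_def.1 hK.disjoint x hxD hx.2)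
  have hfC : ∀ s, f s ∈ C := fun s => (hf ▸ LinearMap.mem_range_self f s : f s ∈ C ⊓ K).1
  -- The Lagrangian consists of the pairs `(u, s)` with `u` congruent modulo `D` to the image of the
  -- conjugate of `s`. Conjugation reverses the form on the environment, so the two contributions
  -- cancel and the subspace is isotropic.
  let l : Phase p (n + e) →ₗ[ZMod p] Phase p n :=
    LinearMap.funLeft (ZMod p) (ZMod p × ZMod p) (Fin.castAdd e) -
      f ∘ₗ (conjEquiv p e).toLinearMap ∘ₗ
        LinearMap.funLeft (ZMod p) (ZMod p × ZMod p) (Fin.natAdd n)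
  have hl : ∀ v, l v = lft v - f (conjEquiv p e (rgt v)) := fun v => rfl
  have hmem : ∀ v, v ∈ D.comap l ↔ lft v - f (conjEquiv p e (rgt v)) ∈ D := fun v => Iff.rfl
  have homega : ∀ s t, omega p e s t = -omega p n (f (conjEquiv p e s)) (f (conjEquiv p e t)) :=
    fun s t => by rw [hfB, omega_conjEquiv, neg_neg]
  refine ⟨e, D.comap l, ?_, ?_, fun u => ?_⟩
  · intro v hv w hw
    have h1 := hDC _ ((hmem v).1 hv) _ (hC ((hmem w).1 hw))
    have h2 := hDC _ ((hmem v).1 hv) _ (hfC (conjEquiv p e (rgt w)))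
    have h3 := hCD _ (hfC (conjEquiv p e (rgt v))) _ ((hmem w).1 hw)
    rw [omega_word, homega]
    simp only [map_sub, LinearMap.sub_apply] at h1 h2 h3
    linear_combination h1 + h2 + h3
  · intro w hw
    -- The vectors `(y, 0)` with `y ∈ D` belong to the subspace; orthogonality to them puts the
    -- first component in the double complement, which is `C`.
    have hwC : lft w ∈ C := by
      rw [← hDD]
      intro y hy
      have h0 : Fin.append y (0 : Phase p e) ∈ D.comap l := by
        rw [hmem, lft_append, rgt_append, map_zero, map_zero, sub_zero]
        exact hy
      have : omega p (n + e) (Fin.append y (0 : Phase p e)) w = 0 := hw _ h0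
      rw [omega_word, lft_append, rgt_append, map_zero, LinearMap.zero_apply, add_zero] at this
      exact this
    obtain ⟨y, hy, z, hz, hyz⟩ := hsplit _ hwC
    obtain ⟨r, rfl⟩ : z ∈ LinearMap.range f := hf ▸ hz
    -- The vectors `(f s, conj s)` are killed by `l`. Orthogonality to them, together with
    -- nondegeneracy on the environment, matches the environment component with the coordinates of
    -- the symplectic part of `lft w`.
    have hr : r - conjEquiv p e (rgt w) = 0 := by
      refine omega_nondegenerate.2 _ fun s => ?_
      have h0 : Fin.append (f s) (conjEquiv p e s) ∈ D.comap l := by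
        rw [hmem, lft_append, rgt_append, conjEquiv_conjEquiv, sub_self]
        exact D.zero_mem
      have h1 : omega p (n + e) (Fin.append (f s) (conjEquiv p e s)) w = 0 := hw _ h0
      rw [omega_word, lft_append, rgt_append, homega, conjEquiv_conjEquiv, ← hyz, map_add,
        hCD _ (hfC s) y hy, hfB, hfB] at h1
      rw [map_sub]
      linear_combination h1
    rw [hmem, ← hyz, sub_eq_zero.1 hr, add_sub_cancel_right]
    exact hy
  · constructor
    · intro hu
      obtain ⟨y, hy, z, hz, rfl⟩ := hsplit u hu
      obtain ⟨r, rfl⟩ : z ∈ LinearMap.range f := hf ▸ hz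
      refine ⟨conjEquiv p e r, ?_⟩
      rw [hmem, lft_append, rgt_append, conjEquiv_conjEquiv, add_sub_cancel_right]
      exact hy
    · rintro ⟨s, hs⟩
      rw [hmem, lft_append, rgt_append] at hs
      have := C.add_mem (hC hs) (hfC (conjEquiv p e s))
      rwa [sub_add_cancel] at this

/-! ### Realisation of coisotropic relations -/

/-- The superoperator of some mixed stabiliser map. -/
def Realizable (M : Mx (ZMod p × ZMod p) a b) : Prop :=
  ∃ f : (⟨⟨a⟩⟩ : CPMStab p) ⟶ ⟨⟨b⟩⟩, CPMStab.toMx f = M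

namespace Realizable

theorem dbl {f : Mx (ZMod p) a b} (hf : IsStab f) : Realizable (Mx.dbl f) :=
  ⟨(CPMStab.pure p).map (X := ⟨a⟩) (Y := ⟨b⟩) ⟨f, hf⟩, CPMStab.toMx_pure _⟩

theorem relabel (σ : Fin b ≃ Fin a) :
    Realizable (Mx.relabel σ : Mx (ZMod p × ZMod p) a b) := by
  rw [← dbl_relabel]
  exact .dbl (isStab_relabel σ)

theorem one : Realizable (1 : Mx (ZMod p × ZMod p) a a) := by
  rw [← relabel_refl]
  exact .relabel _

theorem cup : Realizable (Mx.cup n : Mx (ZMod p × ZMod p) 0 (n + n)) := by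
  rw [← dbl_cup]
  exact .dbl (isStab_cup n)

theorem mul {M : Mx (ZMod p × ZMod p) a b} {N : Mx (ZMod p × ZMod p) b c} (hN : Realizable N)
    (hM : Realizable M) : Realizable (N * M) := by
  obtain ⟨f, rfl⟩ := hM
  obtain ⟨g, rfl⟩ := hN
  exact ⟨f ≫ g, CPMStab.toMx_comp f g⟩

theorem tens {M : Mx (ZMod p × ZMod p) a b} {N : Mx (ZMod p × ZMod p) c d} (hM : Realizable M)
    (hN : Realizable N) : Realizable (Mx.tens M N) := by
  obtain ⟨f, rfl⟩ := hM
  obtain ⟨g, rfl⟩ := hN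
  exact ⟨CPMStab.tensor f g, CPMStab.toMx_tensor f g⟩

theorem conjTranspose {M : Mx (ZMod p × ZMod p) a b} (hM : Realizable M) :
    Realizable M.conjTranspose := by
  obtain ⟨f, rfl⟩ := hM
  exact ⟨CPMStab.dagger f, CPMStab.toMx_dagger f⟩

theorem disc : Realizable (disc p n) := by
  -- The identity on `n` wires, with all of its inputs declared to be environment.
  refine ⟨Quotient.mk _ ⟨⟨n⟩, ⟨Mx.relabel (leftE n), isStab_relabel _⟩⟩, ?_⟩
  change superop (Mx.relabel (leftE n) : Mx (ZMod p) (0 + n) n) = _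
  ext y x
  have h : ∀ (z : Fin 0 → ZMod p) (i : Fin n → ZMod p), Fin.append z i ∘ leftE n = i := fun z i => by
    rw [← rgt_eq_leftE, rgt_append]
  simp only [superop, Matrix.of_apply, relabel_apply, h, Wigner.disc]
  by_cases h' : fstW y = sndW y <;> simp [h', eq_comm]

/-- Bending the input wires of a superoperator. -/
theorem bend {M : Mx (ZMod p × ZMod p) 0 (a + b)} (hM : Realizable M) :
    Realizable (Matrix.of fun y x => M (Fin.append x y) default : Mx (ZMod p × ZMod p) a b) := by
  have h : (Mx.relabel (leftE b) : Mx (ZMod p × ZMod p) _ _) *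
      (Mx.tens (Mx.cup a : Mx (ZMod p × ZMod p) 0 (a + a)).conjTranspose
        (1 : Mx (ZMod p × ZMod p) b b) *
      ((Mx.relabel (assocE a a b).symm : Mx (ZMod p × ZMod p) _ _) *
      (Mx.tens (1 : Mx (ZMod p × ZMod p) a a) M *
      (Mx.relabel (rightE a).symm : Mx (ZMod p × ZMod p) _ _)))) =
      (Matrix.of fun y x => M (Fin.append x y) default : Mx (ZMod p × ZMod p) a b) := by
    ext y x
    have h0 : lft (x ∘ (rightE a).symm) = x := rfl
    have h1 : rgt (y ∘ (leftE b).symm) = y := by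
      rw [rgt_eq_leftE]; funext i; simp
    have h2 : ∀ w : Phase p (a + a + b), lft (w ∘ (assocE a a b).symm.symm) = lft (lft w) :=
      fun _ => rfl
    have h3 : ∀ (u v : Phase p a) (w : Phase p b),
        rgt (Fin.append (Fin.append u v) w ∘ (assocE a a b).symm.symm) = Fin.append v w :=
      fun u v w => word_ext (by simp [lft_rgt_assocE]) (by simp [rgt_rgt_assocE])
    rw [relabel_mul, Matrix.mul_apply]
    simp only [relabel_mul, mul_relabel, tens_apply, sum_word, lft_append, rgt_append, h0, h1, h2, h3,
      Matrix.conjTranspose_apply, cup_apply, Matrix.one_apply]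
    simp only [apply_ite star, star_one, star_zero, ite_mul, one_mul, zero_mul, mul_ite, mul_zero,
      Finset.sum_ite_eq, Finset.sum_ite_eq', Finset.mem_univ, if_true, Finset.sum_ite_irrel,
      Finset.sum_const_zero]
    exact congrArg _ (wordZero_ext _ _)
  rw [← h]
  exact (relabel _).mul (((cup.conjTranspose.tens one)).mul ((relabel _).mul
    ((one.tens hM).mul (relabel _))))

end Realizable

/-- A wire treated as an input is transformed by the conjugate of the matrix used for an output, and
conjugation negates momenta; the scalar is the normalisation of `wig` for the new inputs. -/
theorem wig_bend (M : Mx (ZMod p × ZMod p) 0 (a + b)) (w : Phase p b) (v : Phase p a) :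
    wig (Matrix.of fun y x => M (Fin.append x y) default : Mx (ZMod p × ZMod p) a b) w v =
      ((p : ℂ) ^ a)⁻¹ * wig M (Fin.append (conjEquiv p a v) w) default := by
  rw [wig_state_apply, sum_word]
  simp only [wignerF_append, lft_append, rgt_append]
  rw [wig, Matrix.smul_apply, smul_eq_mul, Matrix.mul_apply]
  congr 1
  refine Finset.sum_congr rfl fun x _ => ?_
  rw [Matrix.mul_apply, Matrix.conjTranspose_apply, star_wignerF, Finset.sum_mul]
  refine Finset.sum_congr rfl fun y _ => ?_
  rw [Matrix.of_apply]
  ring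

/-- The position eigenspace, a Lagrangian subspace. -/
def positionZero (p n : ℕ) [Fact p.Prime] : Submodule (ZMod p) (Phase p n) where
  carrier := {v | fstW v = 0}
  add_mem' {v w} hv hw := by
    change fstW v + fstW w = 0
    rw [show fstW v = 0 from hv, show fstW w = 0 from hw, add_zero]
  zero_mem' := rfl
  smul_mem' c v hv := by
    change c • fstW v = 0
    rw [show fstW v = 0 from hv, smul_zero]

theorem orthogonal_positionZero :
    (omega p n).orthogonal (positionZero p n) ≤ positionZero p n := by
  intro w hw
  refine dotProduct_eq _ _ fun z => ?_
  have : omega p n (pairW 0 z) w = 0 := hw (pairW 0 z) rfl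
  rw [omega_apply, fstW_pairW, sndW_pairW, zero_dotProduct, sub_zero] at this
  rw [dotProduct_comm, this, zero_dotProduct]

section Odd

variable [NeZero (2 : ZMod p)]

/-- A Lagrangian purification of `C` carries a stabiliser state, translated by `u₀` on the system
and by zero on the environment. Discarding the environment composes with the converse of a full
relation, which projects the Lagrangian onto `C`. -/
theorem exists_realizable_state (C : Submodule (ZMod p) (Phase p n))
    (hC : (omega p n).orthogonal C ≤ C) (u₀ : Phase p n) :
    ∃ (M : Mx (ZMod p × ZMod p) 0 n) (R : std p 0 ⟶ std p n), Realizable M ∧ HasRel M R ∧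
      ∀ z u, Related R z u ↔ u - u₀ ∈ C := by
  obtain ⟨e, L, hL, hL', hLC⟩ := exists_lagrangian C hC
  obtain ⟨ψ, hψ, h1, h2⟩ := isStab_of_lagrangian hL hL' (Fin.append u₀ 0)
  obtain ⟨S, hS, hS'⟩ := hasRel_ket hL hL' h1 h2
  refine ⟨(relabel (rightE n) : Mx (ZMod p × ZMod p) _ _) *
    (tens (1 : Mx (ZMod p × ZMod p) n n) (disc p e).conjTranspose * dbl (ket ψ)), _,
    (Realizable.relabel _).mul ((Realizable.one.tens Realizable.disc.conjTranspose).mul (.dbl hψ)),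
    (hS.comp (HasRel.one.tens hasRel_disc.conjTranspose)).comp (HasRel.relabel _), fun z u => ?_⟩
  rw [hLC]
  constructor
  · rintro ⟨x, ⟨y, h3, h4⟩, h5⟩
    change Phase p (n + e) at y
    change Phase p (n + 0) at x
    have h3 : y - Fin.append u₀ 0 ∈ L := (hS' z y).1 h3
    have h4 : lft x = lft y := ((related_relTens _ _ y x).1 h4).1
    have h5 : u = lft x := h5
    refine ⟨rgt y, ?_⟩
    convert h3 using 1
    refine word_ext ?_ ?_
    · rw [lft_append, h5, h4, lft_sub, lft_append]
    · rw [rgt_append, rgt_sub, rgt_append, sub_zero]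
  · rintro ⟨s, hs⟩
    refine ⟨(Fin.append u 0 : Phase p (n + 0)), ⟨(Fin.append u s : Phase p (n + e)), ?_, ?_⟩, ?_⟩
    · refine (hS' z _).2 ?_
      convert hs using 1
      refine word_ext ?_ ?_
      · rw [lft_append, lft_sub, lft_append, lft_append]
      · rw [rgt_append, rgt_sub, rgt_append, rgt_append, sub_zero]
    · refine (related_relTens _ _ _ _).2 ⟨?_, related_fullHom _ _⟩
      rw [lft_append, lft_append]
      rfl
    · exact (append_zero_rightE u).symm

/-- Negating the momenta of the inputs carries `-ω ⊕ ω` to the standard form on `a + b` wires, so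
the direction of `R` becomes coisotropic there and is realised by a state. Bending the first `a`
wires back restores both the inputs and their momenta. -/
theorem exists_realizable_of_related {R : std p a ⟶ std p b} {v₀ : Phase p a} {w₀ : Phase p b}
    (h₀ : Related R v₀ w₀) : ∃ M : Mx (ZMod p × ZMod p) a b, Realizable M ∧ HasRel M R := by
  let l : Phase p (a + b) →ₗ[ZMod p] Phase p a × Phase p b :=
    ((conjEquiv p a).toLinearMap ∘ₗ
      LinearMap.funLeft (ZMod p) (ZMod p × ZMod p) (Fin.castAdd b)).prod
      (LinearMap.funLeft (ZMod p) (ZMod p × ZMod p) (Fin.natAdd a))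
  have hmem : ∀ x, x ∈ (direction R).comap l ↔ (conjEquiv p a (lft x), rgt x) ∈ direction R :=
    fun x => Iff.rfl
  have hC : (omega p (a + b)).orthogonal ((direction R).comap l) ≤ (direction R).comap l := by
    intro x hx
    refine (hmem x).2 (R.2 ⟨_, h₀⟩ ?_)
    rintro ⟨α, β⟩ hαβ
    have h : Fin.append (conjEquiv p a α) β ∈ (direction R).comap l := by
      rw [hmem, lft_append, rgt_append, conjEquiv_conjEquiv]
      exact hαβ
    have h1 : omega p (a + b) (Fin.append (conjEquiv p a α) β) x = 0 := hx _ h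
    change -omega p a α (conjEquiv p a (lft x)) + omega p b β (rgt x) = 0
    rw [omega_word, lft_append, rgt_append] at h1
    have h2 := omega_conjEquiv α (conjEquiv p a (lft x))
    rw [conjEquiv_conjEquiv] at h2
    rw [← h2, h1]
  obtain ⟨M, S, hM, ⟨k, hk⟩, hS'⟩ := exists_realizable_state _ hC (Fin.append (conjEquiv p a v₀) w₀)
  refine ⟨_, hM.bend, k - a, fun w v => ?_⟩
  have hrel : Related R v w ↔ Related S default (Fin.append (conjEquiv p a v) w) := by
    rw [hS', hmem, h₀.iff_sub]
    have e1 : lft (Fin.append (conjEquiv p a v) w - Fin.append (conjEquiv p a v₀) w₀) =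
        conjEquiv p a v - conjEquiv p a v₀ := by
      rw [lft_sub, lft_append, lft_append]
    have e2 : rgt (Fin.append (conjEquiv p a v) w - Fin.append (conjEquiv p a v₀) w₀) = w - w₀ := by
      rw [rgt_sub, rgt_append, rgt_append]
    rw [e1, e2, map_sub, conjEquiv_conjEquiv, conjEquiv_conjEquiv]
  rw [hrel, wig_bend]
  refine ⟨fun h => ?_, fun h => ?_⟩
  · rw [(hk _ _).1 h, zpow_sub₀ p_ne_zero, zpow_natCast, div_eq_mul_inv, mul_comm]
  · rw [(hk _ _).2 h, mul_zero]

theorem exists_realizable (R : std p a ⟶ std p b) :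
    ∃ M : Mx (ZMod p × ZMod p) a b, Realizable M ∧ HasRel M R := by
  by_cases h : ∃ v w, Related R v w
  · obtain ⟨v, w, h⟩ := h
    exact exists_realizable_of_related h
  push Not at h
  -- The empty relation has no linear component to purify. It is instead the composite of two
  -- nonempty relations through one wire: the first reaches only position `0`, the second accepts
  -- only position `1`.
  have hA : (sumForm (-(std p a).form) (std p 1).form).orthogonal
      ((positionZero p 1).comap (LinearMap.snd (ZMod p) (Phase p a) (Phase p 1))) ≤
      (positionZero p 1).comap (LinearMap.snd (ZMod p) (Phase p a) (Phase p 1)) := by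
    rintro ⟨v, w⟩ h
    refine orthogonal_positionZero fun x hx => ?_
    have : -omega p a 0 v + omega p 1 x w = 0 := h (0, x) hx
    rwa [map_zero, LinearMap.zero_apply, neg_zero, zero_add] at this
  have hB : (sumForm (-(std p 1).form) (std p b).form).orthogonal
      ((positionZero p 1).comap (LinearMap.fst (ZMod p) (Phase p 1) (Phase p b))) ≤
      (positionZero p 1).comap (LinearMap.fst (ZMod p) (Phase p 1) (Phase p b)) := by
    rintro ⟨w, v⟩ h
    refine orthogonal_positionZero fun x hx => ?_
    have : -omega p 1 x w + omega p b 0 v = 0 := h (x, 0) hx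
    rw [map_zero, LinearMap.zero_apply, add_zero, neg_eq_zero] at this
    exact this
  let A : std p a ⟶ std p 1 := affHom _ hA 0
  let B : std p 1 ⟶ std p b := affHom _ hB (pairW 1 0, 0)
  have hA' : ∀ v w, Related A v w ↔ fstW w = 0 := fun v w => by
    refine mem_affHom.trans ?_
    change fstW (w - 0) = 0 ↔ _
    rw [sub_zero]
  have hB' : ∀ w v, Related B w v ↔ fstW w = 1 := fun w v => by
    refine mem_affHom.trans ?_
    change fstW w - 1 = 0 ↔ _
    rw [sub_eq_zero]
  obtain ⟨M, hM, hMA⟩ := exists_realizable_of_related ((hA' 0 0).2 rfl)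
  obtain ⟨N, hN, hNB⟩ := exists_realizable_of_related ((hB' (pairW 1 0) 0).2 rfl)
  refine ⟨N * M, hN.mul hM, ?_⟩
  have hR : R = A ≫ B := related_ext fun v u => by
    refine iff_of_false (h v u) ?_
    rintro ⟨w, h1, h2⟩
    have h1 := (hA' v w).1 h1
    have h2 := (hB' w u).1 h2
    rw [h1] at h2
    exact zero_ne_one (congrFun h2 0)
  rw [hR]
  exact hMA.comp hNB

/-! ### The equivalence -/

instance : (relFunctor p).Full where
  map_surjective {X Y} R := by
    obtain ⟨M, ⟨f, rfl⟩, h⟩ := exists_realizable (p := p) R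
    exact ⟨Quotient.mk _ f, relOf_eq h⟩

/-- Equal relations give Wigner transforms that differ by a power of `p`, and this power is an
invertible scalar, so the two maps agree in the projectivisation. -/
instance : (relFunctor p).Faithful where
  map_injective {X Y} := by
    rintro ⟨f⟩ ⟨g⟩ h
    have h : relOf f = relOf g := h
    obtain ⟨k, hk⟩ := (hasRel_relOf f).exists_smul (h ▸ hasRel_relOf g)
    obtain ⟨s, hs⟩ := exists_scalar_iso (p := p) k
    exact Quotient.sound ⟨s, CPMStab.toMx_injective (by rw [toMx_scale, hs, hk])⟩

instance : (relFunctor p).EssSurj where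
  mem_essImage V := by
    obtain ⟨n, ⟨e⟩⟩ := exists_iso_std V
    exact ⟨⟨⟨⟨n⟩⟩⟩, ⟨e⟩⟩

end Odd

/-! ### The quotient functor and the theorem -/

instance (C : Type u) [Category.{v} C] [MonoidalCategory C] : (Proj.quot C).Full where
  map_surjective := Quotient.exists_rep

instance (C : Type u) [Category.{v} C] [MonoidalCategory C] : (Proj.quot C).EssSurj where
  mem_essImage X := ⟨X.obj, ⟨Iso.refl _⟩⟩

end Wigner

theorem mainTheorem1 (p : ℕ) [Fact p.Prime] (hp : p ≠ 2) :
    ∃ Rel : DaggerCompactFunctor (CPMStab p) (ACR p),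
      Rel.functor.EssSurj ∧ Rel.functor.Full ∧
      ∃ E : DaggerCompactFunctor (Proj (CPMStab p)) (ACR p),
        E.functor.IsEquivalence ∧ Rel = (Proj.proj (CPMStab p)).comp E := by
  -- Oddness of `p` enters only as invertibility of `2`, on which the halved Weyl phases and the
  -- reflections in phase space depend.
  have h2 : NeZero (2 : ZMod p) := ⟨fun h => hp <| by
    have h : ((2 : ℕ) : ZMod p) = 0 := by exact_mod_cast h
    exact (Nat.prime_dvd_prime_iff_eq Fact.out Nat.prime_two).1
      ((ZMod.natCast_eq_zero_iff 2 p).1 h)⟩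
  refine ⟨(Proj.proj (CPMStab p)).comp (Wigner.relDagger p), ?_, ?_, Wigner.relDagger p, ?_, rfl⟩
  · exact inferInstanceAs (Proj.quot (CPMStab p) ⋙ Wigner.relFunctor p).EssSurj
  · exact inferInstanceAs (Proj.quot (CPMStab p) ⋙ Wigner.relFunctor p).Full
  · exact { faithful := inferInstanceAs (Wigner.relFunctor p).Faithful
            full := inferInstanceAs (Wigner.relFunctor p).Full
            essSurj := inferInstanceAs (Wigner.relFunctor p).EssSurj }
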